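/- **Setting.** Let $H\neq 0$ be a complex Hilbert space and let $(A,H,D)$ be a spectral triple: $A$ is a unital self-adjoint algebra of bounded operators on $H$ with norm closure $\mathcal A$, $D$ is a self-adjoint operator on $H$ with $(I+D^2)^{-1}$ compact, and for each $a\in A$ the commutator $[D,a]$, with domain $\{x\in\mathrm{dom}\,D : ax\in\mathrm{dom}\,D\}$, is densely defined and bounded. Let $P$ be an orthogonal projection on $H$ such that * $P$ commutes with $D$, $[P,a]$ is compact for every $a\in\mathcal A$, and $a\mapsto Pa|_{PH}$ modulo compacts is injective from $\mathcal A$ to the Calkin algebra of $PH$; * for each $a\in A$, $[PD,a]$ and $[(I-P)D,a]$ are bounded, and for all $a,b\in A$ the space $\mathrm{dom}[D,a]\cap\mathrm{dom}[D,b]$ intersects $PH$ and $(I-P)H$ in dense subspaces of $PH$ and $(I-P)H$; * $D_p:=D|_{PH}$ has trivial kernel. Write $T(a)=Pa|_{PH}$. Let $A_c$ be the set of compact operators $k$ on $PH$ for which $D_pk$ (everywhere defined) and $kD_p$ are bounded, and put $$A_{\mathcal A}=\{a\in A: a=a^*\},\quad A_{\mathcal C}=\{k+\lambda I: k=k^*\in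 A_c,\ \lambda\in\mathbb R\},\quad A_{\mathcal T}=T(A_{\mathcal A})+A_{\mathcal C},$$ which are order-unit spaces in the operator order, with unit $I$. On $K=PH\oplus H$ let $\pi(T(a)+k)=(T(a)+k)\oplus a$, and for $\alpha,\beta>0$ let $$D_{\alpha,\beta}(x,y)=(\beta D_pPy,\ \beta D_px+\tfrac1\alpha Dy)\qquad (x\in PH\cap\mathrm{dom}\,D,\ y\in\mathrm{dom}\,D).$$ Define $L_{\mathcal A}(a)=\|[D,a]\|$, $L_{\mathcal C}(k+\lambda I)=\|D_pk\|$ and $L_{\alpha,\beta}(t)=\|[D_{\alpha,\beta},\pi(t)]\|$ on $A_{\mathcal A}$, $A_{\mathcal C}$ and $A_{\mathcal T}$ respectively. A Lip-norm on an order-unit space $(B,e)$ is a seminorm $L$ with null space $\mathbb Re$ such that $\rho_L(\mu,\nu)=\sup\{|\mu(b)-\nu(b)|: L(b)\le1\}$ induces the weak-* topology on the state space $S(B)$; then $(B,L)$ is called a compact quantum metric space. The quantum Gromov–Hausdorff distance $\mathrm{dist}_q$ between $(B_1,L_1)$ and $(B_2,L_2)$ is the infimum, over all Lip-norms $L$ on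 $B_1\oplus B_2$ whose quotient seminorms on $B_1$ and $B_2$ are $L_1$ and $L_2$, of the Hausdorff distance for $\rho_L$ between $S(B_1)$ and $S(B_2)$ inside $S(B_1\oplus B_2)$. Assume that $L_{\mathcal A}$ is a Lip-norm. Let $$\mathcal P=\{(\alpha,\beta)\in\mathbb R^2:\alpha\ge0,\ \beta>0,\ \alpha\beta\le1\}\cup\{(0,\infty)\},$$ and attach to the points of $\mathcal P$ the pairs $(A_{\mathcal T},L_{\alpha,\beta})$ for $0<\alpha$, $(A_{\mathcal C},\beta L_{\mathcal C})$ for $\alpha=0$, $\beta<\infty$, and the one-point space $(\mathbb R,0)$ for $(0,\infty)$. **Proposition.** All these pairs are compact quantum metric spaces; $\mathrm{dist}_q$ between them is finite and defines a pseudometric on $\mathcal P$; and for every $\beta_0>0$ the subset $\mathcal P_{\beta_0}=\{(\alpha,\beta)\in\mathcal P:\beta\ge\beta_0\}$ is compact in the topology of this pseudometric. -/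

import Mathlib

open scoped ENNReal

universe u

noncomputable section

namespace QMS

/-! ### Order-unit spaces and compact quantum metric spaces -/

/-- An order-unit space: a real partially ordered vector space with an order unit,
satisfying the order unit property and the Archimedean property. -/
structure OrderUnitSpace where
  carrier : Type u
  [addCommGroup : AddCommGroup carrier]
  [module : Module ℝ carrier]
  [partialOrder : PartialOrder carrier]
  [isOrderedAddMonoid : IsOrderedAddMonoid carrier]
  [posSMulMono : PosSMulMono ℝ carrier]
  unit : carrier
  unit_nonneg : 0 ≤ unit
  exists_le : ∀ a : carrier, ∃ r : ℝ, a ≤ r • unit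
  archimedean : ∀ a : carrier, (∀ r : ℝ, 0 < r → a ≤ r • unit) → a ≤ 0

namespace OrderUnitSpace

instance : CoeSort OrderUnitSpace.{u} (Type u) := ⟨carrier⟩

attribute [instance] addCommGroup module partialOrder isOrderedAddMonoid posSMulMono

/-- A state of `A`: a linear functional `μ` with `μ(e) = 1 = ‖μ‖`, where the dual norm is taken
with respect to the order-unit norm `‖a‖ = inf {r | -r e ≤ a ≤ r e}`.  (As `‖e‖ ≤ 1`, the
condition `μ(e) = 1` gives `‖μ‖ ≥ 1`; the second condition is `‖μ‖ ≤ 1`.) -/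
def State (A : OrderUnitSpace.{u}) : Type u :=
  {μ : A →ₗ[ℝ] ℝ // μ A.unit = 1 ∧
    ∀ (a : A) (r : ℝ), -(r • A.unit) ≤ a → a ≤ r • A.unit → |μ a| ≤ r}

instance (A : OrderUnitSpace.{u}) : CoeFun A.State (fun _ => A → ℝ) := ⟨fun μ => ⇑μ.1⟩

/-- The weak-* topology on the state space. -/
@[reducible] def weakStar (A : OrderUnitSpace.{u}) : TopologicalSpace A.State :=
  TopologicalSpace.induced (fun (μ : A.State) (a : A) => μ a) Pi.topologicalSpace

/-- `ρ_L(μ, ν) = sup {|μ(a) - ν(a)| : L(a) ≤ 1}`, possibly infinite. -/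
def rho {A : OrderUnitSpace.{u}} (L : A → ℝ) (μ ν : A.State) : ℝ≥0∞ :=
  ⨆ (a : A) (_ : L a ≤ 1), ENNReal.ofReal |μ a - ν a|

/-- `ρ_L` as an extended pseudometric on the state space. -/
@[reducible] def rhoSpace {A : OrderUnitSpace.{u}} (L : A → ℝ) : PseudoEMetricSpace A.State where
  edist := rho L
  edist_self μ := by simp [rho]
  edist_comm μ ν := by simp only [rho, abs_sub_comm]
  edist_triangle μ ν τ := by
    refine iSup₂_le fun a ha => ?_
    calc ENNReal.ofReal |μ a - τ a|
        ≤ ENNReal.ofReal (|μ a - ν a| + |ν a - τ a|) :=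
          ENNReal.ofReal_le_ofReal (abs_sub_le _ _ _)
      _ = ENNReal.ofReal |μ a - ν a| + ENNReal.ofReal |ν a - τ a| :=
          ENNReal.ofReal_add (abs_nonneg _) (abs_nonneg _)
      _ ≤ rho L μ ν + rho L ν τ := by
          gcongr
          · exact le_iSup₂_of_le (f := fun (a : A) (_ : L a ≤ 1) =>
              ENNReal.ofReal |μ a - ν a|) a ha le_rfl
          · exact le_iSup₂_of_le (f := fun (a : A) (_ : L a ≤ 1) =>
              ENNReal.ofReal |ν a - τ a|) a ha le_rfl

/-- A Lip-norm on `A`: a seminorm with null space `ℝ e` for which the topology of `ρ_L` on the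
state space is the weak-* topology. -/
structure IsLipNorm {A : OrderUnitSpace.{u}} (L : A → ℝ) : Prop where
  add_le : ∀ a b, L (a + b) ≤ L a + L b
  smul : ∀ (r : ℝ) (a : A), L (r • a) = |r| * L a
  eq_zero_iff : ∀ a, L a = 0 ↔ ∃ r : ℝ, a = r • A.unit
  topology_eq : (rhoSpace L).toUniformSpace.toTopologicalSpace = A.weakStar

/-- The direct sum of two order-unit spaces, with unit `(e_A, e_B)`. -/
def prod (A B : OrderUnitSpace.{u}) : OrderUnitSpace.{u} where
  carrier := A × B
  posSMulMono := ⟨fun _ ha _ _ h => Prod.mk_le_mk.2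
    ⟨smul_le_smul_of_nonneg_left (Prod.le_def.1 h).1 ha,
      smul_le_smul_of_nonneg_left (Prod.le_def.1 h).2 ha⟩⟩
  unit := (A.unit, B.unit)
  unit_nonneg := ⟨A.unit_nonneg, B.unit_nonneg⟩
  exists_le := by
    rintro ⟨a, b⟩
    obtain ⟨r, hr⟩ := A.exists_le a
    obtain ⟨s, hs⟩ := B.exists_le b
    exact ⟨max r s, hr.trans (smul_le_smul_of_nonneg_right (le_max_left r s) A.unit_nonneg),
      hs.trans (smul_le_smul_of_nonneg_right (le_max_right r s) B.unit_nonneg)⟩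
  archimedean := fun a h =>
    ⟨A.archimedean _ fun r hr => (h r hr).1, B.archimedean _ fun r hr => (h r hr).2⟩

/-- A state of `A` viewed as a state of `A ⊕ B`, through the quotient map `A ⊕ B → A`. -/
def State.inl {A : OrderUnitSpace.{u}} (B : OrderUnitSpace.{u}) (μ : A.State) :
    (A.prod B).State :=
  ⟨μ.1.comp (LinearMap.fst ℝ A B), μ.2.1, fun a r h₁ h₂ => μ.2.2 a.1 r h₁.1 h₂.1⟩

/-- A state of `B` viewed as a state of `A ⊕ B`, through the quotient map `A ⊕ B → B`. -/
def State.inr (A : OrderUnitSpace.{u}) {B : OrderUnitSpace.{u}} (ν : B.State) :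
    (A.prod B).State :=
  ⟨ν.1.comp (LinearMap.snd ℝ A B), ν.2.1, fun a r h₁ h₂ => ν.2.2 a.2 r h₁.2 h₂.2⟩

/-- The set `M(L_A, L_B)` of Lip-norms on `A ⊕ B` whose quotient seminorms on `A` and on `B`
are `L_A` and `L_B`. -/
def bridges {A B : OrderUnitSpace.{u}} (LA : A → ℝ) (LB : B → ℝ) : Set (A.prod B → ℝ) :=
  {L | IsLipNorm L ∧ (∀ a : A, LA a = ⨅ b : B, L (a, b)) ∧ (∀ b : B, LB b = ⨅ a : A, L (a, b))}

end OrderUnitSpace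

open OrderUnitSpace

/-- A pair `(A, L)` of an order-unit space and a real function on it. -/
structure OrderUnitPair where
  A : OrderUnitSpace.{u}
  L : A → ℝ

/-- A compact quantum metric space is a pair `(A, L)` for which `L` is a Lip-norm. -/
def OrderUnitPair.IsCompactQuantumMetricSpace (X : OrderUnitPair.{u}) : Prop := IsLipNorm X.L

/-- The quantum Gromov-Hausdorff distance: the infimum over `L ∈ M(L_A, L_B)` of the Hausdorff
distance for `ρ_L` between the copies of `S(A)` and `S(B)` in `S(A ⊕ B)`. -/
def distQ (X Y : OrderUnitPair.{u}) : ℝ≥0∞ :=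
  ⨅ L ∈ bridges X.L Y.L,
    @Metric.hausdorffEDist (X.A.prod Y.A).State (rhoSpace L)
      (Set.range (State.inl Y.A)) (Set.range (State.inr X.A))

/-- The one-point order-unit space `ℝ`. -/
def OrderUnitSpace.real : OrderUnitSpace.{u} where
  carrier := ULift.{u} ℝ
  isOrderedAddMonoid :=
    { add_le_add_left := fun a b h c => by
        have h' : a.down ≤ b.down := h
        change a.down + c.down ≤ b.down + c.down
        linarith }
  posSMulMono := ⟨fun _ ha _ _ h => mul_le_mul_of_nonneg_left (α := ℝ) h ha⟩
  unit := ⟨1⟩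
  unit_nonneg := zero_le_one (α := ℝ)
  exists_le a := ⟨a.down, by change a.down ≤ a.down * 1; simp⟩
  archimedean a h := by
    change a.down ≤ 0
    refine le_of_forall_pos_le_add fun r hr => ?_
    have : a.down ≤ r * 1 := h r hr
    linarith

section Operators

variable {E : Type u} [NormedAddCommGroup E] [InnerProductSpace ℂ E]

lemma le_iff_re_inner [CompleteSpace E] {a b : E →L[ℂ] E} (ha : IsSelfAdjoint a)
    (hb : IsSelfAdjoint b) :
    a ≤ b ↔ ∀ x, RCLike.re (inner ℂ (a x) x) ≤ RCLike.re (inner ℂ (b x) x) := by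
  rw [ContinuousLinearMap.le_def, ContinuousLinearMap.isPositive_def']
  simp [hb.sub ha, ContinuousLinearMap.reApplyInnerSelf_apply, inner_sub_left]

lemma isSelfAdjoint_smul_one [CompleteSpace E] (r : ℝ) :
    IsSelfAdjoint (r • (1 : E →L[ℂ] E)) :=
  (IsSelfAdjoint.all r).smul (IsSelfAdjoint.one _)

lemma re_inner_smul_one (r : ℝ) (x : E) :
    RCLike.re (inner ℂ ((r • (1 : E →L[ℂ] E)) x) x) = r * ‖x‖ ^ 2 := by
  have h : inner ℂ ((r • (1 : E →L[ℂ] E)) x) x = ((r * ‖x‖ ^ 2 : ℝ) : ℂ) := by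
    simp [inner_smul_left_eq_smul, inner_self_eq_norm_sq_to_K]
  rw [h]; exact RCLike.ofReal_re _

/-- A real linear space of self-adjoint bounded operators that contains the identity, with the
operator order, is an order-unit space with the identity as order unit. -/
def ofOperators [CompleteSpace E] (S : Submodule ℝ (E →L[ℂ] E))
    (hS : ∀ a ∈ S, IsSelfAdjoint a) (h1 : (1 : E →L[ℂ] E) ∈ S) : OrderUnitSpace.{u} where
  carrier := S
  isOrderedAddMonoid :=
    { add_le_add_left := fun a b h c => by
        have h' : a.1 ≤ b.1 := h
        change a.1 + c.1 ≤ b.1 + c.1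
        simpa [ContinuousLinearMap.le_def] using h' }
  posSMulMono := ⟨fun r hr a b h => by
    have h' := (le_iff_re_inner (hS a a.2) (hS b b.2)).1 h
    refine (le_iff_re_inner (hS _ (r • a).2) (hS _ (r • b).2)).2 fun x => ?_
    simpa [inner_smul_left_eq_smul] using mul_le_mul_of_nonneg_left (h' x) hr⟩
  unit := ⟨1, h1⟩
  unit_nonneg := by
    refine (le_iff_re_inner (hS _ (0 : S).2) (hS _ h1)).2 fun x => ?_
    simpa using inner_self_nonneg (𝕜 := ℂ) (x := x)
  exists_le a := ⟨‖a.1‖, by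
    refine (le_iff_re_inner (hS a a.2) (isSelfAdjoint_smul_one _)).2 fun x => ?_
    rw [re_inner_smul_one]
    calc RCLike.re (inner ℂ (a.1 x) x) ≤ ‖inner ℂ (a.1 x) x‖ := RCLike.re_le_norm _
      _ ≤ ‖a.1 x‖ * ‖x‖ := norm_inner_le_norm _ _
      _ ≤ ‖a.1‖ * ‖x‖ * ‖x‖ := by gcongr; exact a.1.le_opNorm x
      _ = ‖a.1‖ * ‖x‖ ^ 2 := by ring⟩
  archimedean a h := by
    refine (le_iff_re_inner (hS a a.2) (hS _ (0 : S).2)).2 fun x => ?_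
    have h' : ∀ r : ℝ, 0 < r → RCLike.re (inner ℂ (a.1 x) x) ≤ r * ‖x‖ ^ 2 := fun r hr => by
      rw [← re_inner_smul_one]
      exact (le_iff_re_inner (hS a a.2) (isSelfAdjoint_smul_one r)).1 (h r hr) x
    have : RCLike.re (inner ℂ (a.1 x) x) ≤ 0 := by
      refine le_of_forall_pos_le_add fun ε hε => ?_
      refine (h' (ε / (‖x‖ ^ 2 + 1)) (by positivity)).trans ?_
      rw [zero_add, div_mul_eq_mul_div, div_le_iff₀ (by positivity)]
      nlinarith
    simpa using this

end Operators

/-! ### Unbounded operators -/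

section Unbounded

variable {E : Type u} [NormedAddCommGroup E] [InnerProductSpace ℂ E]

/-- The product `D a` of an unbounded operator `D` and a bounded operator `a`, with its natural
domain `{x | a x ∈ dom D}`. -/
def mulRight (D : E →ₗ.[ℂ] E) (a : E →L[ℂ] E) : E →ₗ.[ℂ] E where
  domain := D.domain.comap (a : E →ₗ[ℂ] E)
  toFun := D.toFun ∘ₗ (a : E →ₗ[ℂ] E).restrict (fun _ h => h)

/-- The product `a D` of a bounded operator `a` and an unbounded operator `D`, with its natural
domain `dom D`. -/
def mulLeft (a : E →L[ℂ] E) (D : E →ₗ.[ℂ] E) : E →ₗ.[ℂ] E :=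
  (a : E →ₗ[ℂ] E).compPMap D

/-- The commutator `[D, a] = D a - a D`, with its natural domain `{x ∈ dom D | a x ∈ dom D}`. -/
def comm (D : E →ₗ.[ℂ] E) (a : E →L[ℂ] E) : E →ₗ.[ℂ] E :=
  mulRight D a - mulLeft a D

/-- An operator is bounded if it is bounded on its domain. -/
def IsBdd (f : E →ₗ.[ℂ] E) : Prop :=
  ∃ C : ℝ, ∀ x : f.domain, ‖f x‖ ≤ C * ‖(x : E)‖

/-- The norm of a bounded operator `f`: the least bound on its domain, which is also the norm of
the closure of `f`. -/
def opNorm (f : E →ₗ.[ℂ] E) : ℝ :=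
  sInf {C : ℝ | 0 ≤ C ∧ ∀ x : f.domain, ‖f x‖ ≤ C * ‖(x : E)‖}

/-- `(I + D²)⁻¹` is a compact operator (where `D²` has its natural domain). -/
def HasCompactResolvent (D : E →ₗ.[ℂ] E) : Prop :=
  ∃ R : E →L[ℂ] E, IsCompactOperator R ∧
    (∀ y : E, ∃ (h₁ : R y ∈ D.domain) (h₂ : D ⟨R y, h₁⟩ ∈ D.domain),
      R y + D ⟨D ⟨R y, h₁⟩, h₂⟩ = y) ∧
    (∀ (x : D.domain) (h : D x ∈ D.domain), R ((x : E) + D ⟨D x, h⟩) = x)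

end Unbounded

/-! ### Spectral triples and quadruples of Toeplitz type -/

variable (H : Type u) [NormedAddCommGroup H] [InnerProductSpace ℂ H] [CompleteSpace H]

/-- A spectral triple `(A, H, D)`, where `A` is a unital self-adjoint algebra of bounded operators
on `H`.  It is associated to the C*-algebra given by the norm closure of `A`. -/
structure SpectralTriple where
  A : StarSubalgebra ℂ (H →L[ℂ] H)
  D : H →ₗ.[ℂ] H
  selfAdjoint : IsSelfAdjoint D
  comm_dense : ∀ a ∈ A, Dense ((comm D a).domain : Set H)
  comm_bdd : ∀ a ∈ A, IsBdd (comm D a)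
  compactResolvent : HasCompactResolvent D

variable {H}

namespace SpectralTriple

variable (X : SpectralTriple H)

/-- The C*-algebra to which the spectral triple is associated. -/
def cstar : StarSubalgebra ℂ (H →L[ℂ] H) := X.A.topologicalClosure

/-- The order-unit space `{a ∈ A | a = a*}`. -/
def ouA : OrderUnitSpace.{u} :=
  ofOperators
    { carrier := {a | a ∈ X.A ∧ IsSelfAdjoint a}
      add_mem' := fun ha hb => ⟨add_mem ha.1 hb.1, ha.2.add hb.2⟩
      zero_mem' := ⟨zero_mem _, IsSelfAdjoint.zero _⟩
      smul_mem' := fun r a ha => ⟨by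
        rw [← Complex.coe_smul]; exact X.A.smul_mem ha.1 (r : ℂ), (IsSelfAdjoint.all r).smul ha.2⟩ }
    (fun _ ha => ha.2) ⟨one_mem _, IsSelfAdjoint.one _⟩

/-- `L_A(a) = ‖[D, a]‖`. -/
def LA (a : X.ouA) : ℝ := opNorm (comm X.D a.1)

end SpectralTriple

/-- The compression `P a | PH` of `a` to the closed subspace `V = PH`. -/
def compress (V : Submodule ℂ H) [CompleteSpace V] (a : H →L[ℂ] H) : V →L[ℂ] V :=
  V.orthogonalProjectionOnto ∘L a ∘L V.subtypeL

variable (H)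

/-- A quadruple `((A, H, D), P)` of Toeplitz type.  The orthogonal projection `P` is given by its
range `V = PH`, so that `P = V.starProjection` and `I - P = Vᗮ.starProjection`. -/
structure ToeplitzQuadruple extends SpectralTriple H where
  V : Submodule ℂ H
  [complete : CompleteSpace V]
  /-- `P` commutes with `D`, that is, `P D ⊆ D P`. -/
  commutes : ∀ x : D.domain, ∃ h : V.starProjection x ∈ D.domain,
    D ⟨V.starProjection x, h⟩ = V.starProjection (D x)
  /-- `P` commutes with the C*-algebra modulo the compact operators. -/
  comm_compact : ∀ a ∈ toSpectralTriple.cstar,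
    IsCompactOperator (V.starProjection * a - a * V.starProjection)
  /-- The map `a ↦ P a | PH` into the Calkin algebra of `PH` is injective on the C*-algebra. -/
  faithful : ∀ a ∈ toSpectralTriple.cstar, ∀ b ∈ toSpectralTriple.cstar,
    IsCompactOperator (compress V a - compress V b) → a = b
  /-- `[P D, a]` is bounded. -/
  comm_P_bdd : ∀ a ∈ A, IsBdd (comm (mulLeft V.starProjection D) a)
  /-- `[(I - P) D, a]` is bounded. -/
  comm_Q_bdd : ∀ a ∈ A, IsBdd (comm (mulLeft Vᗮ.starProjection D) a)
  /-- The common domain of any two commutators intersects `PH` in a dense subspace of `PH`. -/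
  dense_P : ∀ a ∈ A, ∀ b ∈ A,
    (V : Set H) ⊆ closure ((comm D a).domain ∩ (comm D b).domain ∩ V)
  /-- The common domain of any two commutators intersects `(I - P) H` in a dense subspace. -/
  dense_Q : ∀ a ∈ A, ∀ b ∈ A,
    (Vᗮ : Set H) ⊆ closure ((comm D a).domain ∩ (comm D b).domain ∩ Vᗮ)
  /-- `D | PH` has trivial kernel. -/
  ker_trivial : ∀ x : D.domain, (x : H) ∈ V → D x = 0 → x = 0

variable {H}

namespace ToeplitzQuadruple

variable (Q : ToeplitzQuadruple H)

/-- The Hilbert space `PH`. -/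
def PH : Type u := Q.V

instance : NormedAddCommGroup Q.PH := inferInstanceAs (NormedAddCommGroup Q.V)
instance : InnerProductSpace ℂ Q.PH := inferInstanceAs (InnerProductSpace ℂ Q.V)
instance : CompleteSpace Q.PH := Q.complete

/-- The inclusion of `PH` into `H`. -/
def incl : Q.PH →L[ℂ] H := Q.V.subtypeL

/-- The orthogonal projection of `H` onto `PH`. -/
def proj : H →L[ℂ] Q.PH :=
  haveI := Q.complete
  Q.V.orthogonalProjectionOnto

/-- The compression `T(a) = P a | PH`. -/
def T (a : H →L[ℂ] H) : Q.PH →L[ℂ] Q.PH := Q.proj ∘L a ∘L Q.incl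

/-- The operator `D_p = D | PH` on `PH`, with domain `dom D ∩ PH`.  (Since `P` commutes with `D`,
it maps into `PH`, and the projection in the formula has no effect.) -/
def Dp : Q.PH →ₗ.[ℂ] Q.PH where
  domain := Q.D.domain.comap (Q.incl : Q.PH →ₗ[ℂ] H)
  toFun := (Q.proj : H →ₗ[ℂ] Q.PH) ∘ₗ Q.D.toFun ∘ₗ
    (Q.incl : Q.PH →ₗ[ℂ] H).restrict (fun _ h => h)

/-- The membership condition of the algebra `A_c` of compact operators `k` on `PH` for which
`D_p k` is bounded and everywhere defined and `k D_p` is bounded. -/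
def memAc (k : Q.PH →L[ℂ] Q.PH) : Prop :=
  IsCompactOperator k ∧ ((mulRight Q.Dp k).domain = ⊤ ∧ IsBdd (mulRight Q.Dp k)) ∧
    IsBdd (mulLeft k Q.Dp)

lemma memAc_add {k l : Q.PH →L[ℂ] Q.PH} (hk : Q.memAc k) (hl : Q.memAc l) :
    Q.memAc (k + l) := by
  obtain ⟨hk1, ⟨hk2, C, hC⟩, C', hC'⟩ := hk
  obtain ⟨hl1, ⟨hl2, B, hB⟩, B', hB'⟩ := hl
  have hk3 : ∀ x, k x ∈ Q.Dp.domain := fun x => by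
    have : x ∈ (mulRight Q.Dp k).domain := by rw [hk2]; trivial
    exact this
  have hl3 : ∀ x, l x ∈ Q.Dp.domain := fun x => by
    have : x ∈ (mulRight Q.Dp l).domain := by rw [hl2]; trivial
    exact this
  refine ⟨hk1.add hl1, ⟨?_, C + B, ?_⟩, C' + B', ?_⟩
  · ext x
    simp only [Submodule.mem_top, iff_true]
    exact add_mem (hk3 x) (hl3 x)
  · rintro ⟨x, hx⟩
    have e : mulRight Q.Dp (k + l) ⟨x, hx⟩
        = mulRight Q.Dp k ⟨x, hk3 x⟩ + mulRight Q.Dp l ⟨x, hl3 x⟩ :=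
      Q.Dp.map_add ⟨k x, hk3 x⟩ ⟨l x, hl3 x⟩
    rw [e, add_mul]
    exact (norm_add_le _ _).trans (add_le_add (hC ⟨x, hk3 x⟩) (hB ⟨x, hl3 x⟩))
  · intro x
    rw [add_mul]
    exact (norm_add_le (k (Q.Dp x)) (l (Q.Dp x))).trans (add_le_add (hC' x) (hB' x))

lemma memAc_smul (r : ℝ) {k : Q.PH →L[ℂ] Q.PH} (hk : Q.memAc k) : Q.memAc (r • k) := by
  obtain ⟨hk1, ⟨hk2, C, hC⟩, C', hC'⟩ := hk
  have hk3 : ∀ x, k x ∈ Q.Dp.domain := fun x => by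
    have : x ∈ (mulRight Q.Dp k).domain := by rw [hk2]; trivial
    exact this
  refine ⟨hk1.smul r, ⟨?_, |r| * C, ?_⟩, |r| * C', ?_⟩
  · ext x
    simp only [Submodule.mem_top, iff_true]
    exact Q.Dp.domain.smul_mem (r : ℂ) (hk3 x)
  · rintro ⟨x, hx⟩
    have e : mulRight Q.Dp (r • k) ⟨x, hx⟩ = (r : ℂ) • mulRight Q.Dp k ⟨x, hk3 x⟩ :=
      Q.Dp.map_smul (r : ℂ) ⟨k x, hk3 x⟩
    rw [e, norm_smul, Complex.norm_real, Real.norm_eq_abs, mul_assoc]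
    exact mul_le_mul_of_nonneg_left (hC ⟨x, hk3 x⟩) (abs_nonneg r)
  · intro x
    have e : mulLeft (r • k) Q.Dp x = (r : ℂ) • mulLeft k Q.Dp x := rfl
    rw [e, norm_smul, Complex.norm_real, Real.norm_eq_abs, mul_assoc]
    exact mul_le_mul_of_nonneg_left (hC' x) (abs_nonneg r)

lemma memAc_zero : Q.memAc 0 := by
  refine ⟨isCompactOperator_zero, ⟨?_, 0, ?_⟩, 0, ?_⟩
  · ext x
    simp only [Submodule.mem_top, iff_true]
    exact Q.Dp.domain.zero_mem
  · rintro ⟨x, hx⟩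
    have e : mulRight Q.Dp 0 ⟨x, hx⟩ = 0 := Q.Dp.map_zero
    simp [e]
  · intro x
    have e : mulLeft 0 Q.Dp x = 0 := rfl
    simp [e]

/-- The real linear space `{k + λ I | λ ∈ ℝ, k = k* ∈ A_c}`. -/
def spaceC : Submodule ℝ (Q.PH →L[ℂ] Q.PH) where
  carrier := {x | ∃ k, (Q.memAc k ∧ IsSelfAdjoint k) ∧ ∃ r : ℝ, x = k + r • 1}
  add_mem' := by
    rintro _ _ ⟨k, ⟨hk, hk'⟩, r, rfl⟩ ⟨l, ⟨hl, hl'⟩, s, rfl⟩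
    exact ⟨k + l, ⟨Q.memAc_add hk hl, hk'.add hl'⟩, r + s, by rw [add_smul]; abel⟩
  zero_mem' := ⟨0, ⟨Q.memAc_zero, IsSelfAdjoint.zero _⟩, 0, by simp⟩
  smul_mem' := by
    rintro c _ ⟨k, ⟨hk, hk'⟩, r, rfl⟩
    exact ⟨c • k, ⟨Q.memAc_smul c hk, (IsSelfAdjoint.all c).smul hk'⟩, c * r, by
      rw [smul_add, smul_smul]⟩

lemma isSelfAdjoint_of_mem_spaceC {x : Q.PH →L[ℂ] Q.PH} (hx : x ∈ Q.spaceC) :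
    IsSelfAdjoint x := by
  obtain ⟨k, ⟨_, hk⟩, r, rfl⟩ := hx
  exact hk.add (isSelfAdjoint_smul_one r)

lemma one_mem_spaceC : 1 ∈ Q.spaceC :=
  ⟨0, ⟨Q.memAc_zero, IsSelfAdjoint.zero _⟩, 1, by simp⟩

/-- The real linear space `T(A_sa) + A_C`, which consists of the self-adjoint elements
`T(a) + k` with `a ∈ A` and `k ∈ A_c`. -/
def spaceT : Submodule ℝ (Q.PH →L[ℂ] Q.PH) where
  carrier := {t | ∃ a, (a ∈ Q.A ∧ IsSelfAdjoint a) ∧ ∃ x ∈ Q.spaceC, t = Q.T a + x}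
  add_mem' := by
    rintro _ _ ⟨a, ⟨ha, ha'⟩, x, hx, rfl⟩ ⟨b, ⟨hb, hb'⟩, y, hy, rfl⟩
    refine ⟨a + b, ⟨add_mem ha hb, ha'.add hb'⟩, x + y, add_mem hx hy, ?_⟩
    have : Q.T (a + b) = Q.T a + Q.T b := by ext; simp [T]
    rw [this]; abel
  zero_mem' := ⟨0, ⟨zero_mem _, IsSelfAdjoint.zero _⟩, 0, zero_mem _, by
    ext; simp [T]⟩
  smul_mem' := by
    rintro c _ ⟨a, ⟨ha, ha'⟩, x, hx, rfl⟩
    refine ⟨c • a, ⟨?_, (IsSelfAdjoint.all c).smul ha'⟩, c • x, Q.spaceC.smul_mem c hx, ?_⟩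
    · rw [← Complex.coe_smul]; exact Q.A.smul_mem ha (c : ℂ)
    · rw [smul_add]; congr 1
      rw [← Complex.coe_smul, ← Complex.coe_smul c a]
      ext; simp [T]

lemma isSelfAdjoint_T {a : H →L[ℂ] H} (ha : IsSelfAdjoint a) : IsSelfAdjoint (Q.T a) := by
  rw [ContinuousLinearMap.isSelfAdjoint_iff_isSymmetric] at ha ⊢
  intro x y
  have h : ∀ u : H, ∀ v : Q.PH, inner ℂ (Q.proj u) v = inner ℂ u (Q.incl v) := fun u v =>
    haveI := Q.complete
    Q.V.inner_orthogonalProjectionOnto_eq_of_mem_right v u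
  have h' : ∀ u : H, ∀ v : Q.PH, inner ℂ v (Q.proj u) = inner ℂ (Q.incl v) u := fun u v =>
    haveI := Q.complete
    Q.V.inner_orthogonalProjectionOnto_eq_of_mem_left v u
  simpa [T, h, h'] using ha (Q.incl x) (Q.incl y)

/-- The order-unit space `A_C`. -/
def ouC : OrderUnitSpace.{u} :=
  ofOperators Q.spaceC (fun _ => Q.isSelfAdjoint_of_mem_spaceC) Q.one_mem_spaceC

/-- The order-unit space `A_T`. -/
def ouT : OrderUnitSpace.{u} :=
  ofOperators Q.spaceT
    (fun _ ⟨_, ha, _, hx, h⟩ =>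
      h ▸ (Q.isSelfAdjoint_T ha.2).add (Q.isSelfAdjoint_of_mem_spaceC hx))
    ⟨0, ⟨zero_mem _, IsSelfAdjoint.zero _⟩, 1, Q.one_mem_spaceC, by ext; simp [T]⟩

/-- `L_C(k + λ I) = ‖D_p k‖`.  (The decomposition is unique when `PH` is infinite-dimensional.) -/
def LC (x : Q.ouC) : ℝ := opNorm (mulRight Q.Dp (Classical.choose x.2))

open Classical in
/-- The homomorphism `ρ = φ⁻¹ ∘ κ`: here `ρ(t)` is the unique element `a` of the C*-algebra for
which `t - T(a)` is compact. -/
def rho (t : Q.PH →L[ℂ] Q.PH) : H →L[ℂ] H :=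
  if h : ∃ a, a ∈ Q.cstar ∧ IsCompactOperator (t - Q.T a) then h.choose else 0

/-- The Hilbert space `K = PH ⊕ H`. -/
abbrev K : Type u := WithLp 2 (Q.PH × H)

/-- The representation `π(t) = t ⊕ ρ(t)` on `K`. -/
def rep (t : Q.PH →L[ℂ] Q.PH) : Q.K →L[ℂ] Q.K :=
  (WithLp.prodContinuousLinearEquiv 2 ℂ Q.PH H).symm.toContinuousLinearMap ∘L
    (t.prodMap (Q.rho t)) ∘L
    (WithLp.prodContinuousLinearEquiv 2 ℂ Q.PH H).toContinuousLinearMap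

/-- The operator `D_{α,β}` on `K = PH ⊕ H`,
`(x, y) ↦ (β D_p P y, β D_p x + α⁻¹ D y)` for `x ∈ dom D ∩ PH` and `y ∈ dom D`
(where `D_p P y = P D y`, since `P` commutes with `D`). -/
def DK (α β : ℝ) : Q.K →ₗ.[ℂ] Q.K where
  domain :=
    { carrier := {w | Q.incl w.fst ∈ Q.D.domain ∧ w.snd ∈ Q.D.domain}
      add_mem' := fun h h' => ⟨add_mem h.1 h'.1, add_mem h.2 h'.2⟩
      zero_mem' := ⟨zero_mem _, zero_mem _⟩
      smul_mem' := fun c _ h => ⟨Q.D.domain.smul_mem c h.1, Q.D.domain.smul_mem c h.2⟩ }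
  toFun :=
    { toFun := fun w => WithLp.toLp 2
        ((β : ℂ) • Q.proj (Q.D ⟨w.1.snd, w.2.2⟩),
          (β : ℂ) • Q.incl (Q.Dp ⟨w.1.fst, w.2.1⟩) + ((α⁻¹ : ℝ) : ℂ) • Q.D ⟨w.1.snd, w.2.2⟩)
      map_add' := by
        intro w w'
        have e₁ : Q.D ⟨(w + w').1.snd, (w + w').2.2⟩
            = Q.D ⟨w.1.snd, w.2.2⟩ + Q.D ⟨w'.1.snd, w'.2.2⟩ :=
          Q.D.map_add ⟨w.1.snd, w.2.2⟩ ⟨w'.1.snd, w'.2.2⟩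
        have e₂ : Q.Dp ⟨(w + w').1.fst, (w + w').2.1⟩
            = Q.Dp ⟨w.1.fst, w.2.1⟩ + Q.Dp ⟨w'.1.fst, w'.2.1⟩ :=
          Q.Dp.map_add ⟨w.1.fst, w.2.1⟩ ⟨w'.1.fst, w'.2.1⟩
        rw [e₁, e₂, ← WithLp.toLp_add, Prod.mk_add_mk]
        congr 2
        · rw [map_add, smul_add]
        · rw [map_add, smul_add, smul_add]; abel
      map_smul' := by
        intro c w
        have e₁ : Q.D ⟨(c • w).1.snd, (c • w).2.2⟩ = c • Q.D ⟨w.1.snd, w.2.2⟩ :=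
          Q.D.map_smul c ⟨w.1.snd, w.2.2⟩
        have e₂ : Q.Dp ⟨(c • w).1.fst, (c • w).2.1⟩ = c • Q.Dp ⟨w.1.fst, w.2.1⟩ :=
          Q.Dp.map_smul c ⟨w.1.fst, w.2.1⟩
        rw [e₁, e₂, RingHom.id_apply, ← WithLp.toLp_smul, Prod.smul_mk]
        congr 2
        · rw [map_smul, smul_comm]
        · rw [map_smul, smul_add, smul_comm c, smul_comm c] }

/-- `L_{α,β}(t) = ‖[D_{α,β}, π(t)]‖`. -/
def LT (α β : ℝ) (t : Q.ouT) : ℝ := opNorm (comm (Q.DK α β) (Q.rep t.1))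

/-! ### The parameter space -/

/-- The parameter space
`{(α, β) | α ≥ 0, β > 0, α β ≤ 1} ∪ {(0, ∞)}`. -/
def params : Set (ℝ × WithTop ℝ) :=
  {p | (∃ α β : ℝ, p = (α, (β : WithTop ℝ)) ∧ 0 ≤ α ∧ 0 < β ∧ α * β ≤ 1) ∨ p = (0, ⊤)}

open Classical in
/-- The pair at the parameter `(α, β)`: it is `(ℝ, 0)` for `β = ∞`, it is `(A_C, β L_C)` for
`α = 0` and `β < ∞`, and it is `(A_T, L_{α,β})` otherwise. -/
def fam : ℝ × WithTop ℝ → OrderUnitPair.{u}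
  | (_, none) => ⟨OrderUnitSpace.real, fun _ => 0⟩
  | (α, some β) => if α = 0 then ⟨Q.ouC, fun x => β * Q.LC x⟩ else ⟨Q.ouT, Q.LT α β⟩

end ToeplitzQuadruple

end QMS

/-!
All the order-unit spaces of the family consist of self-adjoint operators on `PH` with unit `1`
(the one-point space being the scalars), so distances between them can be estimated inside the
algebra of bounded operators on `PH`.

*Lip-norms.* A seminorm with null space `ℝ e` is a Lip-norm if its unit ball is totally bounded
modulo scalars (`IsPrecompactLip.isLipNorm`), and the converse holds by the Arzelà-Ascoli argument
(`IsLipNorm.isPrecompactLip`); the converse is needed only for the hypothesis on `L_A`.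

*Distances.* If every element `x` of one space has an element `y` of the other with
`L y ≤ c L x` and `‖x - y‖ ≤ η L x`, and conversely, and if both spaces have radius at most `R`,
then their quantum distance is at most `η + (c - 1) R` (`distQ_le_of_approx_mul`). The bridge is
`max (L_X x) (L_Y y) (γ⁻¹ ‖x - y‖)`: a state of one space extends to a functional of norm one on
all bounded operators by the Hahn-Banach theorem, and the restriction of that functional to the
other space is a state at distance at most `γ`. The triangle inequality (`distQ_triangle`) comes
from the composite bridge `inf_y max (L₁ (y, x)) (L₂ (y, z))`.

*Operators.* Since `D_p` has trivial kernel and compact resolvent, it is bounded below,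
`‖k‖ ≤ G ‖D_p k‖`, and the self-adjoint `k` with `‖D_p k‖ ≤ 1` form a totally bounded set
(`totallyBounded_selfAdjoint_mul_bounded`). The identity of `PH` is not compact, so the symbol of
`T(a) + k` is `a`, and the commutator of `D_{α,β}` with `π(T(a) + k)` has the entries
`β (P D a - t P D)`, `β (D_p t - a D_p)` and `α⁻¹ [D, a]`. Reading off entries, one gets
`‖[D, a]‖ ≤ α L_{α,β}(t)` and `β ‖D_p k‖ ≤ (1 + α β) L_{α,β}(t)` for `t = T(a) + k`, as well as
`L_{α,β}(k + r) ≤ β ‖D_p k‖` and an estimate of `L_{α,β}` by `L_{α',β'}` with a factor that tends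
to one (`IsDecomp.normComm_le_mul`). Hence `L_{α,β}` has precompact unit ball; as `α → 0` the
operator `a` is within `O(α)` of a scalar, so that `A_T` approaches `A_C`; and as `β → ∞` with
`α β ≤ 1` the radius of all the spaces tends to zero.

*Compactness.* In the coordinates `(α, s)` with `s = 1/β`, the parameters with `β ≥ β₀` form the
compact triangle `0 ≤ α ≤ s ≤ 1/β₀`, on which the family depends continuously
(`ToeplitzQuadruple.tendsto_distQ_fam`).
-/

namespace QMS

namespace OrderUnitSpace

/-! ### Lip-norms with precompact unit ball -/

variable {A B C : OrderUnitSpace.{u}}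

/-- A seminorm with null space `ℝ e` whose unit ball is totally bounded modulo `ℝ e` for the
order-unit norm.  Total boundedness is phrased with order intervals `[-ε e, ε e]`. -/
structure IsPrecompactLip {A : OrderUnitSpace.{u}} (L : A → ℝ) : Prop where
  add_le : ∀ a b, L (a + b) ≤ L a + L b
  smul : ∀ (r : ℝ) (a : A), L (r • a) = |r| * L a
  eq_zero_iff : ∀ a, L a = 0 ↔ ∃ r : ℝ, a = r • A.unit
  net : ∀ ε : ℝ, 0 < ε → ∃ F : Set A, F.Finite ∧ ∀ a, L a ≤ 1 → ∃ f ∈ F, ∃ r : ℝ,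
    -(ε • A.unit) ≤ a - f - r • A.unit ∧ a - f - r • A.unit ≤ ε • A.unit

lemma State.map_smul_unit (μ : A.State) (r : ℝ) : μ (r • A.unit) = r := by
  rw [map_smul, μ.2.1, smul_eq_mul, mul_one]

lemma smul_unit_mono {r s : ℝ} (h : r ≤ s) : r • A.unit ≤ s • A.unit :=
  smul_le_smul_of_nonneg_right h A.unit_nonneg

/-- A functional bounded by `c` on the unit ball of a homogeneous function `L` is bounded by
`c L`; this includes the null vectors of `L`. -/
lemma abs_le_mul_of_le_on_ball {M : Type*} [AddCommGroup M] [Module ℝ M] {L : M → ℝ}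
    (hL : ∀ (r : ℝ) a, L (r • a) = |r| * L a) (h0 : ∀ a, 0 ≤ L a) (φ : M →ₗ[ℝ] ℝ) {c : ℝ}
    (h : ∀ a, L a ≤ 1 → |φ a| ≤ c) (a : M) : |φ a| ≤ c * L a := by
  have hc : 0 ≤ c := (abs_nonneg _).trans (h 0 (by
    have := hL 0 0
    simp only [smul_zero, abs_zero, zero_mul] at this
    rw [this]; exact zero_le_one))
  refine le_of_forall_pos_le_add fun δ hδ => ?_
  set s := L a + δ / (c + 1) with hs
  have hs0 : 0 < s := add_pos_of_nonneg_of_pos (h0 a) (by positivity)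
  have h1 : |φ (s⁻¹ • a)| ≤ c := h _ (by
    rw [hL, abs_of_pos (inv_pos.2 hs0), inv_mul_le_iff₀ hs0, mul_one, hs]
    linarith [show 0 < δ / (c + 1) by positivity])
  rw [map_smul, smul_eq_mul, abs_mul, abs_of_pos (inv_pos.2 hs0), inv_mul_le_iff₀ hs0] at h1
  have h2 : c * (δ / (c + 1)) ≤ δ := by
    rw [mul_div_assoc', div_le_iff₀ (by positivity)]; nlinarith
  calc |φ a| ≤ s * c := h1
    _ = c * L a + c * (δ / (c + 1)) := by rw [hs]; ring
    _ ≤ c * L a + δ := by linarith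

lemma rho_le_iff {L : A → ℝ} {μ ν : A.State} {c : ℝ} (hc : 0 ≤ c) :
    rho L μ ν ≤ ENNReal.ofReal c ↔ ∀ a, L a ≤ 1 → |μ a - ν a| ≤ c := by
  simp only [rho, iSup_le_iff, ENNReal.ofReal_le_ofReal_iff hc]

lemma abs_sub_le_of_rho {L : A → ℝ} {μ ν : A.State} (h : rho L μ ν ≠ ⊤) {a : A} (ha : L a ≤ 1) :
    |μ a - ν a| ≤ (rho L μ ν).toReal :=
  (rho_le_iff ENNReal.toReal_nonneg).1 (by rw [ENNReal.ofReal_toReal h]) a ha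

section Seminorm

variable {L : A → ℝ}

lemma nonneg_of_seminorm (hadd : ∀ a b, L (a + b) ≤ L a + L b)
    (hsmul : ∀ (r : ℝ) (a : A), L (r • a) = |r| * L a) (a : A) : 0 ≤ L a := by
  have h0 : L 0 = 0 := by simpa using hsmul 0 0
  have h1 := hadd a ((-1 : ℝ) • a)
  rw [hsmul] at h1
  have : a + (-1 : ℝ) • a = 0 := by rw [neg_one_smul, add_neg_cancel]
  rw [this, h0] at h1
  norm_num at h1
  linarith

lemma IsPrecompactLip.nonneg (h : IsPrecompactLip L) (a : A) : 0 ≤ L a :=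
  nonneg_of_seminorm h.add_le h.smul a

lemma IsPrecompactLip.map_smul_unit (h : IsPrecompactLip L) (r : ℝ) : L (r • A.unit) = 0 :=
  (h.eq_zero_iff _).2 ⟨r, rfl⟩

lemma IsPrecompactLip.map_add_smul_unit_le (h : IsPrecompactLip L) (a : A) (r : ℝ) :
    L (a + r • A.unit) ≤ L a := by
  simpa [h.map_smul_unit] using h.add_le a (r • A.unit)

lemma abs_state_sub_le {L : A → ℝ} (hadd : ∀ a b, L (a + b) ≤ L a + L b)
    (hsmul : ∀ (r : ℝ) (a : A), L (r • a) = |r| * L a) {μ ν : A.State} {c : ℝ}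
    (h : ∀ a, L a ≤ 1 → |μ a - ν a| ≤ c) (a : A) : |μ a - ν a| ≤ c * L a :=
  abs_le_mul_of_le_on_ball hsmul (nonneg_of_seminorm hadd hsmul) (μ.1 - ν.1) h a

end Seminorm

/-- If the unit ball is totally bounded modulo `ℝ e`, then `ρ_L` gives the weak-* topology. -/
theorem IsPrecompactLip.isLipNorm {L : A → ℝ} (h : IsPrecompactLip L) : IsLipNorm L where
  add_le := h.add_le
  smul := h.smul
  eq_zero_iff := h.eq_zero_iff
  topology_eq := by
    apply le_antisymm
    · -- evaluation at `a` is Lipschitz for `ρ_L`, as `L a < ∞`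
      rw [← continuous_iff_le_induced]
      let _ := rhoSpace L
      refine continuous_pi fun a => ?_
      refine continuous_iff_continuousAt.2 fun μ => ?_
      have hL := h.nonneg a
      rw [ContinuousAt, EMetric.tendsto_nhds]
      intro ε hε
      have hc : (0 : ℝ) < L a + 1 := by linarith
      have hpos : 0 < ε / ENNReal.ofReal (L a + 1) :=
        ENNReal.div_pos hε.ne' ENNReal.ofReal_ne_top
      filter_upwards [Metric.eball_mem_nhds μ hpos] with ν hν
      have hν' : rho L ν μ < ε / ENNReal.ofReal (L a + 1) := hν
      have h1 : L ((L a + 1)⁻¹ • a) ≤ 1 := by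
        rw [h.smul, abs_of_pos (inv_pos.2 hc), inv_mul_le_iff₀ hc]; linarith
      have h2 : ENNReal.ofReal |ν ((L a + 1)⁻¹ • a) - μ ((L a + 1)⁻¹ • a)| ≤ rho L ν μ :=
        le_iSup₂_of_le (f := fun (b : A) (_ : L b ≤ 1) => ENNReal.ofReal |ν b - μ b|) _ h1 le_rfl
      rw [map_smul, map_smul, smul_eq_mul, smul_eq_mul, ← mul_sub, abs_mul,
        abs_of_pos (inv_pos.2 hc), inv_mul_eq_div, ENNReal.ofReal_div_of_pos hc] at h2
      have h3 := h2.trans_lt hν'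
      rw [edist_dist, Real.dist_eq]
      exact (ENNReal.div_lt_div_iff_left (by simpa using hc) ENNReal.ofReal_ne_top).1 h3
    · -- states that agree up to `δ` on a `δ`-net of the ball are `3δ`-close for `ρ_L`
      refine le_of_nhds_le_nhds fun μ => ?_
      let _ := rhoSpace L
      refine (Metric.nhds_basis_eball (x := μ)).ge_iff.2 fun ε hε => ?_
      obtain ⟨δ, hδ, hδε⟩ : ∃ δ : ℝ, 0 < δ ∧ ENNReal.ofReal (3 * δ) < ε := by
        rcases eq_or_ne ε ⊤ with rfl | hε'
        · exact ⟨1, one_pos, ENNReal.ofReal_lt_top⟩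
        · have : 0 < ε.toReal := ENNReal.toReal_pos hε.ne' hε'
          refine ⟨ε.toReal / 4, by linarith, ?_⟩
          rw [ENNReal.ofReal_lt_iff_lt_toReal (by linarith) hε']
          linarith
      obtain ⟨F, hF, hFnet⟩ := h.net δ hδ
      have hcont : ∀ f : A, @Continuous _ _ A.weakStar _ (fun ν : A.State => ν f) := fun f =>
        let _ := A.weakStar
        (continuous_apply f).comp continuous_induced_dom
      have hmem : {ν : A.State | ∀ f ∈ F, |ν f - μ f| < δ} ∈ @nhds _ A.weakStar μ := by
        let _ := A.weakStar
        refine (Filter.eventually_all_finite hF).2 fun f _ => ?_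
        have := (hcont f).continuousAt (x := μ) (Metric.ball_mem_nhds (μ f) hδ)
        filter_upwards [this] with ν hν
        rwa [Set.mem_preimage, Metric.mem_ball, Real.dist_eq] at hν
      refine Filter.mem_of_superset hmem fun ν hν => ?_
      refine lt_of_le_of_lt ?_ hδε
      refine (rho_le_iff (by linarith)).2 fun a ha => ?_
      obtain ⟨f, hf, r, hr1, hr2⟩ := hFnet a ha
      have e1 := ν.2.2 _ _ hr1 hr2
      have e2 := μ.2.2 _ _ hr1 hr2
      have e3 := hν f hf
      have e4 := ν.map_smul_unit r
      have e5 := μ.map_smul_unit r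
      rw [map_sub, map_sub] at e1 e2
      rw [abs_le] at e1 e2 ⊢
      rw [abs_lt] at e3
      constructor <;> linarith

/-! ### Seminorms on direct sums and the triangle inequality -/

lemma smul_eq_of_smul_le {M : Type*} [AddCommGroup M] [Module ℝ M] {L : M → ℝ}
    (h0 : ∀ a, 0 ≤ L a) (h : ∀ (r : ℝ) a, L (r • a) ≤ |r| * L a) (r : ℝ) (a : M) :
    L (r • a) = |r| * L a := by
  refine le_antisymm (h r a) ?_
  rcases eq_or_ne r 0 with rfl | hr
  · simpa using h0 _
  · have h1 := h r⁻¹ (r • a)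
    rw [inv_smul_smul₀ hr, abs_inv, le_inv_mul_iff₀ (abs_pos.2 hr)] at h1
    exact h1

lemma add_smul_unit_le {x : A} {q δ δ' : ℝ} (hx : x ≤ δ • A.unit) (hq : q ≤ δ') :
    x + q • A.unit ≤ (δ + δ') • A.unit := by
  rw [add_smul]; exact add_le_add hx (smul_unit_mono hq)

/-- A seminorm on `A ⊕ B` that dominates Lip-norms with precompact ball on the summands, and for
which some state of `A` has finite distance from some state of `B`, has precompact ball. -/
theorem IsPrecompactLip.prod {LA : A → ℝ} {LB : B → ℝ} (hA : IsPrecompactLip LA)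
    (hB : IsPrecompactLip LB) {L : A.prod B → ℝ} (hadd : ∀ a b, L (a + b) ≤ L a + L b)
    (hsmul : ∀ (r : ℝ) a, L (r • a) = |r| * L a) (hunit : L (A.prod B).unit = 0)
    (h₁ : ∀ (a : A) (b : B), LA a ≤ L (a, b)) (h₂ : ∀ (a : A) (b : B), LB b ≤ L (a, b))
    {μ : A.State} {ν : B.State} {c : ℝ} (hc : ∀ (a : A) (b : B), |μ a - ν b| ≤ c * L (a, b)) :
    IsPrecompactLip L where
  add_le := hadd
  smul := hsmul
  eq_zero_iff := by
    rintro ⟨a, b⟩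
    constructor
    · intro h
      obtain ⟨r, rfl⟩ := (hA.eq_zero_iff a).1 (le_antisymm (h ▸ h₁ a b) (hA.nonneg a))
      obtain ⟨s, rfl⟩ := (hB.eq_zero_iff b).1 (le_antisymm (h ▸ h₂ _ b) (hB.nonneg b))
      have h3 := hc (r • A.unit) (s • B.unit)
      rw [h, mul_zero, μ.map_smul_unit, ν.map_smul_unit] at h3
      have : r = s := sub_eq_zero.1 (abs_eq_zero.1 (le_antisymm h3 (abs_nonneg _)))
      exact ⟨r, this ▸ rfl⟩
    · rintro ⟨r, hr⟩
      rw [hr, hsmul, hunit, mul_zero]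
  net := by
    intro ε hε
    have hδ : 0 < ε / 2 := half_pos hε
    set δ := ε / 2
    obtain ⟨F, hF, hFn⟩ := hA.net δ hδ
    obtain ⟨G, hG, hGn⟩ := hB.net δ hδ
    obtain ⟨m, hm⟩ := (hF.image fun f => |μ f|).bddAbove
    obtain ⟨n, hn⟩ := (hG.image fun g => |ν g|).bddAbove
    -- the scalars left over on the two summands differ by a bounded amount: a net of an interval
    obtain ⟨T, hT, hTn⟩ := Metric.totallyBounded_iff.1
      (isCompact_Icc (a := -(|c| + m + n + 2 * δ)) (b := |c| + m + n + 2 * δ)).totallyBounded δ hδ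
    refine ⟨(fun p : A × B × ℝ => ((p.1 + p.2.2 • A.unit, p.2.1) : A × B)) '' (F ×ˢ (G ×ˢ T)),
      (hF.prod (hG.prod hT)).image _, ?_⟩
    rintro ⟨a, b⟩ hab
    obtain ⟨f, hf, r, hr1, hr2⟩ := hFn a ((h₁ a b).trans hab)
    obtain ⟨g, hg, s, hs1, hs2⟩ := hGn b ((h₂ a b).trans hab)
    have e1 := μ.2.2 _ _ hr1 hr2
    have e2 := ν.2.2 _ _ hs1 hs2
    rw [map_sub, map_sub] at e1 e2
    have e3 := μ.map_smul_unit r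
    have e4 := ν.map_smul_unit s
    have e5 : |μ a - ν b| ≤ |c| := (hc a b).trans (by
      have hL : 0 ≤ L (a, b) := (hA.nonneg a).trans (h₁ a b)
      calc c * L (a, b) ≤ |c| * L (a, b) := by gcongr; exact le_abs_self c
        _ ≤ |c| * 1 := by gcongr
        _ = |c| := mul_one _)
    have e6 : |μ f| ≤ m := hm ⟨f, hf, rfl⟩
    have e7 : |ν g| ≤ n := hn ⟨g, hg, rfl⟩
    have hrs : r - s ∈ Set.Icc (-(|c| + m + n + 2 * δ)) (|c| + m + n + 2 * δ) := by
      rw [abs_le] at e1 e2 e5 e6 e7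
      constructor <;> linarith
    obtain ⟨t, ht, hrst⟩ := Set.mem_iUnion₂.1 (hTn hrs)
    rw [Metric.mem_ball, Real.dist_eq, abs_lt] at hrst
    refine ⟨_, ⟨(f, g, t), ⟨hf, hg, ht⟩, rfl⟩, s, ?_⟩
    have k1 : a - (f + t • A.unit) - s • A.unit = (a - f - r • A.unit) + (r - s - t) • A.unit := by
      module
    have k2 : ∀ x : A, -(ε • A.unit) ≤ x ↔ -x ≤ ε • A.unit := fun x => neg_le
    have hε2 : ε = δ + δ := (add_halves ε).symm
    have hle : δ ≤ ε := by linarith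
    refine ⟨⟨?_, ?_⟩, ⟨?_, ?_⟩⟩
    · change -(ε • A.unit) ≤ a - (f + t • A.unit) - s • A.unit
      rw [k2, k1, neg_add, ← neg_smul, hε2]
      exact add_smul_unit_le (neg_le.1 hr1) (by linarith)
    · exact (neg_le_neg (smul_unit_mono hle)).trans hs1
    · change a - (f + t • A.unit) - s • A.unit ≤ ε • A.unit
      rw [k1, hε2]
      exact add_smul_unit_le hr2 (by linarith)
    · exact hs2.trans (smul_unit_mono hle)

lemma hausdorff_le {L : A.prod B → ℝ} {r : ℝ≥0∞}
    (h₁ : ∀ μ : A.State, ∃ ν : B.State, rho L (State.inl B μ) (State.inr A ν) ≤ r)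
    (h₂ : ∀ ν : B.State, ∃ μ : A.State, rho L (State.inl B μ) (State.inr A ν) ≤ r) :
    @Metric.hausdorffEDist (A.prod B).State (rhoSpace L)
      (Set.range (State.inl B)) (Set.range (State.inr A)) ≤ r := by
  let _ := rhoSpace L
  refine Metric.hausdorffEDist_le_of_mem_edist ?_ ?_
  · rintro _ ⟨μ, rfl⟩
    obtain ⟨ν, h⟩ := h₁ μ
    exact ⟨_, ⟨ν, rfl⟩, h⟩
  · rintro _ ⟨ν, rfl⟩
    obtain ⟨μ, h⟩ := h₂ ν
    exact ⟨_, ⟨μ, rfl⟩, (edist_comm _ _).trans_le h⟩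

lemma exists_right_of_hausdorff_lt {L : A.prod B → ℝ} {r : ℝ≥0∞}
    (h : @Metric.hausdorffEDist (A.prod B).State (rhoSpace L)
      (Set.range (State.inl B)) (Set.range (State.inr A)) < r) (μ : A.State) :
    ∃ ν : B.State, rho L (State.inl B μ) (State.inr A ν) < r := by
  let _ := rhoSpace L
  obtain ⟨_, ⟨ν, rfl⟩, hν⟩ := Metric.exists_edist_lt_of_hausdorffEDist_lt (Set.mem_range_self μ) h
  exact ⟨ν, hν⟩

lemma exists_left_of_hausdorff_lt {L : A.prod B → ℝ} {r : ℝ≥0∞}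
    (h : @Metric.hausdorffEDist (A.prod B).State (rhoSpace L)
      (Set.range (State.inl B)) (Set.range (State.inr A)) < r) (ν : B.State) :
    ∃ μ : A.State, rho L (State.inl B μ) (State.inr A ν) < r := by
  let _ := rhoSpace L
  rw [Metric.hausdorffEDist_comm] at h
  obtain ⟨_, ⟨μ, rfl⟩, hμ⟩ := Metric.exists_edist_lt_of_hausdorffEDist_lt (Set.mem_range_self ν) h
  exact ⟨μ, (edist_comm _ _).trans_lt hμ⟩

/-- The quotient seminorm of a composite bridge is the quotient seminorm of the first factor. -/
lemma iInf_iInf_max {β γ : Type*} [Nonempty β] [Nonempty γ] {f : β → ℝ} {g : β → γ → ℝ}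
    (hf : ∀ b, 0 ≤ f b) (h : ∀ b, ⨅ c, g b c ≤ f b) :
    ⨅ c, ⨅ b, max (f b) (g b c) = ⨅ b, f b := by
  have bdd : ∀ c, BddBelow (Set.range fun b => max (f b) (g b c)) := fun c =>
    ⟨0, by rintro _ ⟨b, rfl⟩; exact (hf b).trans (le_max_left _ _)⟩
  have bdd' : BddBelow (Set.range fun c => ⨅ b, max (f b) (g b c)) :=
    ⟨0, by rintro _ ⟨c, rfl⟩; exact le_ciInf fun b => (hf b).trans (le_max_left _ _)⟩
  have bddf : BddBelow (Set.range f) := ⟨0, by rintro _ ⟨b, rfl⟩; exact hf b⟩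
  apply le_antisymm
  · refine le_ciInf fun b => le_of_forall_pos_le_add fun δ hδ => ?_
    obtain ⟨c, hc⟩ := exists_lt_of_ciInf_lt ((h b).trans_lt (lt_add_of_pos_right _ hδ))
    exact ((ciInf_le bdd' c).trans (ciInf_le (bdd c) b)).trans
      (max_le (by linarith) hc.le)
  · exact le_ciInf fun c => le_ciInf fun b => (ciInf_le bddf b).trans (le_max_left _ _)

/-- Bridges `L₁` on `Y ⊕ X` and `L₂` on `Y ⊕ Z` compose to the bridge
`(x, z) ↦ inf_y max (L₁ (y, x)) (L₂ (y, z))` on `X ⊕ Z`. -/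
lemma distQ_le_of_lt {X Y Z : OrderUnitPair.{u}} (hX : IsPrecompactLip X.L)
    (hZ : IsPrecompactLip Z.L) [Nonempty X.A.State] {r s : ℝ≥0∞} (hr : r ≠ ⊤) (hs : s ≠ ⊤)
    (hYX : distQ Y X < r) (hYZ : distQ Y Z < s) : distQ X Z ≤ r + s := by
  simp only [distQ, iInf_lt_iff] at hYX hYZ
  obtain ⟨L₁, ⟨l₁, q₁, q₁'⟩, h₁⟩ := hYX
  obtain ⟨L₂, ⟨l₂, q₂, q₂'⟩, h₂⟩ := hYZ
  have n₁ := nonneg_of_seminorm l₁.add_le l₁.smul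
  have n₂ := nonneg_of_seminorm l₂.add_le l₂.smul
  let L : X.A.prod Z.A → ℝ := fun p => ⨅ y : Y.A, max (L₁ (y, p.1)) (L₂ (y, p.2))
  have bdd : ∀ x z, BddBelow (Set.range fun y : Y.A => max (L₁ (y, x)) (L₂ (y, z))) := fun x z =>
    ⟨0, by rintro _ ⟨y, rfl⟩; exact (n₁ _).trans (le_max_left _ _)⟩
  have bdd₁ : ∀ x : X.A, BddBelow (Set.range fun y : Y.A => L₁ (y, x)) := fun x =>
    ⟨0, by rintro _ ⟨y, rfl⟩; exact n₁ _⟩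
  have bdd₂ : ∀ z : Z.A, BddBelow (Set.range fun y : Y.A => L₂ (y, z)) := fun z =>
    ⟨0, by rintro _ ⟨y, rfl⟩; exact n₂ _⟩
  have bdd₁' : ∀ y : Y.A, BddBelow (Set.range fun x : X.A => L₁ (y, x)) := fun y =>
    ⟨0, by rintro _ ⟨x, rfl⟩; exact n₁ _⟩
  have bdd₂' : ∀ y : Y.A, BddBelow (Set.range fun z : Z.A => L₂ (y, z)) := fun y =>
    ⟨0, by rintro _ ⟨z, rfl⟩; exact n₂ _⟩
  have hL0 : ∀ p, 0 ≤ L p := fun p => le_ciInf fun y => (n₁ _).trans (le_max_left _ _)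
  have hadd : ∀ p q, L (p + q) ≤ L p + L q := fun p q => by
    refine le_of_forall_pos_le_add fun δ hδ => ?_
    obtain ⟨y, hy⟩ := exists_lt_of_ciInf_lt (lt_add_of_pos_right (L p) (half_pos hδ))
    obtain ⟨y', hy'⟩ := exists_lt_of_ciInf_lt (lt_add_of_pos_right (L q) (half_pos hδ))
    refine (ciInf_le (bdd _ _) (y + y')).trans (max_le ?_ ?_)
    · have := l₁.add_le (y, p.1) (y', q.1)
      have e1 := (le_max_left _ _).trans_lt hy
      have e2 := (le_max_left _ _).trans_lt hy'
      exact this.trans (by linarith)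
    · have := l₂.add_le (y, p.2) (y', q.2)
      have e1 := (le_max_right _ _).trans_lt hy
      have e2 := (le_max_right _ _).trans_lt hy'
      exact this.trans (by linarith)
  have hsmul : ∀ (t : ℝ) p, L (t • p) = |t| * L p := smul_eq_of_smul_le hL0 fun t p => by
    rw [Real.mul_iInf_of_nonneg (abs_nonneg t)]
    refine le_ciInf fun y => (ciInf_le (bdd _ _) (t • y)).trans ?_
    rw [mul_max_of_nonneg _ _ (abs_nonneg t)]
    exact max_le_max (l₁.smul t (y, p.1)).le (l₂.smul t (y, p.2)).le
  have hunit : L (X.A.prod Z.A).unit = 0 := by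
    refine le_antisymm ((ciInf_le (bdd _ _) Y.A.unit).trans (max_le ?_ ?_)) (hL0 _)
    · exact ((l₁.eq_zero_iff _).2 ⟨1, (one_smul _ _).symm⟩).le
    · exact ((l₂.eq_zero_iff _).2 ⟨1, (one_smul _ _).symm⟩).le
  have hLX : ∀ x z, X.L x ≤ L (x, z) := fun x z => le_ciInf fun y => by
    rw [q₁' x]; exact (ciInf_le (bdd₁ x) y).trans (le_max_left _ _)
  have hLZ : ∀ x z, Z.L z ≤ L (x, z) := fun x z => le_ciInf fun y => by
    rw [q₂' z]; exact (ciInf_le (bdd₂ z) y).trans (le_max_right _ _)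
  -- states at finite distance along the two bridges are at finite distance along the composite
  have key : ∀ (μ : X.A.State) (ν : Y.A.State) (τ : Z.A.State),
      rho L₁ (State.inl X.A ν) (State.inr Y.A μ) < r →
      rho L₂ (State.inl Z.A ν) (State.inr Y.A τ) < s →
      ∀ x z, |μ x - τ z| ≤ (r.toReal + s.toReal) * L (x, z) := by
    intro μ ν τ hμ hτ x z
    have k₁ : ∀ y, |ν y - μ x| ≤ r.toReal * L₁ (y, x) := fun y =>
      abs_state_sub_le (μ := State.inl X.A ν) (ν := State.inr Y.A μ) l₁.add_le l₁.smul
        (fun a ha => (abs_sub_le_of_rho hμ.ne_top ha).trans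
          (ENNReal.toReal_mono hr hμ.le)) (y, x)
    have k₂ : ∀ y, |ν y - τ z| ≤ s.toReal * L₂ (y, z) := fun y =>
      abs_state_sub_le (μ := State.inl Z.A ν) (ν := State.inr Y.A τ) l₂.add_le l₂.smul
        (fun a ha => (abs_sub_le_of_rho hτ.ne_top ha).trans
          (ENNReal.toReal_mono hs hτ.le)) (y, z)
    rw [Real.mul_iInf_of_nonneg (by positivity)]
    refine le_ciInf fun y => ?_
    have e : |μ x - τ z| ≤ |ν y - μ x| + |ν y - τ z| :=
      abs_sub_comm (μ x) (ν y) ▸ abs_sub_le (μ x) (ν y) (τ z)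
    refine e.trans ?_
    rw [add_mul]
    exact add_le_add ((k₁ y).trans (by gcongr; exact le_max_left _ _))
      ((k₂ y).trans (by gcongr; exact le_max_right _ _))
  have key' : ∀ (μ : X.A.State) (ν : Y.A.State) (τ : Z.A.State),
      rho L₁ (State.inl X.A ν) (State.inr Y.A μ) < r →
      rho L₂ (State.inl Z.A ν) (State.inr Y.A τ) < s →
      rho L (State.inl Z.A μ) (State.inr X.A τ) ≤ r + s := by
    intro μ ν τ hμ hτ
    rw [← ENNReal.ofReal_toReal hr, ← ENNReal.ofReal_toReal hs,
      ← ENNReal.ofReal_add ENNReal.toReal_nonneg ENNReal.toReal_nonneg]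
    refine (rho_le_iff (by positivity)).2 fun p hp => (key μ ν τ hμ hτ p.1 p.2).trans ?_
    exact mul_le_of_le_one_right (by positivity) hp
  obtain ⟨μ⟩ := ‹Nonempty X.A.State›
  obtain ⟨ν, hν⟩ := exists_left_of_hausdorff_lt h₁ μ
  obtain ⟨τ, hτ⟩ := exists_right_of_hausdorff_lt h₂ ν
  have hLip := (hX.prod hZ hadd hsmul hunit hLX hLZ (key μ ν τ hν hτ)).isLipNorm
  have hbridge : L ∈ bridges X.L Z.L := by
    refine ⟨hLip, fun x => ?_, fun z => ?_⟩
    · rw [q₁' x]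
      exact (iInf_iInf_max (f := fun y => L₁ (y, x)) (g := fun y z => L₂ (y, z)) (fun _ => n₁ _)
        fun y => by
          rw [← q₂ y, q₁ y]; exact ciInf_le (bdd₁' y) x).symm
    · rw [q₂' z]
      refine ((iInf_iInf_max (f := fun y => L₂ (y, z)) (g := fun y x => L₁ (y, x)) (fun _ => n₂ _)
        fun y => by
          rw [← q₁ y, q₂ y]; exact ciInf_le (bdd₂' y) z).symm).trans ?_
      simp only [max_comm]; rfl
  refine (iInf₂_le L hbridge).trans (hausdorff_le ?_ ?_)
  · intro μ
    obtain ⟨ν, hν⟩ := exists_left_of_hausdorff_lt h₁ μ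
    obtain ⟨τ, hτ⟩ := exists_right_of_hausdorff_lt h₂ ν
    exact ⟨τ, key' μ ν τ hν hτ⟩
  · intro τ
    obtain ⟨ν, hν⟩ := exists_left_of_hausdorff_lt h₂ τ
    obtain ⟨μ, hμ⟩ := exists_right_of_hausdorff_lt h₁ ν
    exact ⟨μ, key' μ ν τ hμ hν⟩

/-- The triangle inequality, with the middle space in the first place on the right-hand side; for
`Z = Y` this orientation also gives the symmetry of `distQ`. -/
theorem distQ_triangle {X Y Z : OrderUnitPair.{u}} (hX : IsPrecompactLip X.L)
    (hZ : IsPrecompactLip Z.L) [Nonempty X.A.State] :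
    distQ X Z ≤ distQ Y X + distQ Y Z := by
  by_cases h₁ : distQ Y X = ⊤
  · simp [h₁]
  by_cases h₂ : distQ Y Z = ⊤
  · simp [h₂]
  refine ENNReal.le_of_forall_pos_le_add fun ε hε _ => ?_
  have hε' : (ε / 2 : ℝ≥0∞) ≠ 0 := by simpa using hε.ne'
  have hεt : (ε / 2 : ℝ≥0∞) ≠ ⊤ := ENNReal.div_ne_top ENNReal.coe_ne_top two_ne_zero
  have := distQ_le_of_lt hX hZ (r := distQ Y X + ε / 2) (s := distQ Y Z + ε / 2)
    (ENNReal.add_ne_top.2 ⟨h₁, hεt⟩) (ENNReal.add_ne_top.2 ⟨h₂, hεt⟩)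
    (ENNReal.lt_add_right h₁ hε') (ENNReal.lt_add_right h₂ hε')
  rwa [add_add_add_comm, ENNReal.add_halves] at this


/-! ### Order-unit spaces inside a normed space -/

section Embedding

variable {A B : OrderUnitSpace.{u}} {N : Type*} [NormedAddCommGroup N] [NormedSpace ℝ N] {v : N}

/-- A linear map from an order-unit space to a normed space that is isometric for the order-unit
norm and sends the unit to `v`. -/
structure IsUnitalEmbedding (v : N) (ι : A →ₗ[ℝ] N) : Prop where
  map_unit : ι A.unit = v
  norm_le_iff : ∀ (a : A) (r : ℝ), ‖ι a‖ ≤ r ↔ -(r • A.unit) ≤ a ∧ a ≤ r • A.unit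

variable {ι : A →ₗ[ℝ] N}

lemma IsUnitalEmbedding.map_sub_smul (h : IsUnitalEmbedding v ι) (a b : A) (r : ℝ) :
    ι (a - b - r • A.unit) = ι a - ι b - r • v := by
  rw [map_sub, map_sub, map_smul, h.map_unit]

lemma IsUnitalEmbedding.abs_state_le (h : IsUnitalEmbedding v ι) (μ : A.State) (a : A) :
    |μ a| ≤ ‖ι a‖ :=
  μ.2.2 a _ ((h.norm_le_iff a _).1 le_rfl).1 ((h.norm_le_iff a _).1 le_rfl).2

lemma IsUnitalEmbedding.injective (h : IsUnitalEmbedding v ι) : Function.Injective ι := by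
  refine (injective_iff_map_eq_zero ι).2 fun a ha => ?_
  have := (h.norm_le_iff a 0).1 (by rw [ha, norm_zero])
  simpa using le_antisymm this.2 (by simpa using this.1)

/-- By the Hahn-Banach theorem, a state extends to a functional of norm at most one on the
surrounding normed space. -/
lemma IsUnitalEmbedding.exists_extension (h : IsUnitalEmbedding v ι) (μ : A.State) :
    ∃ F : N →L[ℝ] ℝ, ‖F‖ ≤ 1 ∧ F v = 1 ∧ ∀ a, F (ι a) = μ a := by
  let e := LinearEquiv.ofInjective ι h.injective
  let f : LinearMap.range ι →L[ℝ] ℝ := (μ.1 ∘ₗ e.symm.toLinearMap).mkContinuous 1 (by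
    rintro ⟨_, a, rfl⟩
    have : e.symm ⟨ι a, a, rfl⟩ = a := e.symm_apply_apply a
    simpa [this] using h.abs_state_le μ a)
  obtain ⟨F, hF, hn⟩ := exists_extension_norm_eq _ f
  have hFa : ∀ a, F (ι a) = μ a := fun a => by
    have : e.symm ⟨ι a, a, rfl⟩ = a := e.symm_apply_apply a
    rw [hF ⟨ι a, a, rfl⟩]
    simp [f, this]
  refine ⟨F, hn ▸ LinearMap.mkContinuous_norm_le _ zero_le_one _, ?_, hFa⟩
  rw [← h.map_unit, hFa, μ.2.1]

/-- The restriction to `A` of a functional of norm at most one that takes the value one at the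
unit. -/
def IsUnitalEmbedding.restrict (h : IsUnitalEmbedding v ι) (F : N →L[ℝ] ℝ) (hF : ‖F‖ ≤ 1)
    (hv : F v = 1) : A.State :=
  ⟨F.toLinearMap ∘ₗ ι, by simp [h.map_unit, hv], fun a r h₁ h₂ =>
    (F.le_opNorm (ι a)).trans ((mul_le_of_le_one_left (norm_nonneg _) hF).trans
      ((h.norm_le_iff a r).2 ⟨h₁, h₂⟩))⟩

lemma IsUnitalEmbedding.nonempty_state (h : IsUnitalEmbedding v ι) (hv : ‖v‖ = 1) :
    Nonempty A.State := by
  obtain ⟨F, hF, hFv⟩ := exists_dual_vector ℝ v (by rw [hv]; exact one_ne_zero)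
  exact ⟨h.restrict F hF.le (by simpa [hv] using hFv)⟩

/-- Total boundedness modulo scalars may be tested in the surrounding norm. -/
lemma IsUnitalEmbedding.isPrecompactLip (h : IsUnitalEmbedding v ι) {L : A → ℝ}
    (add_le : ∀ a b, L (a + b) ≤ L a + L b) (smul : ∀ (r : ℝ) (a : A), L (r • a) = |r| * L a)
    (eq_zero_iff : ∀ a, L a = 0 ↔ ∃ r : ℝ, a = r • A.unit)
    (net : ∀ ε : ℝ, 0 < ε → ∃ F : Set A, F.Finite ∧ ∀ a, L a ≤ 1 → ∃ f ∈ F, ∃ r : ℝ,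
      ‖ι a - ι f - r • v‖ ≤ ε) : IsPrecompactLip L where
  add_le := add_le
  smul := smul
  eq_zero_iff := eq_zero_iff
  net ε hε := by
    obtain ⟨F, hF, hn⟩ := net ε hε
    refine ⟨F, hF, fun a ha => ?_⟩
    obtain ⟨f, hf, r, hr⟩ := hn a ha
    rw [← h.map_sub_smul] at hr
    exact ⟨f, hf, r, (h.norm_le_iff _ _).1 hr⟩

lemma IsUnitalEmbedding.exists_net (h : IsUnitalEmbedding v ι) {L : A → ℝ}
    (hL : IsPrecompactLip L) {ε : ℝ} (hε : 0 < ε) : ∃ F : Set A, F.Finite ∧ ∀ a, L a ≤ 1 →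
      ∃ f ∈ F, ∃ r : ℝ, ‖ι a - ι f - r • v‖ ≤ ε := by
  obtain ⟨F, hF, hn⟩ := hL.net ε hε
  refine ⟨F, hF, fun a ha => ?_⟩
  obtain ⟨f, hf, r, hr⟩ := hn a ha
  exact ⟨f, hf, r, by rw [← h.map_sub_smul]; exact (h.norm_le_iff _ _).2 hr⟩

/-- Finite radius: a seminorm with precompact ball bounds the distance to the scalars. -/
lemma IsUnitalEmbedding.exists_radius (h : IsUnitalEmbedding v ι) {L : A → ℝ}
    (hL : IsPrecompactLip L) :
    ∃ R : ℝ, 0 ≤ R ∧ ∀ a, ∃ r : ℝ, ‖ι a - r • v‖ ≤ R * L a := by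
  obtain ⟨F, hF, hn⟩ := h.exists_net hL one_pos
  obtain ⟨m, hm⟩ := (hF.image fun f => ‖ι f‖).bddAbove
  refine ⟨1 + |m|, by positivity, fun a => ?_⟩
  rcases (hL.nonneg a).eq_or_lt with h0 | hpos
  · obtain ⟨r, rfl⟩ := (hL.eq_zero_iff a).1 h0.symm
    exact ⟨r, by rw [← h0, map_smul, h.map_unit, sub_self, norm_zero, mul_zero]⟩
  · obtain ⟨f, hf, r, hr⟩ := hn ((L a)⁻¹ • a) (by
      rw [hL.smul, abs_of_pos (inv_pos.2 hpos), inv_mul_cancel₀ hpos.ne'])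
    have hfm : ‖ι f‖ ≤ |m| := (hm ⟨f, hf, rfl⟩).trans (le_abs_self m)
    refine ⟨L a * r, ?_⟩
    have e : ι a - (L a * r) • v = L a • ((ι ((L a)⁻¹ • a) - ι f - r • v) + ι f) := by
      rw [map_smul, smul_add, smul_sub, smul_sub, smul_inv_smul₀ hpos.ne', smul_smul]
      abel
    rw [e, norm_smul, Real.norm_of_nonneg hpos.le, mul_comm]
    gcongr
    exact (norm_add_le _ _).trans (add_le_add hr hfm)

end Embedding

section Bridge

variable {X Y : OrderUnitPair.{u}} {N : Type*} [NormedAddCommGroup N] [NormedSpace ℝ N] {v : N}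
  {ι : X.A →ₗ[ℝ] N} {κ : Y.A →ₗ[ℝ] N}

/-- If, inside a common normed space, every element of each of two spaces is within `γ` times its
seminorm of an element of the other whose seminorm is no larger, then the quantum distance is at
most `γ`.  The bridge is `max (L_X x) (L_Y y) (γ⁻¹ ‖x - y‖)`. -/
lemma distQ_le_of_approx (hv : ‖v‖ = 1) (hι : IsUnitalEmbedding v ι) (hκ : IsUnitalEmbedding v κ)
    (hX : IsPrecompactLip X.L) (hY : IsPrecompactLip Y.L) {γ : ℝ} (hγ : 0 < γ)
    (hXY : ∀ x, ∃ y, Y.L y ≤ X.L x ∧ ‖ι x - κ y‖ ≤ γ * X.L x)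
    (hYX : ∀ y, ∃ x, X.L x ≤ Y.L y ∧ ‖ι x - κ y‖ ≤ γ * Y.L y) :
    distQ X Y ≤ ENNReal.ofReal γ := by
  let L : X.A.prod Y.A → ℝ := fun p => max (max (X.L p.1) (Y.L p.2)) (γ⁻¹ * ‖ι p.1 - κ p.2‖)
  have hLX : ∀ x y, X.L x ≤ L (x, y) := fun x y => (le_max_left _ _).trans (le_max_left _ _)
  have hLY : ∀ x y, Y.L y ≤ L (x, y) := fun x y => (le_max_right _ _).trans (le_max_left _ _)
  have hN : ∀ x y, ‖ι x - κ y‖ ≤ γ * L (x, y) := fun x y => by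
    rw [← inv_mul_le_iff₀ hγ]; exact le_max_right _ _
  have hL0 : ∀ p, 0 ≤ L p := fun p => (hX.nonneg p.1).trans (hLX p.1 p.2)
  have hle : ∀ (x : X.A) (y : Y.A) (m : ℝ), X.L x ≤ m → Y.L y ≤ m → ‖ι x - κ y‖ ≤ γ * m →
      L (x, y) ≤ m := fun x y m h₁ h₂ h₃ =>
    max_le (max_le h₁ h₂) ((inv_mul_le_iff₀ hγ).2 h₃)
  have hadd : ∀ p q, L (p + q) ≤ L p + L q := by
    rintro ⟨x, y⟩ ⟨x', y'⟩
    refine hle (x + x') (y + y') _ ?_ ?_ ?_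
    · exact (hX.add_le x x').trans (add_le_add (hLX _ _) (hLX _ _))
    · exact (hY.add_le y y').trans (add_le_add (hLY _ _) (hLY _ _))
    · rw [map_add, map_add, add_sub_add_comm, mul_add]
      exact (norm_add_le _ _).trans (add_le_add (hN _ _) (hN _ _))
  have hsmul : ∀ (t : ℝ) p, L (t • p) = |t| * L p := smul_eq_of_smul_le hL0 fun t p => by
    obtain ⟨x, y⟩ := p
    refine hle (t • x) (t • y) _ ?_ ?_ ?_
    · rw [hX.smul]; gcongr; exact hLX _ _
    · rw [hY.smul]; gcongr; exact hLY _ _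
    · rw [map_smul, map_smul, ← smul_sub, norm_smul, Real.norm_eq_abs, mul_left_comm]
      gcongr; exact hN _ _
  have hunit : L (X.A.prod Y.A).unit = 0 := by
    refine le_antisymm (hle X.A.unit Y.A.unit 0 ?_ ?_ ?_) (hL0 _)
    · exact ((hX.eq_zero_iff _).2 ⟨1, (one_smul _ _).symm⟩).le
    · exact ((hY.eq_zero_iff _).2 ⟨1, (one_smul _ _).symm⟩).le
    · rw [hι.map_unit, hκ.map_unit, sub_self, norm_zero, mul_zero]
  have hF : ∀ (F : N →L[ℝ] ℝ), ‖F‖ ≤ 1 → ∀ x y, |F (ι x) - F (κ y)| ≤ γ * L (x, y) :=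
    fun F hF x y => by
      rw [← map_sub]
      exact (F.le_opNorm _).trans ((mul_le_of_le_one_left (norm_nonneg _) hF).trans (hN x y))
  have hrho : ∀ (μ : X.A.State) (ν : Y.A.State) (F : N →L[ℝ] ℝ), ‖F‖ ≤ 1 →
      (∀ x, F (ι x) = μ x) → (∀ y, F (κ y) = ν y) →
      rho L (State.inl Y.A μ) (State.inr X.A ν) ≤ ENNReal.ofReal γ := by
    intro μ ν F h₁ h₂ h₃
    refine (rho_le_iff hγ.le).2 fun p hp => ?_
    have := hF F h₁ p.1 p.2
    rw [h₂, h₃] at this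
    exact this.trans (mul_le_of_le_one_right hγ.le hp)
  have hbridge : L ∈ bridges X.L Y.L := by
    refine ⟨?_, fun x => ?_, fun y => ?_⟩
    · obtain ⟨F, hF₁, hFv⟩ := exists_dual_vector ℝ v (by rw [hv]; exact one_ne_zero)
      have hFv' : F v = 1 := by simpa [hv] using hFv
      exact (hX.prod hY hadd hsmul hunit hLX hLY (μ := hι.restrict F hF₁.le hFv')
        (ν := hκ.restrict F hF₁.le hFv') (hF F hF₁.le)).isLipNorm
    · refine le_antisymm (le_ciInf fun y => hLX x y) ?_
      obtain ⟨y, h₁, h₂⟩ := hXY x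
      exact (ciInf_le ⟨0, by rintro _ ⟨y, rfl⟩; exact hL0 _⟩ y).trans (hle x y _ le_rfl h₁ h₂)
    · refine le_antisymm (le_ciInf fun x => hLY x y) ?_
      obtain ⟨x, h₁, h₂⟩ := hYX y
      exact (ciInf_le ⟨0, by rintro _ ⟨x, rfl⟩; exact hL0 _⟩ x).trans (hle x y _ h₁ le_rfl h₂)
  refine (iInf₂_le L hbridge).trans (hausdorff_le (fun μ => ?_) fun ν => ?_)
  · obtain ⟨F, h₁, h₂, h₃⟩ := hι.exists_extension μ
    exact ⟨hκ.restrict F h₁ h₂, hrho _ _ F h₁ h₃ fun _ => rfl⟩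
  · obtain ⟨F, h₁, h₂, h₃⟩ := hκ.exists_extension ν
    exact ⟨hι.restrict F h₁ h₂, hrho _ _ F h₁ (fun _ => rfl) h₃⟩

/-- A version of `distQ_le_of_approx` in which the approximants have a seminorm larger by a factor
`c`: they are pulled back towards the scalars, which costs `(c - 1) R` for spaces of radius `R`. -/
theorem distQ_le_of_approx_mul (hv : ‖v‖ = 1) (hι : IsUnitalEmbedding v ι)
    (hκ : IsUnitalEmbedding v κ) (hX : IsPrecompactLip X.L) (hY : IsPrecompactLip Y.L)
    {c η R γ : ℝ} (hc : 1 ≤ c) (hγ : 0 ≤ γ) (hcγ : η + (c - 1) * R ≤ γ)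
    (hXY : ∀ x, ∃ y, ∃ t : ℝ, Y.L y ≤ c * X.L x ∧ ‖ι x - κ y‖ ≤ η * X.L x ∧
      ‖ι x - t • v‖ ≤ R * X.L x)
    (hYX : ∀ y, ∃ x, ∃ t : ℝ, X.L x ≤ c * Y.L y ∧ ‖ι x - κ y‖ ≤ η * Y.L y ∧
      ‖κ y - t • v‖ ≤ R * Y.L y) :
    distQ X Y ≤ ENNReal.ofReal γ := by
  have hc0 : 0 < c := by linarith
  have hci : c⁻¹ ≤ 1 := inv_le_one_of_one_le₀ hc
  have hc1 : 1 - c⁻¹ ≤ c - 1 := by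
    have : c * c⁻¹ = 1 := mul_inv_cancel₀ hc0.ne'
    nlinarith
  have key : ∀ (a b : N) (t l ε : ℝ), 0 ≤ l → 0 < ε → ‖a - b‖ ≤ η * l → ‖a - t • v‖ ≤ R * l →
      ‖a - (c⁻¹ • b + ((1 - c⁻¹) * t) • v)‖ ≤ (γ + ε) * l := by
    intro a b t l ε hl hε h₁ h₂
    have e : a - (c⁻¹ • b + ((1 - c⁻¹) * t) • v)
        = c⁻¹ • (a - b) + (1 - c⁻¹) • (a - t • v) := by module
    have e₁ : ‖c⁻¹ • (a - b)‖ ≤ ‖a - b‖ := by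
      rw [norm_smul, Real.norm_of_nonneg (inv_nonneg.2 hc0.le)]
      exact mul_le_of_le_one_left (norm_nonneg _) hci
    have e₂ : ‖(1 - c⁻¹) • (a - t • v)‖ ≤ (c - 1) * ‖a - t • v‖ := by
      rw [norm_smul, Real.norm_of_nonneg (by linarith)]
      gcongr
    rw [e]
    calc _ ≤ ‖c⁻¹ • (a - b)‖ + ‖(1 - c⁻¹) • (a - t • v)‖ := norm_add_le _ _
      _ ≤ η * l + (c - 1) * (R * l) := by
        refine add_le_add (e₁.trans h₁) (e₂.trans ?_)
        exact mul_le_mul_of_nonneg_left h₂ (by linarith)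
      _ = (η + (c - 1) * R) * l := by ring
      _ ≤ (γ + ε) * l := mul_le_mul_of_nonneg_right (by linarith) hl
  -- `distQ_le_of_approx` needs a positive constant, while `γ` may vanish
  have key' : ∀ ε : ℝ, 0 < ε → distQ X Y ≤ ENNReal.ofReal (γ + ε) := by
    intro ε hε
    refine distQ_le_of_approx hv hι hκ hX hY (by linarith) (fun x => ?_) fun y => ?_
    · obtain ⟨y, t, h₁, h₂, h₃⟩ := hXY x
      refine ⟨c⁻¹ • y + ((1 - c⁻¹) * t) • Y.A.unit, ?_, ?_⟩
      · refine (hY.map_add_smul_unit_le _ _).trans ?_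
        rw [hY.smul, abs_of_pos (inv_pos.2 hc0), inv_mul_le_iff₀ hc0]
        exact h₁
      · rw [map_add, map_smul, map_smul, hκ.map_unit]
        exact key _ _ _ _ _ (hX.nonneg x) hε h₂ h₃
    · obtain ⟨x, t, h₁, h₂, h₃⟩ := hYX y
      refine ⟨c⁻¹ • x + ((1 - c⁻¹) * t) • X.A.unit, ?_, ?_⟩
      · refine (hX.map_add_smul_unit_le _ _).trans ?_
        rw [hX.smul, abs_of_pos (inv_pos.2 hc0), inv_mul_le_iff₀ hc0]
        exact h₁
      · rw [map_add, map_smul, map_smul, hι.map_unit, norm_sub_rev]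
        rw [norm_sub_rev] at h₂
        exact key _ _ _ _ _ (hY.nonneg y) hε h₂ h₃
  refine ENNReal.le_of_forall_pos_le_add fun ε hε _ => ?_
  have := key' ε hε
  rwa [ENNReal.ofReal_add hγ (NNReal.coe_nonneg ε), ENNReal.ofReal_coe_nnreal] at this

lemma distQ_self (hv : ‖v‖ = 1) (hι : IsUnitalEmbedding v ι) (hX : IsPrecompactLip X.L) :
    distQ X X = 0 := by
  obtain ⟨R, -, hR⟩ := hι.exists_radius hX
  have h : ∀ x, ∃ y, ∃ t : ℝ, X.L y ≤ 1 * X.L x ∧ ‖ι x - ι y‖ ≤ 0 * X.L x ∧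
      ‖ι x - t • v‖ ≤ R * X.L x := fun x => by
    obtain ⟨t, ht⟩ := hR x
    exact ⟨x, t, by rw [one_mul], by rw [sub_self, norm_zero, zero_mul], ht⟩
  have := distQ_le_of_approx_mul (γ := 0) hv hι hι hX hX le_rfl le_rfl (by simp) h fun y => by
    obtain ⟨t, ht⟩ := hR y
    exact ⟨y, t, by rw [one_mul], by rw [sub_self, norm_zero, zero_mul], ht⟩
  rw [ENNReal.ofReal_zero] at this
  exact le_antisymm this zero_le

/-- Spaces of finite radius are at finite distance: approximate by scalars. -/
lemma distQ_ne_top (hv : ‖v‖ = 1) (hι : IsUnitalEmbedding v ι) (hκ : IsUnitalEmbedding v κ)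
    (hX : IsPrecompactLip X.L) (hY : IsPrecompactLip Y.L) : distQ X Y ≠ ⊤ := by
  obtain ⟨R, hR0, hR⟩ := hι.exists_radius hX
  obtain ⟨S, hS0, hS⟩ := hκ.exists_radius hY
  refine ne_top_of_le_ne_top (ENNReal.ofReal_ne_top (r := R + S))
    (distQ_le_of_approx_mul (c := 1) (η := R + S) (R := R + S) hv hι hκ hX hY le_rfl
      (by positivity) (by simp) (fun x => ?_) fun y => ?_)
  · obtain ⟨t, ht⟩ := hR x
    have ht' : ‖ι x - t • v‖ ≤ (R + S) * X.L x :=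
      ht.trans (mul_le_mul_of_nonneg_right (by linarith) (hX.nonneg x))
    refine ⟨t • Y.A.unit, t, ?_, ?_, ht'⟩
    · rw [hY.map_smul_unit, one_mul]; exact hX.nonneg x
    · rw [map_smul, hκ.map_unit]; exact ht'
  · obtain ⟨t, ht⟩ := hS y
    have ht' : ‖κ y - t • v‖ ≤ (R + S) * Y.L y :=
      ht.trans (mul_le_mul_of_nonneg_right (by linarith) (hY.nonneg y))
    refine ⟨t • X.A.unit, t, ?_, ?_, ht'⟩
    · rw [hX.map_smul_unit, one_mul]; exact hY.nonneg y
    · rw [map_smul, hι.map_unit, norm_sub_rev]; exact ht'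

lemma distQ_comm (hv : ‖v‖ = 1) (hι : IsUnitalEmbedding v ι) (hκ : IsUnitalEmbedding v κ)
    (hX : IsPrecompactLip X.L) (hY : IsPrecompactLip Y.L) : distQ X Y = distQ Y X := by
  have := hι.nonempty_state hv
  have := hκ.nonempty_state hv
  refine le_antisymm ?_ ?_
  · have := distQ_triangle (Y := Y) hX hY
    rwa [distQ_self hv hκ hY, add_zero] at this
  · have := distQ_triangle (Y := X) hY hX
    rwa [distQ_self hv hι hX, add_zero] at this

end Bridge

/-! ### Lip-norms have precompact unit ball -/

section ArzelaAscoli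

variable {A : OrderUnitSpace.{u}}

/-- The state space is weak-* compact: it is a closed subset of a product of intervals. -/
lemma compactSpace_state : @CompactSpace A.State A.weakStar := by
  let _ := A.weakStar
  have hind : Topology.IsInducing (fun (μ : A.State) (a : A) => μ a) := ⟨rfl⟩
  have hbd : ∀ a : A, ∃ r : ℝ, -(r • A.unit) ≤ a ∧ a ≤ r • A.unit := fun a => by
    obtain ⟨r, hr⟩ := A.exists_le a
    obtain ⟨s, hs⟩ := A.exists_le (-a)
    exact ⟨max r s, neg_le.1 (hs.trans (smul_unit_mono (le_max_right r s))),
      hr.trans (smul_unit_mono (le_max_left r s))⟩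
  choose b hb₁ hb₂ using hbd
  rw [← isCompact_univ_iff, hind.isCompact_iff]
  refine (isCompact_univ_pi fun a => isCompact_Icc (a := -b a) (b := b a)).of_isClosed_subset
    ?_ ?_
  · have : (fun (μ : A.State) (a : A) => μ a) '' Set.univ
        = {f : A → ℝ | (∀ a a', f (a + a') = f a + f a') ∧ (∀ (r : ℝ) a, f (r • a) = r * f a) ∧
          f A.unit = 1 ∧ ∀ (a : A) (r : ℝ), -(r • A.unit) ≤ a → a ≤ r • A.unit → |f a| ≤ r} := by
      ext f
      constructor
      · rintro ⟨μ, -, rfl⟩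
        exact ⟨fun a a' => map_add _ _ _, fun r a => map_smul _ _ _, μ.2.1, μ.2.2⟩
      · rintro ⟨h₁, h₂, h₃, h₄⟩
        exact ⟨⟨⟨⟨f, h₁⟩, h₂⟩, h₃, h₄⟩, trivial, rfl⟩
    rw [this]
    have hev : ∀ a : A, Continuous fun f : A → ℝ => f a := fun a => continuous_apply a
    simp only [Set.ofPred_and, Set.ofPred_forall]
    refine IsClosed.inter ?_ (IsClosed.inter ?_ (IsClosed.inter ?_ ?_))
    · exact isClosed_iInter fun a => isClosed_iInter fun a' =>
        isClosed_eq (hev _) ((hev _).add (hev _))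
    · exact isClosed_iInter fun r => isClosed_iInter fun a =>
        isClosed_eq (hev _) (continuous_const.mul (hev _))
    · exact isClosed_eq (hev _) continuous_const
    · exact isClosed_iInter fun a => isClosed_iInter fun r => isClosed_iInter fun _ =>
        isClosed_iInter fun _ => isClosed_le (hev _).abs continuous_const
  · rintro _ ⟨μ, -, rfl⟩ a -
    exact abs_le.1 (μ.2.2 a _ (hb₁ a) (hb₂ a))

/-- The state `(1 - t) μ + t ν`. -/
def State.segment (μ ν : A.State) (t : ℝ) (h₀ : 0 ≤ t) (h₁ : t ≤ 1) : A.State :=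
  ⟨(1 - t) • μ.1 + t • ν.1, by simp [μ.2.1, ν.2.1], fun a r hr hr' => by
    have e₁ := μ.2.2 a r hr hr'
    have e₂ := ν.2.2 a r hr hr'
    change |(1 - t) * μ a + t * ν a| ≤ r
    calc |(1 - t) * μ a + t * ν a| ≤ |(1 - t) * μ a| + |t * ν a| := abs_add_le _ _
      _ = (1 - t) * |μ a| + t * |ν a| := by
        rw [abs_mul, abs_mul, abs_of_nonneg h₀, abs_of_nonneg (sub_nonneg.2 h₁)]
      _ ≤ (1 - t) * r + t * r := by gcongr
      _ = r := by ring⟩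

/-- The segment from `μ` to `ν` is weak-* continuous, and points of it near `μ` are at finite
distance from `μ`; by homogeneity so is `ν`. -/
lemma IsLipNorm.rho_ne_top {L : A → ℝ} (h : IsLipNorm L) (μ ν : A.State) : rho L μ ν ≠ ⊤ := by
  let s : Set.Icc (0 : ℝ) 1 → A.State := fun t => State.segment μ ν t t.2.1 t.2.2
  have hs : @Continuous _ _ _ A.weakStar s := by
    let _ := A.weakStar
    refine continuous_induced_rng.2 (continuous_pi fun a => ?_)
    change Continuous fun t : Set.Icc (0 : ℝ) 1 => (1 - (t : ℝ)) * μ a + t * ν a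
    fun_prop
  rw [← h.topology_eq] at hs
  let _ := rhoSpace L
  have hs0 : s ⟨0, by simp⟩ = μ := by
    apply Subtype.ext; simp [s, State.segment]
  have hc := hs.continuousAt (x := ⟨0, by simp⟩)
  rw [ContinuousAt, hs0] at hc
  obtain ⟨t, ht, ht0⟩ : ∃ t : Set.Icc (0 : ℝ) 1, rho L (s t) μ < 1 ∧ (0 : ℝ) < t := by
    have h1 := hc (Metric.eball_mem_nhds μ one_pos)
    rw [Filter.mem_map, Metric.mem_nhds_iff] at h1
    obtain ⟨ε, hε, hsub⟩ := h1
    have hm : 0 < min (ε / 2) 1 := by positivity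
    refine ⟨⟨min (ε / 2) 1, hm.le, min_le_right _ _⟩, hsub ?_, hm⟩
    rw [Metric.mem_ball, Subtype.dist_eq, Real.dist_eq, sub_zero]
    change |min (ε / 2) 1| < ε
    rw [abs_of_pos hm]
    exact (min_le_left _ _).trans_lt (by linarith)
  refine ne_top_of_le_ne_top ENNReal.ofReal_ne_top
    ((rho_le_iff (c := (t : ℝ)⁻¹) (inv_nonneg.2 ht0.le)).2 fun a ha => ?_)
  have e := (abs_sub_le_of_rho ht.ne_top ha).trans
    (ENNReal.toReal_mono ENNReal.one_ne_top ht.le)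
  have e₁ : s t a - μ a = -((t : ℝ) * (μ a - ν a)) := by
    change (1 - (t : ℝ)) * μ a + t * ν a - μ a = _
    ring
  rw [e₁, abs_neg, abs_mul, abs_of_pos ht0, ENNReal.toReal_one] at e
  rwa [← one_div, le_div_iff₀ ht0, mul_comm]

/-- A set whose image is totally bounded has finite nets consisting of its own points. -/
lemma exists_finite_net {X M : Type*} [PseudoMetricSpace M] {f : X → M} {s : Set X}
    (h : TotallyBounded (f '' s)) {ε : ℝ} (hε : 0 < ε) :
    ∃ F ⊆ s, F.Finite ∧ ∀ x ∈ s, ∃ y ∈ F, dist (f x) (f y) < ε := by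
  obtain ⟨t, hts, htf, ht⟩ := Metric.finite_approx_of_totallyBounded h ε hε
  choose g hg hgf using hts
  have : Finite t := htf
  refine ⟨Set.range fun y : t => g y.2, Set.range_subset_iff.2 fun y => hg y.2,
    Set.finite_range _, fun x hx => ?_⟩
  obtain ⟨y, hy, hxy⟩ := Set.mem_iUnion₂.1 (ht ⟨x, hx, rfl⟩)
  exact ⟨g hy, ⟨⟨y, hy⟩, rfl⟩, by rw [hgf hy]; exact hxy⟩

/-- If states determine the order-unit norm, a Lip-norm has precompact unit ball.  This is the
Arzelà-Ascoli argument: elements of the ball are `1`-Lipschitz functions on the state space, which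
is totally bounded for `ρ_L`. -/
theorem IsLipNorm.isPrecompactLip {L : A → ℝ} (h : IsLipNorm L) [Nonempty A.State]
    (hord : ∀ (a : A) (r : ℝ), (∀ μ : A.State, |μ a| ≤ r) →
      -(r • A.unit) ≤ a ∧ a ≤ r • A.unit) : IsPrecompactLip L where
  add_le := h.add_le
  smul := h.smul
  eq_zero_iff := h.eq_zero_iff
  net ε hε := by
    have hcomp := compactSpace_state (A := A)
    have hrho := h.rho_ne_top
    rw [← h.topology_eq] at hcomp
    let _ := rhoSpace L
    obtain ⟨T, hT, hTn⟩ := EMetric.totallyBounded_iff.1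
      (isCompact_univ (X := A.State)).totallyBounded (ENNReal.ofReal (ε / 3))
      (ENNReal.ofReal_pos.2 (by linarith))
    obtain ⟨μ₀⟩ := ‹Nonempty A.State›
    have : Fintype T := hT.fintype
    let Φ : A → T → ℝ := fun a μ => μ.1 a - μ₀ a
    have hΦ : TotallyBounded (Φ '' {a | L a ≤ 1}) := by
      refine (isCompact_univ_pi fun μ : T => isCompact_Icc (a := -(rho L μ.1 μ₀).toReal)
        (b := (rho L μ.1 μ₀).toReal)).totallyBounded.subset ?_
      rintro _ ⟨a, ha, rfl⟩ μ -
      exact abs_le.1 (abs_sub_le_of_rho (hrho _ _) ha)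
    obtain ⟨F, hFs, hF, hFn⟩ := exists_finite_net hΦ (ε := ε / 3) (by linarith)
    refine ⟨F, hF, fun a ha => ?_⟩
    obtain ⟨f, hf, haf⟩ := hFn a ha
    refine ⟨f, hf, μ₀ a - μ₀ f, hord _ _ fun μ => ?_⟩
    obtain ⟨ν, hν, hμν⟩ := Set.mem_iUnion₂.1 (hTn (Set.mem_univ μ))
    have hμν' : rho L μ ν < ENNReal.ofReal (ε / 3) := hμν
    have e := ENNReal.toReal_mono ENNReal.ofReal_ne_top hμν'.le
    rw [ENNReal.toReal_ofReal (by linarith)] at e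
    have e₁ := (abs_sub_le_of_rho (hrho μ ν) ha).trans e
    have e₂ := (abs_sub_le_of_rho (hrho μ ν) (hFs hf)).trans e
    have e₃ : |(ν a - μ₀ a) - (ν f - μ₀ f)| ≤ ε / 3 :=
      ((dist_le_pi_dist (Φ a) (Φ f) ⟨ν, hν⟩).trans_lt haf).le
    rw [map_sub, map_sub, μ.map_smul_unit]
    rw [abs_le] at e₁ e₂ e₃ ⊢
    constructor <;> linarith

end ArzelaAscoli
end OrderUnitSpace

open OrderUnitSpace

/-! ### Order-unit spaces of self-adjoint operators -/

section Operators

variable {E : Type u} [NormedAddCommGroup E] [InnerProductSpace ℂ E] [CompleteSpace E]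

/-- The norm of a self-adjoint operator is its numerical radius. -/
lemma norm_le_iff_of_isSelfAdjoint [Nontrivial E] {a : E →L[ℂ] E} (ha : IsSelfAdjoint a) (r : ℝ) :
    ‖a‖ ≤ r ↔ ∀ x : E, |RCLike.re (inner ℂ (a x) x)| ≤ r * ‖x‖ ^ 2 := by
  constructor
  · intro h x
    calc |RCLike.re (inner ℂ (a x) x)| ≤ ‖inner ℂ (a x) x‖ := RCLike.abs_re_le_norm _
      _ ≤ ‖a x‖ * ‖x‖ := norm_inner_le_norm _ _
      _ ≤ r * ‖x‖ * ‖x‖ := by gcongr; exact a.le_of_opNorm_le h x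
      _ = r * ‖x‖ ^ 2 := by ring
  · intro h
    have hr : 0 ≤ r := by
      obtain ⟨x, hx⟩ := exists_ne (0 : E)
      have := (abs_nonneg _).trans (h x)
      exact nonneg_of_mul_nonneg_left this (by positivity)
    rw [a.norm_eq_iSup_rayleighQuotient
      ((ContinuousLinearMap.isSelfAdjoint_iff_isSymmetric).1 ha)]
    refine ciSup_le fun x => ?_
    rw [ContinuousLinearMap.rayleighQuotient, ContinuousLinearMap.reApplyInnerSelf_apply, abs_div,
      abs_of_nonneg (sq_nonneg ‖x‖)]
    exact div_le_of_le_mul₀ (sq_nonneg _) hr (h x)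

variable {S : Submodule ℝ (E →L[ℂ] E)} {hS : ∀ a ∈ S, IsSelfAdjoint a}
  {h1 : (1 : E →L[ℂ] E) ∈ S}

lemma ofOperators_order_iff (a : ofOperators S hS h1) (r : ℝ) :
    (-(r • (ofOperators S hS h1).unit) ≤ a ∧ a ≤ r • (ofOperators S hS h1).unit) ↔
      ∀ x : E, |RCLike.re (inner ℂ (a.1 x) x)| ≤ r * ‖x‖ ^ 2 := by
  have e₁ : a ≤ r • (ofOperators S hS h1).unit ↔
      ∀ x : E, RCLike.re (inner ℂ (a.1 x) x) ≤ r * ‖x‖ ^ 2 :=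
    (le_iff_re_inner (hS a.1 a.2) (isSelfAdjoint_smul_one r)).trans
      (by simp only [re_inner_smul_one])
  have e₂ : -(r • (ofOperators S hS h1).unit) ≤ a ↔
      ∀ x : E, -(r * ‖x‖ ^ 2) ≤ RCLike.re (inner ℂ (a.1 x) x) := by
    have : -(r • (ofOperators S hS h1).unit) = (-r) • (ofOperators S hS h1).unit :=
      (neg_smul _ _).symm
    rw [this]
    refine (le_iff_re_inner (isSelfAdjoint_smul_one (-r)) (hS a.1 a.2)).trans ?_
    simp only [re_inner_smul_one, neg_mul]
  rw [e₁, e₂]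
  simp only [abs_le, forall_and]

/-- The inclusion of an order-unit space of operators into the algebra of bounded operators. -/
def ofOperatorsIncl (S : Submodule ℝ (E →L[ℂ] E)) (hS : ∀ a ∈ S, IsSelfAdjoint a)
    (h1 : (1 : E →L[ℂ] E) ∈ S) : ofOperators S hS h1 →ₗ[ℝ] (E →L[ℂ] E) :=
  S.subtype

lemma isUnitalEmbedding_ofOperators [Nontrivial E] :
    IsUnitalEmbedding 1 (ofOperatorsIncl S hS h1) where
  map_unit := rfl
  norm_le_iff a r :=
    (norm_le_iff_of_isSelfAdjoint (hS a.1 a.2) r).trans (ofOperators_order_iff a r).symm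

/-- The vector state of a unit vector. -/
def vectorState (x : E) (hx : ‖x‖ = 1) : (ofOperators S hS h1).State :=
  ⟨{ toFun := fun a => RCLike.re (inner ℂ (a.1 x) x)
     map_add' := fun a b => by
      change RCLike.re (inner ℂ (a.1 x + b.1 x) x) = _
      rw [inner_add_left, map_add]
     map_smul' := fun r a => by
      change RCLike.re (inner ℂ (r • a.1 x) x) = r * _
      rw [inner_smul_left_eq_smul, RCLike.smul_re] },
    by
      change RCLike.re (inner ℂ x x) = (1 : ℝ)
      rw [inner_self_eq_norm_sq, hx, one_pow],
    fun a r h₁ h₂ => by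
      have := (ofOperators_order_iff a r).1 ⟨h₁, h₂⟩ x
      rwa [hx, one_pow, mul_one] at this⟩

/-- Vector states determine the operator order. -/
lemma ofOperators_order_of_states (a : ofOperators S hS h1) (r : ℝ)
    (h : ∀ μ : (ofOperators S hS h1).State, |μ a| ≤ r) :
    -(r • (ofOperators S hS h1).unit) ≤ a ∧ a ≤ r • (ofOperators S hS h1).unit := by
  refine (ofOperators_order_iff a r).2 fun x => ?_
  rcases eq_or_ne x 0 with rfl | hx
  · simp
  · have hn : ‖x‖ ≠ 0 := norm_ne_zero_iff.2 hx
    have hu : ‖((‖x‖⁻¹ : ℝ) : ℂ) • x‖ = 1 := by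
      rw [norm_smul, Complex.norm_real, norm_inv, norm_norm, inv_mul_cancel₀ hn]
    have h2 : |RCLike.re (inner ℂ (a.1 (((‖x‖⁻¹ : ℝ) : ℂ) • x)) (((‖x‖⁻¹ : ℝ) : ℂ) • x))| ≤ r :=
      h (vectorState _ hu)
    rw [map_smul, inner_smul_left, inner_smul_right, Complex.conj_ofReal, ← mul_assoc,
      ← Complex.ofReal_mul] at h2
    have h3 : RCLike.re (((‖x‖⁻¹ * ‖x‖⁻¹ : ℝ) : ℂ) * inner ℂ (a.1 x) x)
        = (‖x‖⁻¹ * ‖x‖⁻¹) * RCLike.re (inner ℂ (a.1 x) x) := RCLike.re_ofReal_mul _ _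
    rw [h3, abs_mul, abs_of_nonneg (by positivity), ← mul_inv, ← sq,
      inv_mul_le_iff₀ (by positivity)] at h2
    linarith

/-- The inclusion of the scalars into the bounded operators. -/
def realIncl (E : Type u) [NormedAddCommGroup E] [InnerProductSpace ℂ E] :
    OrderUnitSpace.real.{u} →ₗ[ℝ] (E →L[ℂ] E) :=
  (LinearMap.toSpanSingleton ℝ (E →L[ℂ] E) 1) ∘ₗ (ULift.moduleEquiv (R := ℝ) (M := ℝ)).toLinearMap

omit [CompleteSpace E] in
lemma isUnitalEmbedding_real [Nontrivial E] : IsUnitalEmbedding 1 (realIncl E) where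
  map_unit := by
    change (1 : ℝ) • (1 : E →L[ℂ] E) = 1
    rw [one_smul]
  norm_le_iff a r := by
    change ‖a.down • (1 : E →L[ℂ] E)‖ ≤ r ↔ -(r * 1) ≤ a.down ∧ a.down ≤ r * 1
    rw [norm_smul, norm_one, mul_one, mul_one, Real.norm_eq_abs, abs_le]

lemma isPrecompactLip_real : IsPrecompactLip (A := OrderUnitSpace.real.{u}) fun _ => 0 where
  add_le _ _ := by simp
  smul _ _ := by simp
  eq_zero_iff a := by
    refine iff_of_true rfl ⟨a.down, ?_⟩
    apply ULift.ext
    change a.down = a.down * 1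
    rw [mul_one]
  net ε hε := by
    refine ⟨{0}, Set.finite_singleton _, fun a _ => ⟨0, rfl, a.down, ?_⟩⟩
    have : a - 0 - a.down • OrderUnitSpace.real.{u}.unit = 0 := by
      apply ULift.ext
      change a.down - 0 - a.down * 1 = 0
      ring
    rw [this]
    have h : 0 ≤ ε • OrderUnitSpace.real.{u}.unit :=
      smul_nonneg hε.le OrderUnitSpace.real.{u}.unit_nonneg
    exact ⟨neg_nonpos.2 h, h⟩

end Operators

/-! ### Unbounded operators with compact resolvent -/

section Unbounded

variable {E : Type u} [NormedAddCommGroup E] [InnerProductSpace ℂ E]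

/-- `D` is symmetric; no density of the domain is required. -/
def IsSymm (D : E →ₗ.[ℂ] E) : Prop :=
  ∀ x y : D.domain, inner ℂ (D x) (y : E) = inner ℂ (x : E) (D y)

lemma isSymm_of_isSelfAdjoint [CompleteSpace E] {D : E →ₗ.[ℂ] E} (hD : IsSelfAdjoint D) :
    IsSymm D := by
  have h := LinearPMap.adjoint_isFormalAdjoint hD.dense_domain
  rw [LinearPMap.isSelfAdjoint_def.1 hD] at h
  exact h

lemma opNorm_nonneg (f : E →ₗ.[ℂ] E) : 0 ≤ opNorm f :=
  Real.sInf_nonneg fun _ h => h.1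

lemma opNorm_le {f : E →ₗ.[ℂ] E} {c : ℝ} (hc : 0 ≤ c)
    (h : ∀ x : f.domain, ‖f x‖ ≤ c * ‖(x : E)‖) : opNorm f ≤ c :=
  csInf_le ⟨0, fun _ h => h.1⟩ ⟨hc, h⟩

/-- The operator norm of a bounded operator is attained as a bound. -/
lemma IsBdd.le_opNorm {f : E →ₗ.[ℂ] E} (hf : IsBdd f) (x : f.domain) :
    ‖f x‖ ≤ opNorm f * ‖(x : E)‖ := by
  obtain ⟨C, hC⟩ := hf
  have hne : {C : ℝ | 0 ≤ C ∧ ∀ x : f.domain, ‖f x‖ ≤ C * ‖(x : E)‖}.Nonempty :=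
    ⟨|C|, abs_nonneg C, fun x => (hC x).trans (by gcongr; exact le_abs_self C)⟩
  rcases (norm_nonneg (x : E)).eq_or_lt with h0 | hpos
  · have := hC x
    rwa [← h0, mul_zero] at this ⊢
  · rw [← div_le_iff₀ hpos]
    exact le_csInf hne fun c hc => (div_le_iff₀ hpos).2 (hc.2 x)

lemma mem_comm_domain {D : E →ₗ.[ℂ] E} {a : E →L[ℂ] E} {x : E} :
    x ∈ (comm D a).domain ↔ a x ∈ D.domain ∧ x ∈ D.domain := Iff.rfl

lemma comm_apply {D : E →ₗ.[ℂ] E} {a : E →L[ℂ] E} {x : E} (hx : x ∈ (comm D a).domain) :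
    comm D a ⟨x, hx⟩ = D ⟨a x, hx.1⟩ - a (D ⟨x, hx.2⟩) := rfl

/-- If `⟪z, y⟫` is bounded by `c ‖y‖` for `y` in a dense set, then `‖z‖ ≤ c`. -/
lemma norm_le_of_dense {z : E} {c : ℝ} {s : Set E} (hc : 0 ≤ c) (hs : Dense s)
    (h : ∀ y ∈ s, ‖inner ℂ z y‖ ≤ c * ‖y‖) : ‖z‖ ≤ c := by
  have hcl : IsClosed {y : E | ‖inner ℂ z y‖ ≤ c * ‖y‖} :=
    isClosed_le (by fun_prop) (by fun_prop)
  have h' : ‖inner ℂ z z‖ ≤ c * ‖z‖ := hcl.closure_subset_iff.2 h (hs z)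
  have e : ‖inner ℂ z z‖ = ‖z‖ * ‖z‖ := by
    rw [inner_self_eq_norm_sq_to_K, norm_pow, RCLike.norm_ofReal, abs_norm, sq]
  rw [e] at h'
  rcases (norm_nonneg z).eq_or_lt with h0 | hpos
  · rwa [← h0]
  · exact le_of_mul_le_mul_right h' hpos

lemma inner_apply_left [CompleteSpace E] {a : E →L[ℂ] E} (ha : IsSelfAdjoint a) (x y : E) :
    inner ℂ (a x) y = inner ℂ x (a y) :=
  (ContinuousLinearMap.isSelfAdjoint_iff_isSymmetric.1 ha) x y

/-- The commutator of a symmetric and a bounded self-adjoint operator is skew-symmetric. -/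
lemma inner_comm_left [CompleteSpace E] {D : E →ₗ.[ℂ] E} {a : E →L[ℂ] E} (hD : IsSymm D)
    (ha : IsSelfAdjoint a) (x y : (comm D a).domain) :
    inner ℂ (comm D a x) (y : E) = -inner ℂ (x : E) (comm D a y) := by
  obtain ⟨x, hx⟩ := x
  obtain ⟨y, hy⟩ := y
  rw [comm_apply, comm_apply, inner_sub_left, inner_sub_right, inner_apply_left ha,
    hD ⟨a x, hx.1⟩ ⟨y, hy.2⟩, ← inner_apply_left ha x, ← hD ⟨x, hx.2⟩ ⟨a y, hy.1⟩, neg_sub]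

/-- A bound for the commutator on a dense part of its domain holds on all of its domain. -/
lemma comm_bound_of_dense [CompleteSpace E] {D : E →ₗ.[ℂ] E} {a : E →L[ℂ] E} (hD : IsSymm D)
    (ha : IsSelfAdjoint a) {s : Set E} (hs : Dense s) {c : ℝ} (hc : 0 ≤ c)
    (h : ∀ y ∈ s, ∃ hy : y ∈ (comm D a).domain, ‖comm D a ⟨y, hy⟩‖ ≤ c * ‖y‖)
    (x : (comm D a).domain) : ‖comm D a x‖ ≤ c * ‖(x : E)‖ := by
  refine norm_le_of_dense (by positivity) hs fun y hy => ?_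
  obtain ⟨hy', hb⟩ := h y hy
  rw [inner_comm_left hD ha x ⟨y, hy'⟩, norm_neg]
  calc _ ≤ ‖(x : E)‖ * ‖comm D a ⟨y, hy'⟩‖ := norm_inner_le_norm _ _
    _ ≤ ‖(x : E)‖ * (c * ‖y‖) := by gcongr
    _ = c * ‖(x : E)‖ * ‖y‖ := by ring

/-- Commutators are linear where both are defined. -/
lemma comm_linear_comb {D : E →ₗ.[ℂ] E} {a b : E →L[ℂ] E} (r q : ℝ)
    {x : E} (ha : x ∈ (comm D a).domain)
    (hb : x ∈ (comm D b).domain) :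
    ∃ h : x ∈ (comm D (r • a + q • b)).domain,
      comm D (r • a + q • b) ⟨x, h⟩
        = (r : ℂ) • comm D a ⟨x, ha⟩ + (q : ℂ) • comm D b ⟨x, hb⟩ := by
  have hm : (r • a + q • b) x ∈ D.domain :=
    D.domain.add_mem (D.domain.smul_mem (r : ℂ) ha.1) (D.domain.smul_mem (q : ℂ) hb.1)
  refine ⟨mem_comm_domain.2 ⟨hm, ha.2⟩, ?_⟩
  have e : D ⟨(r • a + q • b) x, hm⟩ = (r : ℂ) • D ⟨a x, ha.1⟩ + (q : ℂ) • D ⟨b x, hb.1⟩ := by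
    rw [← LinearPMap.map_smul, ← LinearPMap.map_smul, ← LinearPMap.map_add]; rfl
  have e' : (r • a + q • b) (D ⟨x, ha.2⟩)
      = (r : ℂ) • a (D ⟨x, ha.2⟩) + (q : ℂ) • b (D ⟨x, ha.2⟩) := rfl
  rw [comm_apply, comm_apply, comm_apply, e, e']
  module

end Unbounded

section Resolvent

variable {E : Type u} [NormedAddCommGroup E] [InnerProductSpace ℂ E] {D : E →ₗ.[ℂ] E}

lemma norm_sub_starProjection_le {F : Submodule ℂ E} [F.HasOrthogonalProjection] (x : E) {y : E}
    (hy : y ∈ F) : ‖x - F.starProjection x‖ ≤ ‖x - y‖ := by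
  rw [Submodule.starProjection_minimal]
  exact ciInf_le ⟨0, by rintro _ ⟨z, rfl⟩; exact norm_nonneg _⟩ (⟨y, hy⟩ : F)

/-- A compact operator maps into a finite-dimensional space up to a small error in norm. -/
lemma exists_finiteDimensional_of_isCompactOperator {R : E →L[ℂ] E} (hR : IsCompactOperator R)
    {ε : ℝ} (hε : 0 < ε) : ∃ F : Submodule ℂ E, ∃ _ : FiniteDimensional ℂ F,
      ∀ y, ‖R y - F.starProjection (R y)‖ ≤ ε * ‖y‖ := by
  obtain ⟨K, hK, hRK⟩ := hR.image_closedBall_subset_compact (f := (R : E →ₗ[ℂ] E)) 1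
  obtain ⟨t, ht, htn⟩ := Metric.totallyBounded_iff.1 hK.totallyBounded ε hε
  have hfin : FiniteDimensional ℂ (Submodule.span ℂ t) := FiniteDimensional.span_of_finite ℂ ht
  refine ⟨Submodule.span ℂ t, hfin, fun y => ?_⟩
  set P := (Submodule.span ℂ t).starProjection
  have h1 : ∀ y : E, ‖y‖ ≤ 1 → ‖R y - P (R y)‖ ≤ ε := fun y hy => by
    obtain ⟨c, hc, hyc⟩ := Set.mem_iUnion₂.1 (htn (hRK ⟨y, by simpa using hy, rfl⟩))
    refine (norm_sub_starProjection_le _ (Submodule.subset_span hc)).trans ?_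
    rw [← dist_eq_norm]
    exact (Metric.mem_ball.1 hyc).le
  exact ((R - P ∘L R).le_opNorm y).trans (by
    gcongr
    refine ContinuousLinearMap.opNorm_le_of_unit_norm hε.le fun z hz => h1 z hz.le)

/-- A symmetric operator `D` with compact resolvent has compact domain inclusion: in the graph
norm, `dom D` is close to finite-dimensional spaces.  For `z` the component of `x` orthogonal to
`F`, one has `‖z‖² = ⟪x, z⟫ = ⟪x, R z⟫ + ⟪D x, D R z⟫` with `R = (1 + D²)⁻¹`, and
`‖R z‖² + ‖D R z‖² = ⟪R z, z⟫` is small because `R` is compact. -/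
theorem HasCompactResolvent.exists_finiteDimensional (hD : IsSymm D) (hR : HasCompactResolvent D)
    {ε : ℝ} (hε : 0 < ε) : ∃ F : Submodule ℂ E, ∃ _ : FiniteDimensional ℂ F,
      ∀ x : D.domain, ‖(x : E) - F.starProjection x‖ ≤ ε * (‖(x : E)‖ + ‖D x‖) := by
  obtain ⟨R, hRc, hR, -⟩ := hR
  obtain ⟨F, hF, hFR⟩ := exists_finiteDimensional_of_isCompactOperator hRc (sq_pos_of_pos hε)
  refine ⟨F, hF, fun x => ?_⟩
  set z := (x : E) - F.starProjection x with hz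
  have hzF : ∀ y ∈ F, inner ℂ y z = 0 := fun y hy =>
    (Submodule.mem_orthogonal F z).1 (Submodule.sub_starProjection_mem_orthogonal _) y hy
  obtain ⟨h₁, h₂, h₃⟩ := hR z
  set w : D.domain := ⟨R z, h₁⟩ with hw
  set w' : D.domain := ⟨D w, h₂⟩ with hw'
  have e₁ : inner ℂ (x : E) z = inner ℂ z z := by
    conv_rhs => rw [hz, inner_sub_left, hzF _ (Submodule.starProjection_apply_mem _ _), sub_zero]
  have e₂ : inner ℂ (x : E) z = inner ℂ (x : E) (R z) + inner ℂ (D x) (D w) := by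
    conv_lhs => rw [← h₃, inner_add_right]
    rw [hD x w']
  have e₃ : inner ℂ (R z) z = inner ℂ (R z) (R z) + inner ℂ (D w) (D w) := by
    conv_lhs => arg 3; rw [← h₃]
    rw [inner_add_right, hD w w']
  have e₄ : inner ℂ (R z) z = inner ℂ (R z - F.starProjection (R z)) z := by
    rw [inner_sub_left, hzF _ (Submodule.starProjection_apply_mem _ _), sub_zero]
  have n₁ : ‖z‖ ^ 2 ≤ ‖(x : E)‖ * ‖R z‖ + ‖D x‖ * ‖D w‖ := by
    have : ‖inner ℂ z z‖ = ‖z‖ ^ 2 := by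
      rw [inner_self_eq_norm_sq_to_K, norm_pow, RCLike.norm_ofReal, abs_norm]
    rw [← this, ← e₁, e₂]
    exact (norm_add_le _ _).trans (add_le_add (norm_inner_le_norm _ _) (norm_inner_le_norm _ _))
  have n₂ : ‖R z‖ ^ 2 + ‖D w‖ ^ 2 ≤ (ε * ‖z‖) ^ 2 := by
    have h : ‖inner ℂ (R z) z‖ = ‖R z‖ ^ 2 + ‖D w‖ ^ 2 := by
      rw [e₃, inner_self_eq_norm_sq_to_K, inner_self_eq_norm_sq_to_K]
      have : ((‖R z‖ : ℂ) ^ 2 + (‖D w‖ : ℂ) ^ 2) = ((‖R z‖ ^ 2 + ‖D w‖ ^ 2 : ℝ) : ℂ) := by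
        push_cast; rfl
      refine (congrArg norm this).trans ?_
      rw [Complex.norm_real, Real.norm_of_nonneg (by positivity)]
    rw [← h, e₄]
    calc _ ≤ ‖R z - F.starProjection (R z)‖ * ‖z‖ := norm_inner_le_norm _ _
      _ ≤ ε ^ 2 * ‖z‖ * ‖z‖ := by gcongr; exact hFR z
      _ = (ε * ‖z‖) ^ 2 := by ring
  have n₃ : ‖R z‖ ≤ ε * ‖z‖ :=
    abs_le_of_sq_le_sq' (by nlinarith [sq_nonneg ‖D w‖]) (by positivity) |>.2
  have n₄ : ‖D w‖ ≤ ε * ‖z‖ :=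
    abs_le_of_sq_le_sq' (by nlinarith [sq_nonneg ‖R z‖]) (by positivity) |>.2
  rcases (norm_nonneg z).eq_or_lt with h0 | hpos
  · rw [← h0]; positivity
  · refine le_of_mul_le_mul_right ?_ hpos
    calc ‖z‖ * ‖z‖ = ‖z‖ ^ 2 := (sq _).symm
      _ ≤ ‖(x : E)‖ * (ε * ‖z‖) + ‖D x‖ * (ε * ‖z‖) := n₁.trans (by gcongr)
      _ = ε * (‖(x : E)‖ + ‖D x‖) * ‖z‖ := by ring

/-- On a closed subspace that meets the kernel trivially, an operator with compact resolvent is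
bounded below: `‖x - R x‖ ≤ ‖D x‖` for `R = (1 + D²)⁻¹`, so unit vectors `xₙ` of the subspace with
`D xₙ → 0` would accumulate at a unit vector `x = R x`, for which `D x = 0`. -/
theorem HasCompactResolvent.exists_bound (hD : IsSymm D) (hR : HasCompactResolvent D)
    {V : Submodule ℂ E} (hV : IsClosed (V : Set E))
    (hker : ∀ x : D.domain, (x : E) ∈ V → D x = 0 → x = 0) :
    ∃ G : ℝ, 0 ≤ G ∧ ∀ x : D.domain, (x : E) ∈ V → ‖(x : E)‖ ≤ G * ‖D x‖ := by
  obtain ⟨R, hRc, hR, -⟩ := hR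
  have hRD : ∀ x : D.domain, ‖(x : E) - R x‖ ≤ ‖D x‖ := fun x => by
    obtain ⟨h₁, h₂, h₃⟩ := hR x
    set w : D.domain := ⟨R x, h₁⟩ with hw
    set w' : D.domain := ⟨D w, h₂⟩ with hw'
    have e : (x : E) - R x = D w' := sub_eq_of_eq_add' h₃.symm
    have e' : ((x - w : D.domain) : E) = D w' := e
    have n : ‖D w'‖ ^ 2 + ‖D w‖ ^ 2 ≤ ‖D x‖ * ‖D w‖ := by
      have h : inner ℂ (D w') (D w') = inner ℂ (D x) (D w) - inner ℂ (D w) (D w) := by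
        conv_lhs => arg 2; rw [← e']
        rw [← hD (x - w) w', LinearPMap.map_sub, inner_sub_left]
      have h' : ‖D w'‖ ^ 2 = RCLike.re (inner ℂ (D x) (D w)) - ‖D w‖ ^ 2 := by
        rw [← inner_self_eq_norm_sq (𝕜 := ℂ), h, map_sub, inner_self_eq_norm_sq]
      have := (RCLike.re_le_norm (inner ℂ (D x) (D w))).trans (norm_inner_le_norm _ _)
      linarith
    rw [e]
    refine abs_le_of_sq_le_sq' ?_ (norm_nonneg _) |>.2
    nlinarith [sq_nonneg (‖D x‖ - ‖D w‖), sq_nonneg ‖D x‖, sq_nonneg ‖D w‖]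
  by_contra! hcon
  have hseq : ∀ n : ℕ, ∃ x : D.domain, (x : E) ∈ V ∧ ‖(x : E)‖ = 1 ∧ ‖D x‖ ≤ 1 / ((n : ℝ) + 1) := by
    intro n
    obtain ⟨x, hxV, hx⟩ := hcon (n + 1) (by positivity)
    have hpos : 0 < ‖(x : E)‖ := (by positivity : (0 : ℝ) ≤ (n + 1) * ‖D x‖).trans_lt hx
    refine ⟨((‖(x : E)‖⁻¹ : ℝ) : ℂ) • x, V.smul_mem _ hxV, ?_, ?_⟩
    · rw [Submodule.coe_smul, norm_smul, Complex.norm_real, norm_inv, norm_norm,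
        inv_mul_cancel₀ hpos.ne']
    · rw [LinearPMap.map_smul, norm_smul, Complex.norm_real, norm_inv, norm_norm,
        inv_mul_le_iff₀ hpos, mul_one_div, le_div_iff₀ (by positivity)]
      linarith
  choose x hxV hx1 hxD using hseq
  obtain ⟨K, hK, hRK⟩ := hRc.image_closedBall_subset_compact (f := (R : E →ₗ[ℂ] E)) 1
  obtain ⟨y, -, φ, hφ, hy⟩ := hK.tendsto_subseq (x := fun n => R (x n))
    fun n => hRK ⟨x n, by simp [hx1], rfl⟩
  have hdiff : Filter.Tendsto (fun n => (x (φ n) : E) - R (x (φ n))) Filter.atTop (nhds 0) := by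
    refine squeeze_zero_norm (fun n => (hRD _).trans (hxD _)) ?_
    exact (tendsto_one_div_add_atTop_nhds_zero_nat (𝕜 := ℝ)).comp hφ.tendsto_atTop
  have hxy : Filter.Tendsto (fun n => (x (φ n) : E)) Filter.atTop (nhds y) := by
    simpa using hdiff.add hy
  have hyV : y ∈ V := hV.mem_of_tendsto hxy (Filter.Eventually.of_forall fun n => hxV _)
  have hy1 : ‖y‖ = 1 := tendsto_nhds_unique hxy.norm (by simp [hx1])
  have hRy : R y = y := tendsto_nhds_unique ((R.continuous.tendsto y).comp hxy) hy
  obtain ⟨h₁, h₂, h₃⟩ := hR y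
  have hyd : y ∈ D.domain := hRy ▸ h₁
  have e₁ : D ⟨R y, h₁⟩ = D ⟨y, hyd⟩ := by congr 1; exact Subtype.ext hRy
  have e₂ : D ⟨D ⟨R y, h₁⟩, h₂⟩ = 0 := add_eq_left.1 (h₃.trans hRy.symm)
  have e₃ : D ⟨R y, h₁⟩ = 0 := by
    rw [← inner_self_eq_zero (𝕜 := ℂ)]
    have := hD ⟨D ⟨R y, h₁⟩, h₂⟩ ⟨R y, h₁⟩
    rw [e₂, inner_zero_left] at this
    exact this.symm
  have h0 := hker ⟨y, hyd⟩ hyV (e₁ ▸ e₃)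
  have : y = 0 := congrArg Subtype.val h0
  rw [this, norm_zero] at hy1
  exact zero_ne_one hy1

/-- If the unit ball of `D` is close to finite-dimensional spaces, the self-adjoint operators `k`
with `‖D k‖ ≤ 1` form a totally bounded set: such a `k` is close to its compression to a
finite-dimensional space. -/
theorem totallyBounded_selfAdjoint_mul_bounded [CompleteSpace E] {G : ℝ}
    (hG : ∀ x : D.domain, ‖(x : E)‖ ≤ G * ‖D x‖)
    (hfin : ∀ ε : ℝ, 0 < ε → ∃ F : Submodule ℂ E, ∃ _ : FiniteDimensional ℂ F,
      ∀ x : D.domain, ‖(x : E) - F.starProjection x‖ ≤ ε * ‖D x‖) :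
    TotallyBounded {k : E →L[ℂ] E | IsSelfAdjoint k ∧
      ∀ x, ∃ h : k x ∈ D.domain, ‖D ⟨k x, h⟩‖ ≤ ‖x‖} := by
  refine Metric.totallyBounded_iff.2 fun ε hε => ?_
  obtain ⟨F, hF, hFD⟩ := hfin (ε / 6) (by positivity)
  set P : E →L[ℂ] E := F.starProjection with hP
  have hPn : ‖P‖ ≤ 1 := F.starProjection_norm_le
  have hPsa : IsSelfAdjoint P := isSelfAdjoint_starProjection F
  let Ψ : (F →L[ℂ] F) → (E →L[ℂ] E) := fun m => F.subtypeL ∘L m ∘L F.orthogonalProjectionOnto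
  have hΨ : Continuous Ψ := by fun_prop
  have hprop : ProperSpace (F →L[ℂ] F) := FiniteDimensional.proper ℂ (F →L[ℂ] F)
  have hcomp : IsCompact (Ψ '' Metric.closedBall 0 |G|) := (isCompact_closedBall _ _).image hΨ
  obtain ⟨t, ht, htn⟩ := Metric.totallyBounded_iff.1 hcomp.totallyBounded (ε / 2) (by positivity)
  refine ⟨t, ht, ?_⟩
  rintro k ⟨hk, hkD⟩
  have hkn : ‖k‖ ≤ |G| := k.opNorm_le_bound (abs_nonneg _) fun x => by
    obtain ⟨h, hx⟩ := hkD x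
    calc ‖k x‖ ≤ G * ‖D ⟨k x, h⟩‖ := hG ⟨k x, h⟩
      _ ≤ |G| * ‖D ⟨k x, h⟩‖ := by gcongr; exact le_abs_self G
      _ ≤ |G| * ‖x‖ := by gcongr
  have n₁ : ‖k - P * k‖ ≤ ε / 6 := (k - P * k).opNorm_le_bound (by positivity) fun x => by
    obtain ⟨h, hx⟩ := hkD x
    exact (hFD ⟨k x, h⟩).trans (by gcongr)
  have n₂ : ‖k - k * P‖ ≤ ε / 6 := by
    have e : star (k - P * k) = k - k * P := by
      rw [star_sub, star_mul, hk.star_eq, hPsa.star_eq]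
    rw [← e, norm_star]
    exact n₁
  have n₃ : ‖k - P * k * P‖ ≤ ε / 3 := by
    have e : k - P * k * P = (k - P * k) + P * (k - k * P) := by rw [mul_sub, mul_assoc]; abel
    rw [e]
    calc _ ≤ ‖k - P * k‖ + ‖P‖ * ‖k - k * P‖ :=
          (norm_add_le _ _).trans (add_le_add le_rfl (norm_mul_le _ _))
      _ ≤ ε / 6 + 1 * (ε / 6) := by gcongr
      _ = ε / 3 := by ring
  have hmem : P * k * P ∈ Ψ '' Metric.closedBall 0 |G| := by
    refine ⟨F.orthogonalProjectionOnto ∘L k ∘L F.subtypeL, ?_, ?_⟩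
    · refine (mem_closedBall_zero_iff (E := F →L[ℂ] F)).2 ?_
      refine ContinuousLinearMap.opNorm_le_bound _ (abs_nonneg _) fun x => ?_
      calc _ ≤ ‖k x‖ := by
            refine (F.orthogonalProjectionOnto.le_opNorm _).trans ?_
            exact mul_le_of_le_one_left (norm_nonneg _) F.orthogonalProjectionOnto_norm_le
        _ ≤ |G| * ‖x‖ := k.le_of_opNorm_le hkn x
    · ext x; rfl
  obtain ⟨c, hc, hkc⟩ := Set.mem_iUnion₂.1 (htn hmem)
  refine Set.mem_iUnion₂.2 ⟨c, hc, ?_⟩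
  rw [Metric.mem_ball] at hkc ⊢
  have h₁ : dist k (P * k * P) ≤ ε / 3 := (dist_eq_norm _ _).trans_le n₃
  linarith [dist_triangle k (P * k * P) c]

end Resolvent

variable {H : Type u} [NormedAddCommGroup H] [InnerProductSpace ℂ H] [CompleteSpace H]

namespace ToeplitzQuadruple

variable (Q : ToeplitzQuadruple H)

-- makes the orthogonal projection onto `V` available
instance : CompleteSpace Q.V := Q.complete

/-! ### The Hilbert space `PH` and the operator `D_p` -/

lemma proj_incl (x : Q.PH) : Q.proj (Q.incl x) = x :=
  Q.V.orthogonalProjectionOnto_mem_subspace_eq_self x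

lemma incl_mem (x : Q.PH) : Q.incl x ∈ Q.V := Subtype.mem x

lemma incl_proj_of_mem {y : H} (hy : y ∈ Q.V) : Q.incl (Q.proj y) = y :=
  Submodule.starProjection_eq_self_iff.2 hy

lemma inner_proj_left (u : H) (v : Q.PH) : inner ℂ (Q.proj u) v = inner ℂ u (Q.incl v) :=
  Q.V.inner_orthogonalProjectionOnto_eq_of_mem_right v u

lemma inner_proj_right (u : H) (v : Q.PH) : inner ℂ v (Q.proj u) = inner ℂ (Q.incl v) u :=
  Q.V.inner_orthogonalProjectionOnto_eq_of_mem_left v u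

lemma norm_incl (x : Q.PH) : ‖Q.incl x‖ = ‖x‖ := rfl

lemma norm_proj_le (y : H) : ‖Q.proj y‖ ≤ ‖y‖ :=
  (Q.proj.le_opNorm y).trans
    (mul_le_of_le_one_left (norm_nonneg _) Q.V.orthogonalProjectionOnto_norm_le)

lemma isSymm_D : IsSymm Q.D := isSymm_of_isSelfAdjoint Q.selfAdjoint

lemma incl_proj_mem {y : H} (hy : y ∈ Q.D.domain) : Q.incl (Q.proj y) ∈ Q.D.domain :=
  (Q.commutes ⟨y, hy⟩).1

lemma D_incl_proj {y : H} (hy : y ∈ Q.D.domain) :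
    Q.D ⟨Q.incl (Q.proj y), Q.incl_proj_mem hy⟩ = Q.incl (Q.proj (Q.D ⟨y, hy⟩)) :=
  (Q.commutes ⟨y, hy⟩).2

lemma mem_Dp_domain {x : Q.PH} : x ∈ Q.Dp.domain ↔ Q.incl x ∈ Q.D.domain := Iff.rfl

lemma Dp_apply {x : Q.PH} (hx : x ∈ Q.Dp.domain) :
    Q.Dp ⟨x, hx⟩ = Q.proj (Q.D ⟨Q.incl x, Q.mem_Dp_domain.1 hx⟩) := rfl

lemma incl_Dp {x : Q.PH} (hx : x ∈ Q.Dp.domain) :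
    Q.incl (Q.Dp ⟨x, hx⟩) = Q.D ⟨Q.incl x, Q.mem_Dp_domain.1 hx⟩ := by
  rw [Dp_apply, ← Q.D_incl_proj]
  congr 1
  exact Subtype.ext (congrArg Q.incl (Q.proj_incl x))

/-- `D_p P = P D` on the domain of `D`. -/
lemma Dp_proj {y : H} (hy : y ∈ Q.D.domain) :
    Q.Dp ⟨Q.proj y, Q.mem_Dp_domain.2 (Q.incl_proj_mem hy)⟩ = Q.proj (Q.D ⟨y, hy⟩) := by
  rw [Dp_apply, Q.D_incl_proj hy, proj_incl]

lemma isSymm_Dp : IsSymm Q.Dp := by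
  rintro ⟨x, hx⟩ ⟨y, hy⟩
  rw [Dp_apply, Dp_apply, inner_proj_left, inner_proj_right]
  exact Q.isSymm_D ⟨Q.incl x, hx⟩ ⟨Q.incl y, hy⟩

/-- `D_p` is bounded below, as it has trivial kernel and compact resolvent. -/
lemma exists_Dp_bound : ∃ G : ℝ, 0 ≤ G ∧ ∀ x : Q.Dp.domain, ‖(x : Q.PH)‖ ≤ G * ‖Q.Dp x‖ := by
  obtain ⟨G, hG, h⟩ := Q.compactResolvent.exists_bound Q.isSymm_D
    (V := Q.V) (completeSpace_coe_iff_isComplete.1 Q.complete).isClosed Q.ker_trivial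
  refine ⟨G, hG, fun ⟨x, hx⟩ => ?_⟩
  have := h ⟨Q.incl x, hx⟩ (Q.incl_mem x)
  rwa [← Q.incl_Dp hx] at this

lemma exists_finiteDimensional_Dp {ε : ℝ} (hε : 0 < ε) : ∃ F : Submodule ℂ Q.PH,
    ∃ _ : FiniteDimensional ℂ F,
      ∀ x : Q.Dp.domain, ‖(x : Q.PH) - F.starProjection x‖ ≤ ε * ‖Q.Dp x‖ := by
  obtain ⟨G, hG, hGb⟩ := Q.exists_Dp_bound
  obtain ⟨F, hF, hFD⟩ := Q.compactResolvent.exists_finiteDimensional Q.isSymm_D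
    (ε := ε / (G + 1)) (by positivity)
  have hF' : FiniteDimensional ℂ (F.map (Q.proj : H →ₗ[ℂ] Q.PH)) := inferInstance
  refine ⟨F.map (Q.proj : H →ₗ[ℂ] Q.PH), hF', fun ⟨x, hx⟩ => ?_⟩
  have h₁ := hFD ⟨Q.incl x, hx⟩
  have h₂ := hGb ⟨x, hx⟩
  rw [← Q.incl_Dp hx, norm_incl, norm_incl] at h₁
  calc _ ≤ ‖x - Q.proj (F.starProjection (Q.incl x))‖ :=
        norm_sub_starProjection_le x
          (Submodule.mem_map_of_mem (Submodule.starProjection_apply_mem F _))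
    _ = ‖Q.proj (Q.incl x - F.starProjection (Q.incl x))‖ := by rw [map_sub, proj_incl]
    _ ≤ ε / (G + 1) * (‖x‖ + ‖Q.Dp ⟨x, hx⟩‖) := (Q.norm_proj_le _).trans h₁
    _ ≤ ε / (G + 1) * (G * ‖Q.Dp ⟨x, hx⟩‖ + ‖Q.Dp ⟨x, hx⟩‖) := by gcongr
    _ = ε * ‖Q.Dp ⟨x, hx⟩‖ := by field_simp

/-- The common domain of two commutators is dense, as it meets `PH` and its complement in dense
subspaces. -/
lemma dense_inter {a b : H →L[ℂ] H} (ha : a ∈ Q.A) (hb : b ∈ Q.A) :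
    Dense (((comm Q.D a).domain ⊓ (comm Q.D b).domain : Submodule ℂ H) : Set H) := by
  set M := (comm Q.D a).domain ⊓ (comm Q.D b).domain
  have h₁ : Q.V ≤ M.topologicalClosure := fun x hx =>
    closure_mono (fun y hy => hy.1) (Q.dense_P a ha b hb hx)
  have h₂ : Q.Vᗮ ≤ M.topologicalClosure := fun x hx =>
    closure_mono (fun y hy => hy.1) (Q.dense_Q a ha b hb hx)
  rw [Submodule.dense_iff_topologicalClosure_eq_top, eq_top_iff,
    ← Submodule.sup_orthogonal_of_hasOrthogonalProjection (K := Q.V)]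
  exact sup_le h₁ h₂

lemma dense_inter_PH {a b : H →L[ℂ] H} (ha : a ∈ Q.A) (hb : b ∈ Q.A) :
    Dense {x : Q.PH | Q.incl x ∈ (comm Q.D a).domain ∧ Q.incl x ∈ (comm Q.D b).domain} := by
  refine Metric.dense_iff.2 fun x r hr => ?_
  obtain ⟨y, ⟨hy, hyV⟩, hxy⟩ := Metric.mem_closure_iff.1
    (Q.dense_P a ha b hb (Q.incl_mem x)) r hr
  refine ⟨Q.proj y, ?_, ?_⟩
  · rw [Metric.mem_ball, dist_comm, dist_eq_norm, ← norm_incl, map_sub,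
      Q.incl_proj_of_mem hyV, ← dist_eq_norm]
    exact hxy
  · change Q.incl (Q.proj y) ∈ (comm Q.D a).domain ∧ Q.incl (Q.proj y) ∈ (comm Q.D b).domain
    rw [Q.incl_proj_of_mem hyV]
    exact hy

/-- The norm `‖D_p k‖`. -/
def normDp (k : Q.PH →L[ℂ] Q.PH) : ℝ := opNorm (mulRight Q.Dp k)

variable {Q}

lemma memAc.mem_domain {k : Q.PH →L[ℂ] Q.PH} (hk : Q.memAc k) (x : Q.PH) : k x ∈ Q.Dp.domain := by
  have : x ∈ (mulRight Q.Dp k).domain := by rw [hk.2.1.1]; trivial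
  exact this

lemma memAc.norm_Dp_le {k : Q.PH →L[ℂ] Q.PH} (hk : Q.memAc k) (x : Q.PH) :
    ‖Q.Dp ⟨k x, hk.mem_domain x⟩‖ ≤ Q.normDp k * ‖x‖ :=
  hk.2.1.2.le_opNorm ⟨x, hk.mem_domain x⟩

lemma memAc.normDp_le {k : Q.PH →L[ℂ] Q.PH} (hk : Q.memAc k) {c : ℝ} (hc : 0 ≤ c)
    (h : ∀ x, ‖Q.Dp ⟨k x, hk.mem_domain x⟩‖ ≤ c * ‖x‖) : Q.normDp k ≤ c :=
  opNorm_le hc fun x => h x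

variable (Q)

lemma normDp_nonneg (k : Q.PH →L[ℂ] Q.PH) : 0 ≤ Q.normDp k := opNorm_nonneg _

lemma normDp_add_le {k l : Q.PH →L[ℂ] Q.PH} (hk : Q.memAc k) (hl : Q.memAc l) :
    Q.normDp (k + l) ≤ Q.normDp k + Q.normDp l := by
  refine (Q.memAc_add hk hl).normDp_le (add_nonneg (Q.normDp_nonneg k) (Q.normDp_nonneg l))
    fun x => ?_
  have e : Q.Dp ⟨(k + l) x, (Q.memAc_add hk hl).mem_domain x⟩
      = Q.Dp ⟨k x, hk.mem_domain x⟩ + Q.Dp ⟨l x, hl.mem_domain x⟩ :=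
    Q.Dp.map_add ⟨k x, hk.mem_domain x⟩ ⟨l x, hl.mem_domain x⟩
  rw [e, add_mul]
  exact (norm_add_le _ _).trans (add_le_add (hk.norm_Dp_le x) (hl.norm_Dp_le x))

lemma normDp_smul_le (r : ℝ) {k : Q.PH →L[ℂ] Q.PH} (hk : Q.memAc k) :
    Q.normDp (r • k) ≤ |r| * Q.normDp k := by
  refine (Q.memAc_smul r hk).normDp_le (mul_nonneg (abs_nonneg r) (Q.normDp_nonneg k))
    fun x => ?_
  have e : Q.Dp ⟨(r • k) x, (Q.memAc_smul r hk).mem_domain x⟩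
      = (r : ℂ) • Q.Dp ⟨k x, hk.mem_domain x⟩ := Q.Dp.map_smul (r : ℂ) ⟨k x, hk.mem_domain x⟩
  rw [e, norm_smul, Complex.norm_real, Real.norm_eq_abs, mul_assoc]
  exact mul_le_mul_of_nonneg_left (hk.norm_Dp_le x) (abs_nonneg r)

lemma norm_le_normDp {G : ℝ} (hG0 : 0 ≤ G) (hG : ∀ x : Q.Dp.domain, ‖(x : Q.PH)‖ ≤ G * ‖Q.Dp x‖)
    {k : Q.PH →L[ℂ] Q.PH} (hk : Q.memAc k) : ‖k‖ ≤ G * Q.normDp k := by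
  refine k.opNorm_le_bound (mul_nonneg hG0 (Q.normDp_nonneg k)) fun x => ?_
  rw [mul_assoc]
  exact (hG ⟨k x, hk.mem_domain x⟩).trans (mul_le_mul_of_nonneg_left (hk.norm_Dp_le x) hG0)

/-- For self-adjoint `k`, the bound for `D_p k` is also one for `k D_p`. -/
lemma norm_mul_Dp_le {k : Q.PH →L[ℂ] Q.PH} (hk : Q.memAc k) (hsa : IsSelfAdjoint k)
    (x : Q.Dp.domain) : ‖k (Q.Dp x)‖ ≤ Q.normDp k * ‖(x : Q.PH)‖ := by
  refine norm_le_of_dense (mul_nonneg (Q.normDp_nonneg k) (norm_nonneg _)) dense_univ fun y _ => ?_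
  rw [inner_apply_left hsa, Q.isSymm_Dp x ⟨k y, hk.mem_domain y⟩]
  calc _ ≤ ‖(x : Q.PH)‖ * ‖Q.Dp ⟨k y, hk.mem_domain y⟩‖ := norm_inner_le_norm _ _
    _ ≤ ‖(x : Q.PH)‖ * (Q.normDp k * ‖y‖) := by gcongr; exact hk.norm_Dp_le y
    _ = Q.normDp k * ‖(x : Q.PH)‖ * ‖y‖ := by ring

/-- For self-adjoint `k`, a bound for `k D_p` on a dense set is one for `D_p k`. -/
lemma normDp_le_of_dense {k : Q.PH →L[ℂ] Q.PH} (hk : Q.memAc k) (hsa : IsSelfAdjoint k) {c : ℝ}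
    (hc : 0 ≤ c) {s : Set Q.PH} (hs : Dense s)
    (h : ∀ y ∈ s, ∃ hy : y ∈ Q.Dp.domain, ‖k (Q.Dp ⟨y, hy⟩)‖ ≤ c * ‖y‖) : Q.normDp k ≤ c := by
  refine hk.normDp_le hc fun x => norm_le_of_dense (by positivity) hs fun y hy => ?_
  obtain ⟨hy', hb⟩ := h y hy
  rw [Q.isSymm_Dp ⟨k x, hk.mem_domain x⟩ ⟨y, hy'⟩, inner_apply_left hsa]
  calc _ ≤ ‖x‖ * ‖k (Q.Dp ⟨y, hy'⟩)‖ := norm_inner_le_norm _ _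
    _ ≤ ‖x‖ * (c * ‖y‖) := by gcongr
    _ = c * ‖x‖ * ‖y‖ := by ring

lemma normDp_zero : Q.normDp 0 = 0 :=
  le_antisymm (Q.memAc_zero.normDp_le le_rfl fun x => by
    have : Q.Dp ⟨(0 : Q.PH →L[ℂ] Q.PH) x, Q.memAc_zero.mem_domain x⟩ = 0 := Q.Dp.map_zero
    rw [this, norm_zero, zero_mul]) (Q.normDp_nonneg 0)

/-- Finite nets for the self-adjoint `k` in `A_c` with `‖D_p k‖ ≤ c`. -/
lemma exists_net_Ac (c : ℝ) {ε : ℝ} (hε : 0 < ε) :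
    ∃ F : Set (Q.PH →L[ℂ] Q.PH), F.Finite ∧ (∀ l ∈ F, Q.memAc l ∧ IsSelfAdjoint l) ∧
      ∀ k, Q.memAc k → IsSelfAdjoint k → Q.normDp k ≤ c → ∃ l ∈ F, ‖k - l‖ < ε := by
  obtain ⟨G, -, hG⟩ := Q.exists_Dp_bound
  have htb := totallyBounded_selfAdjoint_mul_bounded hG fun ε hε => Q.exists_finiteDimensional_Dp hε
  have hm : 0 < |c| + 1 := by positivity
  have htb' := htb.image (f := fun k => (|c| + 1) • k) (uniformContinuous_const_smul _)
  obtain ⟨F, hFs, hF, hn⟩ := exists_finite_net (f := id)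
    (s := {k | Q.memAc k ∧ IsSelfAdjoint k ∧ Q.normDp k ≤ c}) (htb'.subset (by
      rintro _ ⟨k, ⟨hk, hsa, hc⟩, rfl⟩
      refine ⟨(|c| + 1)⁻¹ • k, ⟨(IsSelfAdjoint.all _).smul hsa, fun x =>
        ⟨(Q.memAc_smul _ hk).mem_domain x, ?_⟩⟩, smul_inv_smul₀ hm.ne' k⟩
      refine ((Q.memAc_smul _ hk).norm_Dp_le x).trans (mul_le_of_le_one_left (norm_nonneg _) ?_)
      refine (Q.normDp_smul_le _ hk).trans ?_
      rw [abs_of_pos (inv_pos.2 hm), inv_mul_le_iff₀ hm]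
      linarith [le_abs_self c])) hε
  refine ⟨F, hF, fun l hl => ⟨(hFs hl).1, (hFs hl).2.1⟩, fun k h₁ h₂ h₃ => ?_⟩
  obtain ⟨l, hl, hkl⟩ := hn k ⟨h₁, h₂, h₃⟩
  exact ⟨l, hl, by rwa [dist_eq_norm] at hkl⟩

/-! ### The space `A_C` -/

lemma T_one : Q.T 1 = 1 := by
  ext x; exact Q.proj_incl x

lemma T_add (a b : H →L[ℂ] H) : Q.T (a + b) = Q.T a + Q.T b := by
  ext; simp [T]

lemma T_smul (r : ℝ) (a : H →L[ℂ] H) : Q.T (r • a) = r • Q.T a := by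
  rw [← Complex.coe_smul, ← Complex.coe_smul]
  ext; simp [T]

lemma T_sub (a b : H →L[ℂ] H) : Q.T (a - b) = Q.T a - Q.T b := by
  ext; simp [T]

lemma norm_T_le (a : H →L[ℂ] H) : ‖Q.T a‖ ≤ ‖a‖ :=
  (Q.T a).opNorm_le_bound (norm_nonneg _) fun x =>
    (Q.norm_proj_le _).trans (a.le_opNorm (Q.incl x))

lemma mem_cstar {a : H →L[ℂ] H} (ha : a ∈ Q.A) : a ∈ Q.cstar :=
  Q.A.le_topologicalClosure ha

/-- The identity of `PH` is not compact, as the map to the Calkin algebra is injective. -/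
lemma not_isCompactOperator_one [Nontrivial H] :
    ¬ IsCompactOperator (1 : Q.PH →L[ℂ] Q.PH) := fun h => by
  have := Q.faithful 1 (Q.mem_cstar (one_mem _)) 0 (Q.mem_cstar (zero_mem _)) (by
    have e : compress Q.V (1 : H →L[ℂ] H) - compress Q.V 0 = Q.T 1 - Q.T 0 := rfl
    have e' : Q.T 0 = 0 := by ext; simp [T]
    rw [e, e', T_one, sub_zero]
    exact h)
  exact one_ne_zero this

lemma nontrivial_PH [Nontrivial H] : Nontrivial Q.PH := by
  by_contra hn
  rw [not_nontrivial_iff_subsingleton] at hn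
  refine Q.not_isCompactOperator_one ?_
  have : (1 : Q.PH →L[ℂ] Q.PH) = 0 := by ext x; exact Subsingleton.elim _ _
  rw [this]
  exact isCompactOperator_zero

/-- The inclusion of `A_C` into the bounded operators on `PH`. -/
def inclC : Q.ouC →ₗ[ℝ] (Q.PH →L[ℂ] Q.PH) :=
  ofOperatorsIncl Q.spaceC (fun _ => Q.isSelfAdjoint_of_mem_spaceC) Q.one_mem_spaceC

lemma isUnitalEmbedding_inclC [Nontrivial H] : IsUnitalEmbedding 1 Q.inclC :=
  haveI := Q.nontrivial_PH
  isUnitalEmbedding_ofOperators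

/-- The decomposition `k + r` that defines `L_C` is unique, since `1` is not compact. -/
lemma LC_eq [Nontrivial H] (x : Q.ouC) {k : Q.PH →L[ℂ] Q.PH} {r : ℝ} (hk : Q.memAc k)
    (h : Q.inclC x = k + r • 1) : Q.LC x = Q.normDp k := by
  obtain ⟨⟨hk', -⟩, r', h'⟩ := Classical.choose_spec x.2
  have e : Classical.choose x.2 = k := by
    set k' := Classical.choose x.2
    have hr : r' = r := by
      by_contra hne
      refine Q.not_isCompactOperator_one ?_
      have e : (1 : Q.PH →L[ℂ] Q.PH) = (r' - r)⁻¹ • (k - k') := by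
        have : k - k' = (r' - r) • (1 : Q.PH →L[ℂ] Q.PH) := by
          have := h.symm.trans h'
          rw [sub_smul, sub_eq_sub_iff_add_eq_add, this, add_comm]
        rw [this, inv_smul_smul₀ (sub_ne_zero.2 hne)]
      have hc : IsCompactOperator (k - k' : Q.PH →L[ℂ] Q.PH) := hk.1.sub hk'.1
      have hc' : IsCompactOperator ((r' - r)⁻¹ • (k - k') : Q.PH →L[ℂ] Q.PH) := hc.smul (r' - r)⁻¹
      exact e ▸ hc'
    rw [hr] at h'
    exact add_right_cancel (h'.symm.trans h)
  rw [LC, e, normDp]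

lemma LC_nonneg (x : Q.ouC) : 0 ≤ Q.LC x := by
  unfold LC; exact opNorm_nonneg _

lemma exists_decomp_C (x : Q.ouC) :
    ∃ k, (Q.memAc k ∧ IsSelfAdjoint k) ∧ ∃ r : ℝ, Q.inclC x = k + r • 1 := x.2

/-- `β L_C` is a Lip-norm with precompact ball. -/
theorem isPrecompactLip_LC [Nontrivial H] {β : ℝ} (hβ : 0 < β) :
    IsPrecompactLip fun x : Q.ouC => β * Q.LC x := by
  refine Q.isUnitalEmbedding_inclC.isPrecompactLip ?_ ?_ ?_ ?_
  · intro x y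
    obtain ⟨k, ⟨hk, -⟩, r, hx⟩ := Q.exists_decomp_C x
    obtain ⟨l, ⟨hl, -⟩, s, hy⟩ := Q.exists_decomp_C y
    have hxy : Q.inclC (x + y) = (k + l) + (r + s) • 1 := by
      rw [map_add, hx, hy, add_smul]; abel
    rw [Q.LC_eq x hk hx, Q.LC_eq y hl hy, Q.LC_eq (x + y) (Q.memAc_add hk hl) hxy, ← mul_add]
    exact mul_le_mul_of_nonneg_left (Q.normDp_add_le hk hl) hβ.le
  · refine smul_eq_of_smul_le (M := Q.ouC) (L := fun x => β * Q.LC x)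
      (fun x => mul_nonneg hβ.le (Q.LC_nonneg x)) fun c x => ?_
    obtain ⟨k, ⟨hk, -⟩, r, hx⟩ := Q.exists_decomp_C x
    have hcx : Q.inclC (c • x) = c • k + (c * r) • 1 := by
      rw [map_smul, hx, smul_add, smul_smul]
    rw [Q.LC_eq x hk hx, Q.LC_eq (c • x) (Q.memAc_smul c hk) hcx, mul_left_comm]
    exact mul_le_mul_of_nonneg_left (Q.normDp_smul_le c hk) hβ.le
  · intro x
    constructor
    · intro h
      obtain ⟨k, ⟨hk, -⟩, r, hx⟩ := Q.exists_decomp_C x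
      have h' := (mul_eq_zero.1 h).resolve_left hβ.ne'
      rw [Q.LC_eq x hk hx] at h'
      obtain ⟨G, hG0, hG⟩ := Q.exists_Dp_bound
      have hk0 : k = 0 := by
        have := Q.norm_le_normDp hG0 hG hk
        rw [h', mul_zero] at this
        exact norm_le_zero_iff.1 this
      refine ⟨r, Q.isUnitalEmbedding_inclC.injective ?_⟩
      rw [hx, hk0, zero_add, map_smul, Q.isUnitalEmbedding_inclC.map_unit]
    · rintro ⟨r, rfl⟩
      have hx : Q.inclC (r • Q.ouC.unit) = (0 : Q.PH →L[ℂ] Q.PH) + r • 1 := by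
        rw [map_smul, Q.isUnitalEmbedding_inclC.map_unit, zero_add]
      rw [Q.LC_eq (r • Q.ouC.unit) Q.memAc_zero hx, normDp_zero, mul_zero]
  · intro ε hε
    obtain ⟨F, hF, hFm, hn⟩ := Q.exists_net_Ac β⁻¹ hε
    refine ⟨(fun x : Q.ouC => x.1) ⁻¹' F, hF.preimage Subtype.val_injective.injOn,
      fun x hx => ?_⟩
    obtain ⟨k, ⟨hk, hsa⟩, r, hxk⟩ := Q.exists_decomp_C x
    rw [Q.LC_eq x hk hxk] at hx
    obtain ⟨l, hl, hkl⟩ := hn k hk hsa (by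
      rw [← one_div, le_div_iff₀ hβ, mul_comm]; exact hx)
    refine ⟨⟨l, l, hFm l hl, 0, by rw [zero_smul, add_zero]⟩, hl, r, ?_⟩
    have e : Q.inclC x - l - r • 1 = k - l := by
      rw [hxk]; abel
    exact (congrArg norm e).trans_le hkl.le

/-! ### The commutator of `D_{α,β}` -/

/-- `t = T(a) + k` with self-adjoint `a ∈ A` and self-adjoint `k ∈ A_c`. -/
structure IsDecomp (t : Q.PH →L[ℂ] Q.PH) (a : H →L[ℂ] H) (k : Q.PH →L[ℂ] Q.PH) : Prop where
  mem : a ∈ Q.A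
  selfAdjoint : IsSelfAdjoint a
  memAc : Q.memAc k
  selfAdjoint' : IsSelfAdjoint k
  eq : t = Q.T a + k

variable {Q} {t s : Q.PH →L[ℂ] Q.PH} {a b : H →L[ℂ] H} {k l : Q.PH →L[ℂ] Q.PH}

namespace IsDecomp

lemma add (h : Q.IsDecomp t a k) (h' : Q.IsDecomp s b l) : Q.IsDecomp (t + s) (a + b) (k + l) :=
  ⟨add_mem h.mem h'.mem, h.selfAdjoint.add h'.selfAdjoint, Q.memAc_add h.memAc h'.memAc,
    h.selfAdjoint'.add h'.selfAdjoint', by rw [h.eq, h'.eq, T_add]; abel⟩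

lemma smul (r : ℝ) (h : Q.IsDecomp t a k) : Q.IsDecomp (r • t) (r • a) (r • k) :=
  ⟨by rw [← Complex.coe_smul]; exact Q.A.smul_mem h.mem (r : ℂ),
    (IsSelfAdjoint.all r).smul h.selfAdjoint, Q.memAc_smul r h.memAc,
    (IsSelfAdjoint.all r).smul h.selfAdjoint', by rw [h.eq, T_smul, smul_add]⟩

lemma isSelfAdjoint (h : Q.IsDecomp t a k) : IsSelfAdjoint t :=
  h.eq ▸ (Q.isSelfAdjoint_T h.selfAdjoint).add h.selfAdjoint'

/-- The symbol of `T(a) + k` is `a`. -/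
lemma rho_eq (h : Q.IsDecomp t a k) : Q.rho t = a := by
  have ha : a ∈ Q.cstar ∧ IsCompactOperator (t - Q.T a) := by
    refine ⟨Q.mem_cstar h.mem, ?_⟩
    have e : t - Q.T a = k := by rw [h.eq, add_sub_cancel_left]
    rw [e]
    exact h.memAc.1
  have hex : ∃ a, a ∈ Q.cstar ∧ IsCompactOperator (t - Q.T a) := ⟨a, ha⟩
  rw [rho, dif_pos hex]
  refine Q.faithful _ hex.choose_spec.1 _ ha.1 ?_
  have hc : IsCompactOperator ((t - Q.T a) - (t - Q.T hex.choose) : Q.PH →L[ℂ] Q.PH) :=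
    ha.2.sub hex.choose_spec.2
  have e : compress Q.V hex.choose - compress Q.V a = (t - Q.T a) - (t - Q.T hex.choose) := by
    rw [sub_sub_sub_cancel_left]; rfl
  rw [e]
  exact hc

lemma mem_Dp_domain (h : Q.IsDecomp t a k) {x : Q.PH} (hax : a (Q.incl x) ∈ Q.D.domain) :
    t x ∈ Q.Dp.domain := by
  rw [h.eq]
  exact Q.Dp.domain.add_mem (Q.mem_Dp_domain.2 (Q.incl_proj_mem hax)) (h.memAc.mem_domain x)

end IsDecomp

variable (Q) in
lemma inner_incl_left (x : Q.PH) (y : H) : inner ℂ (Q.incl x) y = inner ℂ x (Q.proj y) :=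
  (Q.inner_proj_right y x).symm

/-- The entry `P D a - t P D` of the commutator: `β` times it is the component in `PH` of
`[D_{α,β}, π(t)] (0, y)` when `a` is the symbol of `t`. -/
def upper (t : Q.PH →L[ℂ] Q.PH) (a : H →L[ℂ] H) (y : H) (hay : a y ∈ Q.D.domain)
    (hy : y ∈ Q.D.domain) : Q.PH :=
  Q.proj (Q.D ⟨a y, hay⟩) - t (Q.proj (Q.D ⟨y, hy⟩))

/-- The entry `D_p t - a D_p` of the commutator: `[D_{α,β}, π(t)] (x, 0)` is `β` times it, in the
component `H`, when `a` is the symbol of `t`. -/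
def lower (t : Q.PH →L[ℂ] Q.PH) (a : H →L[ℂ] H) (x : Q.PH) (htx : t x ∈ Q.Dp.domain)
    (hx : x ∈ Q.Dp.domain) : H :=
  Q.incl (Q.Dp ⟨t x, htx⟩) - a (Q.incl (Q.Dp ⟨x, hx⟩))

namespace IsDecomp

lemma mem_comm_DK (h : Q.IsDecomp t a k) (α β : ℝ) {x : Q.PH} {y : H} (htx : t x ∈ Q.Dp.domain)
    (hx : x ∈ Q.Dp.domain) (hay : a y ∈ Q.D.domain) (hy : y ∈ Q.D.domain) :
    (WithLp.toLp 2 (x, y) : Q.K) ∈ (comm (Q.DK α β) (Q.rep t)).domain :=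
  ⟨⟨htx, by rw [← h.rho_eq] at hay; exact hay⟩, ⟨hx, hy⟩⟩

lemma of_mem_comm_DK (h : Q.IsDecomp t a k) {α β : ℝ} {w : Q.K}
    (hw : w ∈ (comm (Q.DK α β) (Q.rep t)).domain) :
    t w.fst ∈ Q.Dp.domain ∧ w.fst ∈ Q.Dp.domain ∧ a w.snd ∈ Q.D.domain ∧ w.snd ∈ Q.D.domain := by
  obtain ⟨⟨h₁, h₂⟩, ⟨h₃, h₄⟩⟩ := hw
  refine ⟨h₁, h₃, ?_, h₄⟩
  rw [← h.rho_eq]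
  exact h₂

lemma comm_DK_apply (h : Q.IsDecomp t a k) {α β : ℝ} {x : Q.PH} {y : H} (htx : t x ∈ Q.Dp.domain)
    (hx : x ∈ Q.Dp.domain) (hay : a y ∈ Q.D.domain) (hy : y ∈ Q.D.domain) :
    comm (Q.DK α β) (Q.rep t) ⟨WithLp.toLp 2 (x, y), h.mem_comm_DK α β htx hx hay hy⟩
      = WithLp.toLp 2 ((β : ℂ) • upper t a y hay hy,
          (β : ℂ) • lower t a x htx hx
            + ((α⁻¹ : ℝ) : ℂ) • comm Q.D a ⟨y, mem_comm_domain.2 ⟨hay, hy⟩⟩) := by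
  -- the domain of the commutator mentions `ρ(t)`, so `a` is generalized before it is substituted
  have key : ∀ a' (ha' : Q.rho t = a') (hay' : a' y ∈ Q.D.domain)
      (hw : (WithLp.toLp 2 (x, y) : Q.K) ∈ (comm (Q.DK α β) (Q.rep t)).domain),
      comm (Q.DK α β) (Q.rep t) ⟨WithLp.toLp 2 (x, y), hw⟩
      = WithLp.toLp 2 ((β : ℂ) • upper t a' y hay' hy,
          (β : ℂ) • lower t a' x htx hx
            + ((α⁻¹ : ℝ) : ℂ) • comm Q.D a' ⟨y, mem_comm_domain.2 ⟨hay', hy⟩⟩) := by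
    rintro a' rfl hay' hw
    have e : comm (Q.DK α β) (Q.rep t) ⟨WithLp.toLp 2 (x, y), hw⟩
      = WithLp.toLp 2 (
          (β : ℂ) • Q.proj (Q.D ⟨Q.rho t y, hay'⟩) - t ((β : ℂ) • Q.proj (Q.D ⟨y, hy⟩)),
          ((β : ℂ) • Q.incl (Q.Dp ⟨t x, htx⟩) + ((α⁻¹ : ℝ) : ℂ) • Q.D ⟨Q.rho t y, hay'⟩)
            - Q.rho t ((β : ℂ) • Q.incl (Q.Dp ⟨x, hx⟩) + ((α⁻¹ : ℝ) : ℂ) • Q.D ⟨y, hy⟩)) := rfl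
    rw [e, comm_apply, upper, lower, map_smul, map_add, map_smul, map_smul, smul_sub, smul_sub,
      smul_sub]
    congr 2
    abel
  exact key a h.rho_eq hay _

/-- The two off-diagonal entries are formally adjoint to each other, up to sign. -/
lemma inner_lower (h : Q.IsDecomp t a k) {x : Q.PH} {y : H} (htx : t x ∈ Q.Dp.domain)
    (hx : x ∈ Q.Dp.domain) (hay : a y ∈ Q.D.domain) (hy : y ∈ Q.D.domain) :
    inner ℂ (lower t a x htx hx) y = -inner ℂ x (upper t a y hay hy) := by
  have e₁ : inner ℂ (Q.incl (Q.Dp ⟨t x, htx⟩)) y = inner ℂ x (t (Q.proj (Q.D ⟨y, hy⟩))) := by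
    rw [Q.incl_Dp htx, Q.isSymm_D ⟨Q.incl (t x), Q.mem_Dp_domain.1 htx⟩ ⟨y, hy⟩,
      inner_incl_left, inner_apply_left h.isSelfAdjoint]
  have e₂ : inner ℂ (a (Q.incl (Q.Dp ⟨x, hx⟩))) y = inner ℂ x (Q.proj (Q.D ⟨a y, hay⟩)) := by
    rw [inner_apply_left h.selfAdjoint, Q.incl_Dp hx,
      Q.isSymm_D ⟨Q.incl x, Q.mem_Dp_domain.1 hx⟩ ⟨a y, hay⟩, inner_incl_left]
  rw [lower, upper, inner_sub_left, inner_sub_right, e₁, e₂, neg_sub]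

/-- By duality, a bound for the upper entry is one for the lower entry. -/
lemma norm_lower_le (h : Q.IsDecomp t a k) {c : ℝ} (hc : 0 ≤ c)
    (hu : ∀ y (hay : a y ∈ Q.D.domain) (hy : y ∈ Q.D.domain), ‖upper t a y hay hy‖ ≤ c * ‖y‖)
    {x : Q.PH} (htx : t x ∈ Q.Dp.domain) (hx : x ∈ Q.Dp.domain) :
    ‖lower t a x htx hx‖ ≤ c * ‖x‖ := by
  refine norm_le_of_dense (by positivity) (Q.comm_dense a h.mem) fun y hy => ?_
  rw [h.inner_lower htx hx hy.1 hy.2, norm_neg]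
  calc _ ≤ ‖x‖ * ‖upper t a y hy.1 hy.2‖ := norm_inner_le_norm _ _
    _ ≤ ‖x‖ * (c * ‖y‖) := by gcongr; exact hu y _ _
    _ = c * ‖x‖ * ‖y‖ := by ring

/-- `P D a - t P D = P [P D, a] - k D_p P` is bounded. -/
lemma exists_upper_bound (h : Q.IsDecomp t a k) : ∃ c : ℝ, 0 ≤ c ∧
    ∀ y (hay : a y ∈ Q.D.domain) (hy : y ∈ Q.D.domain), ‖upper t a y hay hy‖ ≤ c * ‖y‖ := by
  have hb := Q.comm_P_bdd a h.mem
  refine ⟨opNorm (comm (mulLeft Q.V.starProjection Q.D) a) + Q.normDp k,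
    add_nonneg (opNorm_nonneg _) (Q.normDp_nonneg k), fun y hay hy => ?_⟩
  have h₁ : ‖Q.incl (Q.proj (Q.D ⟨a y, hay⟩)) - a (Q.incl (Q.proj (Q.D ⟨y, hy⟩)))‖
      ≤ opNorm (comm (mulLeft Q.V.starProjection Q.D) a) * ‖y‖ := hb.le_opNorm ⟨y, hay, hy⟩
  have h₂ := Q.norm_mul_Dp_le h.memAc h.selfAdjoint'
    ⟨Q.proj y, Q.mem_Dp_domain.2 (Q.incl_proj_mem hy)⟩
  rw [Q.Dp_proj hy] at h₂
  have e : upper t a y hay hy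
      = Q.proj (Q.incl (Q.proj (Q.D ⟨a y, hay⟩)) - a (Q.incl (Q.proj (Q.D ⟨y, hy⟩))))
        - k (Q.proj (Q.D ⟨y, hy⟩)) := by
    have eT : ∀ z, Q.T a z = Q.proj (a (Q.incl z)) := fun z => rfl
    rw [upper, h.eq, _root_.add_apply, eT, map_sub, proj_incl]
    abel
  rw [e, add_mul]
  refine (norm_sub_le _ _).trans (add_le_add ((Q.norm_proj_le _).trans h₁) (h₂.trans ?_))
  exact mul_le_mul_of_nonneg_left (Q.norm_proj_le y) (Q.normDp_nonneg k)

end IsDecomp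

lemma norm_toLp_le (x : Q.PH) (y : H) : ‖(WithLp.toLp 2 (x, y) : Q.K)‖ ≤ ‖x‖ + ‖y‖ := by
  have e : (WithLp.toLp 2 (x, y) : Q.K) = WithLp.toLp 2 (x, 0) + WithLp.toLp 2 (0, y) := by
    rw [← WithLp.toLp_add, Prod.mk_add_mk, add_zero, zero_add]
  rw [e]
  refine (norm_add_le _ _).trans (add_le_add ?_ ?_)
  · rw [WithLp.norm_toLp_fst]
  · rw [WithLp.norm_toLp_snd]

/-- The number `‖[D_{α,β}, π(t)]‖`. -/
def normComm (Q : ToeplitzQuadruple H) (α β : ℝ) (t : Q.PH →L[ℂ] Q.PH) : ℝ :=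
  opNorm (comm (Q.DK α β) (Q.rep t))

lemma normComm_nonneg (α β : ℝ) (t : Q.PH →L[ℂ] Q.PH) : 0 ≤ Q.normComm α β t := opNorm_nonneg _

namespace IsDecomp

lemma exists_comm_DK_eq (h : Q.IsDecomp t a k) {α β : ℝ} {w : Q.K}
    (hw : w ∈ (comm (Q.DK α β) (Q.rep t)).domain) :
    ∃ (h₁ : t w.fst ∈ Q.Dp.domain) (h₂ : w.fst ∈ Q.Dp.domain) (h₃ : a w.snd ∈ Q.D.domain)
      (h₄ : w.snd ∈ Q.D.domain), comm (Q.DK α β) (Q.rep t) ⟨w, hw⟩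
      = WithLp.toLp 2 ((β : ℂ) • upper t a w.snd h₃ h₄,
          (β : ℂ) • lower t a w.fst h₁ h₂
            + ((α⁻¹ : ℝ) : ℂ) • comm Q.D a ⟨w.snd, mem_comm_domain.2 ⟨h₃, h₄⟩⟩) := by
  obtain ⟨h₁, h₂, h₃, h₄⟩ := h.of_mem_comm_DK hw
  exact ⟨h₁, h₂, h₃, h₄, h.comm_DK_apply h₁ h₂ h₃ h₄⟩

lemma isBdd_comm_DK (h : Q.IsDecomp t a k) (α β : ℝ) : IsBdd (comm (Q.DK α β) (Q.rep t)) := by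
  obtain ⟨c, hc, hu⟩ := h.exists_upper_bound
  have hb := Q.comm_bdd a h.mem
  refine ⟨|β| * c + (|β| * c + |α⁻¹| * opNorm (comm Q.D a)), fun ⟨w, hw⟩ => ?_⟩
  obtain ⟨h₁, h₂, h₃, h₄, e⟩ := h.exists_comm_DK_eq hw
  have nl := h.norm_lower_le hc hu h₁ h₂
  have nu := hu _ h₃ h₄
  have nz := hb.le_opNorm ⟨w.snd, mem_comm_domain.2 ⟨h₃, h₄⟩⟩
  have n₁ : ‖w.fst‖ ≤ ‖w‖ := WithLp.norm_fst_le _ w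
  have n₂ : ‖w.snd‖ ≤ ‖w‖ := WithLp.norm_snd_le _ w
  have hz0 := opNorm_nonneg (comm Q.D a)
  rw [e, add_mul, add_mul]
  refine (norm_toLp_le _ _).trans (add_le_add ?_ ((norm_add_le _ _).trans (add_le_add ?_ ?_)))
  · rw [norm_smul, Complex.norm_real, Real.norm_eq_abs, mul_assoc]
    exact mul_le_mul_of_nonneg_left (nu.trans (mul_le_mul_of_nonneg_left n₂ hc)) (abs_nonneg _)
  · rw [norm_smul, Complex.norm_real, Real.norm_eq_abs, mul_assoc]
    exact mul_le_mul_of_nonneg_left (nl.trans (mul_le_mul_of_nonneg_left n₁ hc)) (abs_nonneg _)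
  · rw [norm_smul, Complex.norm_real, Real.norm_eq_abs, mul_assoc]
    exact mul_le_mul_of_nonneg_left (nz.trans (mul_le_mul_of_nonneg_left n₂ hz0)) (abs_nonneg _)

section Bounds

variable {α β : ℝ}

/-- The column of the commutator over `(0, y)`. -/
lemma sq_norm_upper_comm_le (h : Q.IsDecomp t a k) {y : H} (hay : a y ∈ Q.D.domain)
    (hy : y ∈ Q.D.domain) :
    ‖(β : ℂ) • upper t a y hay hy‖ ^ 2
      + ‖((α⁻¹ : ℝ) : ℂ) • comm Q.D a ⟨y, mem_comm_domain.2 ⟨hay, hy⟩⟩‖ ^ 2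
      ≤ (Q.normComm α β t * ‖y‖) ^ 2 := by
  have h0 : (0 : Q.PH) ∈ Q.Dp.domain := Q.Dp.domain.zero_mem
  have ht0 : t 0 ∈ Q.Dp.domain := by rw [map_zero]; exact h0
  have e₀ : lower t a 0 ht0 h0 = 0 := by
    have e₁ : Q.Dp ⟨0, h0⟩ = 0 := Q.Dp.map_zero
    have e₂ : Q.Dp ⟨t 0, ht0⟩ = 0 :=
      (congrArg Q.Dp (Subtype.ext (map_zero t) : (⟨t 0, ht0⟩ : Q.Dp.domain) = ⟨0, h0⟩)).trans e₁
    rw [lower, e₁, e₂, map_zero, map_zero, sub_zero]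
  have hb := (h.isBdd_comm_DK α β).le_opNorm ⟨_, h.mem_comm_DK α β ht0 h0 hay hy⟩
  rw [h.comm_DK_apply ht0 h0 hay hy, e₀, smul_zero, zero_add] at hb
  have hb' : ‖(WithLp.toLp 2 ((β : ℂ) • upper t a y hay hy,
      ((α⁻¹ : ℝ) : ℂ) • comm Q.D a ⟨y, mem_comm_domain.2 ⟨hay, hy⟩⟩) : Q.K)‖
      ≤ Q.normComm α β t * ‖y‖ := by
    rw [← WithLp.norm_toLp_snd 2 Q.PH H y]; exact hb
  refine le_trans (le_of_eq ?_) (pow_le_pow_left₀ (norm_nonneg _) hb' 2)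
  rw [WithLp.prod_norm_sq_eq_of_L2]
  rfl

lemma norm_upper_le (h : Q.IsDecomp t a k) (hβ : 0 < β) (α : ℝ) {y : H} (hay : a y ∈ Q.D.domain)
    (hy : y ∈ Q.D.domain) : ‖upper t a y hay hy‖ ≤ Q.normComm α β t / β * ‖y‖ := by
  have := h.sq_norm_upper_comm_le (α := α) (β := β) hay hy
  rw [div_mul_eq_mul_div, le_div_iff₀ hβ]
  refine abs_le_of_sq_le_sq' ?_ (mul_nonneg (normComm_nonneg _ _ _) (norm_nonneg _)) |>.2
  refine le_trans ?_ ((le_add_of_nonneg_right (sq_nonneg _)).trans this)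
  rw [norm_smul, Complex.norm_real, Real.norm_of_nonneg hβ.le, mul_comm]

lemma norm_lower_le_normComm (h : Q.IsDecomp t a k) (hβ : 0 < β) (α : ℝ) {x : Q.PH}
    (htx : t x ∈ Q.Dp.domain) (hx : x ∈ Q.Dp.domain) :
    ‖lower t a x htx hx‖ ≤ Q.normComm α β t / β * ‖x‖ :=
  h.norm_lower_le (div_nonneg (normComm_nonneg _ _ _) hβ.le)
    (fun _ hay hy => h.norm_upper_le hβ α hay hy) htx hx

/-- `‖[D, a]‖ ≤ α L_{α,β}(T(a) + k)`. -/
lemma opNorm_comm_le (h : Q.IsDecomp t a k) (hα : 0 < α) (β : ℝ) :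
    opNorm (comm Q.D a) ≤ α * Q.normComm α β t := by
  refine opNorm_le (mul_nonneg hα.le (normComm_nonneg _ _ _)) fun ⟨y, hy⟩ => ?_
  obtain ⟨h₁, h₂⟩ := mem_comm_domain.1 hy
  have := h.sq_norm_upper_comm_le (α := α) (β := β) h₁ h₂
  rw [mul_assoc, ← inv_mul_le_iff₀ hα]
  refine abs_le_of_sq_le_sq' ?_ (mul_nonneg (normComm_nonneg _ _ _) (norm_nonneg _)) |>.2
  refine le_trans ?_ ((le_add_of_nonneg_left (sq_nonneg _)).trans this)
  rw [norm_smul, Complex.norm_real, Real.norm_of_nonneg (inv_nonneg.2 hα.le)]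

/-- `‖D_p k‖ ≤ L_{α,β}(T(a) + k) / β + ‖[D, a]‖`, because on `PH` the entry `P D a - t P D` is
`P [D, a] - k D_p`. -/
lemma normDp_le (h : Q.IsDecomp t a k) (hβ : 0 < β) (α : ℝ) :
    Q.normDp k ≤ Q.normComm α β t / β + opNorm (comm Q.D a) := by
  refine Q.normDp_le_of_dense h.memAc h.selfAdjoint'
    (add_nonneg (div_nonneg (normComm_nonneg _ _ _) hβ.le) (opNorm_nonneg _))
    (Q.dense_inter_PH h.mem h.mem) fun x hx => ?_
  obtain ⟨hx, -⟩ := hx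
  obtain ⟨hax, hx'⟩ := mem_comm_domain.1 hx
  refine ⟨hx', ?_⟩
  have n₁ := h.norm_upper_le hβ α hax hx'
  have n₂ := (Q.comm_bdd a h.mem).le_opNorm ⟨Q.incl x, hx⟩
  have e : k (Q.Dp ⟨x, hx'⟩) = Q.proj (comm Q.D a ⟨Q.incl x, hx⟩)
      - upper t a (Q.incl x) hax hx' := by
    have eT : Q.T a (Q.Dp ⟨x, hx'⟩) = Q.proj (a (Q.D ⟨Q.incl x, hx'⟩)) := by
      rw [← Q.incl_Dp (Q.mem_Dp_domain.2 hx')]; rfl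
    rw [comm_apply, upper, h.eq, ← Q.Dp_apply (Q.mem_Dp_domain.2 hx'), _root_.add_apply, eT,
      map_sub]
    abel
  rw [e, add_mul, add_comm]
  exact (norm_sub_le _ _).trans (add_le_add ((Q.norm_proj_le _).trans n₂) n₁)

/-- `L_{α,β}(k + r) ≤ β ‖D_p k‖`. -/
lemma normComm_le_of_scalar {r : ℝ} (h : Q.IsDecomp t (r • 1) k) (hβ : 0 < β) (α : ℝ) :
    Q.normComm α β t ≤ β * Q.normDp k := by
  have hc := Q.normDp_nonneg k
  refine opNorm_le (mul_nonneg hβ.le hc) fun ⟨w, hw⟩ => ?_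
  obtain ⟨h₁, h₂, h₃, h₄, e⟩ := h.exists_comm_DK_eq hw
  have hD : ∀ y (h₃ : (r • (1 : H →L[ℂ] H)) y ∈ Q.D.domain) (h₄ : y ∈ Q.D.domain),
      Q.D ⟨(r • (1 : H →L[ℂ] H)) y, h₃⟩ = (r : ℂ) • Q.D ⟨y, h₄⟩ := fun y h₃ h₄ =>
    Q.D.map_smul (r : ℂ) ⟨y, h₄⟩
  have eZ : comm Q.D (r • (1 : H →L[ℂ] H)) ⟨w.snd, mem_comm_domain.2 ⟨h₃, h₄⟩⟩ = 0 := by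
    rw [comm_apply, hD _ h₃ h₄]
    exact sub_self _
  have hT : ∀ z, t z = r • z + k z := fun z => by
    have : Q.T (r • 1) = r • 1 := by rw [T_smul, T_one]
    rw [h.eq, this]; rfl
  have hu : ∀ y (h₃ : (r • (1 : H →L[ℂ] H)) y ∈ Q.D.domain) (h₄ : y ∈ Q.D.domain),
      ‖upper t (r • 1) y h₃ h₄‖ ≤ Q.normDp k * ‖y‖ := fun y h₃ h₄ => by
    have n := Q.norm_mul_Dp_le h.memAc h.selfAdjoint'
      ⟨Q.proj y, Q.mem_Dp_domain.2 (Q.incl_proj_mem h₄)⟩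
    rw [Q.Dp_proj h₄] at n
    have e : upper t (r • 1) y h₃ h₄ = -k (Q.proj (Q.D ⟨y, h₄⟩)) := by
      rw [upper, hD _ h₃ h₄, hT, map_smul, Complex.coe_smul]
      abel
    rw [e, norm_neg]
    exact n.trans (mul_le_mul_of_nonneg_left (Q.norm_proj_le y) hc)
  have nu := hu _ h₃ h₄
  have nl := h.norm_lower_le hc hu h₁ h₂
  change ‖comm (Q.DK α β) (Q.rep t) ⟨w, hw⟩‖ ≤ β * Q.normDp k * ‖w‖
  rw [e, eZ, smul_zero, add_zero]
  refine abs_le_of_sq_le_sq' ?_ (by positivity) |>.2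
  rw [WithLp.prod_norm_sq_eq_of_L2, mul_pow _ ‖w‖, WithLp.prod_norm_sq_eq_of_L2 w, mul_add]
  have hβc : ∀ (z : ℝ) (c : ℝ), z ≤ Q.normDp k * c → 0 ≤ z →
      (β * z) ^ 2 ≤ (β * Q.normDp k) ^ 2 * c ^ 2 := fun z c hz hz0 => by
    rw [← mul_pow, mul_assoc]
    exact pow_le_pow_left₀ (mul_nonneg hβ.le hz0) (mul_le_mul_of_nonneg_left hz hβ.le) 2
  have ns : ‖(β : ℂ)‖ = β := by rw [Complex.norm_real, Real.norm_of_nonneg hβ.le]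
  change ‖(β : ℂ) • upper t (r • 1) w.snd h₃ h₄‖ ^ 2
    + ‖(β : ℂ) • lower t (r • 1) w.fst h₁ h₂‖ ^ 2 ≤ _
  rw [norm_smul, norm_smul, ns, add_comm]
  exact add_le_add (hβc _ _ nl (norm_nonneg _)) (hβc _ _ nu (norm_nonneg _))

/-- Dependence of `L_{α,β}` on the parameters: changing them changes the entries by multiples of
`upper`, `lower` and `[D, a]`, each of which is controlled by `L_{α',β'}`. -/
lemma normComm_le_mul (h : Q.IsDecomp t a k) {α' β' : ℝ} (hα : 0 < α) (hα' : 0 < α') (hβ' : 0 < β')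
    (β : ℝ) :
    Q.normComm α β t
      ≤ (1 + (2 * |β / β' - 1| + |α' / α - 1|)) * Q.normComm α' β' t := by
  set c := Q.normComm α' β' t with hcdef
  have hc : 0 ≤ c := normComm_nonneg _ _ _
  refine opNorm_le (mul_nonneg (by positivity) hc) fun ⟨w, hw⟩ => ?_
  obtain ⟨h₁, h₂, h₃, h₄, e⟩ := h.exists_comm_DK_eq hw
  have hw' : w ∈ (comm (Q.DK α' β') (Q.rep t)).domain := hw
  obtain ⟨_, _, _, _, e'⟩ := h.exists_comm_DK_eq hw'
  have n₁ : ‖w.fst‖ ≤ ‖w‖ := WithLp.norm_fst_le _ w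
  have n₂ : ‖w.snd‖ ≤ ‖w‖ := WithLp.norm_snd_le _ w
  have nu := h.norm_upper_le hβ' α' h₃ h₄
  have nl := h.norm_lower_le_normComm hβ' α' h₁ h₂
  have nz := ((Q.comm_bdd a h.mem).le_opNorm ⟨w.snd, mem_comm_domain.2 ⟨h₃, h₄⟩⟩).trans
    (mul_le_mul_of_nonneg_right (h.opNorm_comm_le hα' β') (norm_nonneg _))
  have nw : ‖comm (Q.DK α' β') (Q.rep t) ⟨w, hw'⟩‖ ≤ c * ‖w‖ :=
    (h.isBdd_comm_DK α' β').le_opNorm ⟨w, hw'⟩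
  set U := upper t a w.snd h₃ h₄
  set W := lower t a w.fst h₁ h₂
  set Z := comm Q.D a ⟨w.snd, mem_comm_domain.2 ⟨h₃, h₄⟩⟩
  have ediff : comm (Q.DK α β) (Q.rep t) ⟨w, hw⟩ = comm (Q.DK α' β') (Q.rep t) ⟨w, hw'⟩
      + WithLp.toLp 2 (((β - β' : ℝ) : ℂ) • U, ((β - β' : ℝ) : ℂ) • W
        + ((α⁻¹ - α'⁻¹ : ℝ) : ℂ) • Z) := by
    rw [e, e', ← WithLp.toLp_add, Prod.mk_add_mk]
    congr 2
    · push_cast; module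
    · push_cast; module
  have hd₁ : ∀ z m : ℝ, z ≤ c / β' * m → m ≤ ‖w‖ → |β - β'| * z ≤ |β / β' - 1| * (c * ‖w‖) := by
    intro z m hz hm
    have eβ : |β - β'| = |β / β' - 1| * β' := by
      rw [← abs_of_pos hβ', ← abs_mul, abs_of_pos hβ', sub_mul, div_mul_cancel₀ _ hβ'.ne', one_mul]
    rw [eβ, mul_assoc]
    refine mul_le_mul_of_nonneg_left ?_ (abs_nonneg _)
    calc β' * z ≤ β' * (c / β' * m) := mul_le_mul_of_nonneg_left hz hβ'.le
      _ = c * m := by field_simp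
      _ ≤ c * ‖w‖ := mul_le_mul_of_nonneg_left hm hc
  have hd₂ : |α⁻¹ - α'⁻¹| * ‖Z‖ ≤ |α' / α - 1| * (c * ‖w‖) := by
    have eα : |α⁻¹ - α'⁻¹| = |α' / α - 1| * α'⁻¹ := by
      rw [← abs_of_pos (inv_pos.2 hα'), ← abs_mul, abs_of_pos (inv_pos.2 hα')]
      congr 1
      field_simp
    rw [eα, mul_assoc]
    refine mul_le_mul_of_nonneg_left ?_ (abs_nonneg _)
    rw [inv_mul_le_iff₀ hα']
    exact nz.trans ((mul_le_mul_of_nonneg_left n₂ (mul_nonneg hα'.le hc)).trans_eq (by ring))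
  change ‖comm (Q.DK α β) (Q.rep t) ⟨w, hw⟩‖ ≤ _ * ‖w‖
  rw [ediff]
  refine (norm_add_le _ _).trans ((add_le_add nw ((norm_toLp_le _ _).trans
    (add_le_add le_rfl (norm_add_le _ _)))).trans ?_)
  rw [norm_smul, norm_smul, norm_smul, Complex.norm_real, Complex.norm_real, Real.norm_eq_abs,
    Real.norm_eq_abs]
  have k₁ := hd₁ _ _ nu n₂
  have k₂ := hd₁ _ _ nl n₁
  linarith

end Bounds

end IsDecomp
/-! ### Subadditivity of `L_{α,β}` -/

lemma isSymm_DK (Q : ToeplitzQuadruple H) (α β : ℝ) : IsSymm (Q.DK α β) := by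
  rintro ⟨w, hx, hy⟩ ⟨w', hx', hy'⟩
  have e₁ : inner ℂ (Q.proj (Q.D ⟨w.snd, hy⟩)) w'.fst
      = inner ℂ w.snd (Q.incl (Q.Dp ⟨w'.fst, Q.mem_Dp_domain.2 hx'⟩)) := by
    rw [inner_proj_left, Q.isSymm_D ⟨w.snd, hy⟩ ⟨Q.incl w'.fst, hx'⟩, Q.incl_Dp]
  have e₂ : inner ℂ (Q.incl (Q.Dp ⟨w.fst, Q.mem_Dp_domain.2 hx⟩)) w'.snd
      = inner ℂ w.fst (Q.proj (Q.D ⟨w'.snd, hy'⟩)) := by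
    rw [inner_proj_right, ← Q.isSymm_D ⟨Q.incl w.fst, hx⟩ ⟨w'.snd, hy'⟩, Q.incl_Dp]
  have e₃ := Q.isSymm_D ⟨w.snd, hy⟩ ⟨w'.snd, hy'⟩
  rw [WithLp.prod_inner_apply, WithLp.prod_inner_apply]
  change inner ℂ ((β : ℂ) • Q.proj (Q.D ⟨w.snd, hy⟩)) w'.fst
      + inner ℂ ((β : ℂ) • Q.incl (Q.Dp ⟨w.fst, Q.mem_Dp_domain.2 hx⟩)
        + ((α⁻¹ : ℝ) : ℂ) • Q.D ⟨w.snd, hy⟩) w'.snd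
    = inner ℂ w.fst ((β : ℂ) • Q.proj (Q.D ⟨w'.snd, hy'⟩))
      + inner ℂ w.snd ((β : ℂ) • Q.incl (Q.Dp ⟨w'.fst, Q.mem_Dp_domain.2 hx'⟩)
        + ((α⁻¹ : ℝ) : ℂ) • Q.D ⟨w'.snd, hy'⟩)
  simp only [inner_add_left, inner_add_right, inner_smul_left, inner_smul_right,
    Complex.conj_ofReal]
  rw [e₁, e₂, e₃]
  ring

namespace IsDecomp

lemma rep_apply (h : Q.IsDecomp t a k) (w : Q.K) :
    Q.rep t w = WithLp.toLp 2 (t w.fst, a w.snd) := by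
  rw [← h.rho_eq]; rfl

lemma isSelfAdjoint_rep (h : Q.IsDecomp t a k) : IsSelfAdjoint (Q.rep t) := by
  rw [ContinuousLinearMap.isSelfAdjoint_iff_isSymmetric]
  intro w w'
  change inner ℂ (Q.rep t w) w' = inner ℂ w (Q.rep t w')
  rw [h.rep_apply, h.rep_apply, WithLp.prod_inner_apply, WithLp.prod_inner_apply]
  exact congrArg₂ _ (inner_apply_left h.isSelfAdjoint _ _) (inner_apply_left h.selfAdjoint _ _)

end IsDecomp

/-- The commutator of a combination may have a larger domain than both summands; by skew symmetry
it suffices to bound it on their common domain, which is dense. -/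
lemma IsDecomp.normComm_linear_comb_le (h : Q.IsDecomp t a k) (h' : Q.IsDecomp s b l)
    (α β r q : ℝ) :
    Q.normComm α β (r • t + q • s) ≤ |r| * Q.normComm α β t + |q| * Q.normComm α β s := by
  have hrq := (h.smul r).add (h'.smul q)
  have hc : 0 ≤ |r| * Q.normComm α β t + |q| * Q.normComm α β s :=
    add_nonneg (mul_nonneg (abs_nonneg _) (normComm_nonneg _ _ _))
      (mul_nonneg (abs_nonneg _) (normComm_nonneg _ _ _))
  have hdense : Dense ((WithLp.prodContinuousLinearEquiv 2 ℂ Q.PH H).symm ''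
      ({x : Q.PH | Q.incl x ∈ (comm Q.D a).domain ∧ Q.incl x ∈ (comm Q.D b).domain} ×ˢ
        (((comm Q.D a).domain ⊓ (comm Q.D b).domain : Submodule ℂ H) : Set H))) :=
    ((WithLp.prodContinuousLinearEquiv 2 ℂ Q.PH H).symm.surjective.denseRange).dense_image
      (WithLp.prodContinuousLinearEquiv 2 ℂ Q.PH H).symm.continuous
      ((Q.dense_inter_PH h.mem h'.mem).prod (Q.dense_inter h.mem h'.mem))
  have hrep : Q.rep (r • t + q • s) = r • Q.rep t + q • Q.rep s := by
    ext w : 1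
    rw [hrq.rep_apply]
    change _ = r • Q.rep t w + q • Q.rep s w
    rw [h.rep_apply, h'.rep_apply]
    rfl
  refine opNorm_le hc (comm_bound_of_dense (Q.isSymm_DK α β) hrq.isSelfAdjoint_rep hdense hc ?_)
  rintro _ ⟨⟨x, y⟩, ⟨⟨hxa, hxb⟩, hya, hyb⟩, rfl⟩
  have hx : x ∈ Q.Dp.domain := Q.mem_Dp_domain.2 (mem_comm_domain.1 hxa).2
  have m₁ := h.mem_comm_DK α β (h.mem_Dp_domain (mem_comm_domain.1 hxa).1) hx
    (mem_comm_domain.1 hya).1 (mem_comm_domain.1 hya).2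
  have m₂ := h'.mem_comm_DK α β (h'.mem_Dp_domain (mem_comm_domain.1 hxb).1) hx
    (mem_comm_domain.1 hyb).1 (mem_comm_domain.1 hyb).2
  rw [hrep]
  obtain ⟨m, e⟩ := comm_linear_comb r q m₁ m₂
  refine ⟨m, ?_⟩
  have n₁ : ‖comm (Q.DK α β) (Q.rep t) ⟨_, m₁⟩‖ ≤ Q.normComm α β t * _ :=
    (h.isBdd_comm_DK α β).le_opNorm ⟨_, m₁⟩
  have n₂ : ‖comm (Q.DK α β) (Q.rep s) ⟨_, m₂⟩‖ ≤ Q.normComm α β s * _ :=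
    (h'.isBdd_comm_DK α β).le_opNorm ⟨_, m₂⟩
  refine (congrArg norm e).trans_le ((norm_add_le _ _).trans ?_)
  rw [norm_smul, norm_smul, Complex.norm_real, Complex.norm_real, Real.norm_eq_abs,
    Real.norm_eq_abs, add_mul, mul_assoc, mul_assoc]
  exact add_le_add (mul_le_mul_of_nonneg_left n₁ (abs_nonneg _))
    (mul_le_mul_of_nonneg_left n₂ (abs_nonneg _))

/-! ### The spaces `A` and `A_T` -/

/-- The inclusion of the self-adjoint part of `A` into the bounded operators on `H`. -/
def inclA (Q : ToeplitzQuadruple H) : Q.ouA →ₗ[ℝ] (H →L[ℂ] H) :=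
  ofOperatorsIncl _ _ _

lemma isUnitalEmbedding_inclA [Nontrivial H] (Q : ToeplitzQuadruple H) :
    IsUnitalEmbedding 1 Q.inclA :=
  isUnitalEmbedding_ofOperators

lemma isPrecompactLip_LA [Nontrivial H] (Q : ToeplitzQuadruple H) (h : IsLipNorm Q.LA) :
    IsPrecompactLip Q.LA :=
  haveI := Q.isUnitalEmbedding_inclA.nonempty_state (norm_one (α := H →L[ℂ] H))
  h.isPrecompactLip ofOperators_order_of_states

/-- The inclusion of `A_T` into the bounded operators on `PH`. -/
def inclT (Q : ToeplitzQuadruple H) : Q.ouT →ₗ[ℝ] (Q.PH →L[ℂ] Q.PH) :=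
  ofOperatorsIncl _ _ _

lemma isUnitalEmbedding_inclT [Nontrivial H] (Q : ToeplitzQuadruple H) :
    IsUnitalEmbedding 1 Q.inclT :=
  haveI := Q.nontrivial_PH
  isUnitalEmbedding_ofOperators

lemma LT_eq (Q : ToeplitzQuadruple H) (α β : ℝ) (t : Q.ouT) :
    Q.LT α β t = Q.normComm α β (Q.inclT t) := rfl

lemma isDecomp_smul_one (hk : Q.memAc k) (hk' : IsSelfAdjoint k) (r : ℝ) :
    Q.IsDecomp (k + r • 1) (r • 1) k :=
  ⟨by rw [← Complex.coe_smul]; exact Q.A.smul_mem (one_mem _) (r : ℂ), isSelfAdjoint_smul_one r,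
    hk, hk', by rw [T_smul, T_one, add_comm]⟩

/-- The scalar part of `A_C` is moved into `a`. -/
lemma exists_isDecomp (Q : ToeplitzQuadruple H) (t : Q.ouT) :
    ∃ a k, Q.IsDecomp (Q.inclT t) a k := by
  obtain ⟨a, ⟨ha, ha'⟩, _, ⟨k, ⟨hk, hk'⟩, r, rfl⟩, h⟩ := t.2
  refine ⟨a + r • 1, k, add_mem ha ?_, ha'.add (isSelfAdjoint_smul_one r), hk, hk', ?_⟩
  · rw [← Complex.coe_smul]; exact Q.A.smul_mem (one_mem _) (r : ℂ)
  · rw [T_add, T_smul, T_one]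
    refine Eq.trans h ?_
    abel

lemma IsDecomp.exists_inclT_eq (h : Q.IsDecomp t a k) : ∃ x : Q.ouT, Q.inclT x = t :=
  ⟨⟨t, a, ⟨h.mem, h.selfAdjoint⟩, k, ⟨k, ⟨h.memAc, h.selfAdjoint'⟩, 0, by simp⟩, h.eq⟩, rfl⟩

lemma exists_inclC_eq (hk : Q.memAc k) (hk' : IsSelfAdjoint k) (r : ℝ) :
    ∃ x : Q.ouC, Q.inclC x = k + r • 1 :=
  ⟨⟨k + r • 1, k, ⟨hk, hk'⟩, r, rfl⟩, rfl⟩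

section Radius

variable {R G : ℝ} {α β : ℝ}

/-- An element `T(a) + k` of `A_T` is close to the element `k + r` of `A_C`, where `r` is a scalar
close to `a`. -/
lemma IsDecomp.exists_scalar (h : Q.IsDecomp t a k)
    (hR : 0 ≤ R ∧ ∀ a : Q.ouA, ∃ r : ℝ, ‖Q.inclA a - r • 1‖ ≤ R * Q.LA a)
    (hG : 0 ≤ G ∧ ∀ x : Q.Dp.domain, ‖(x : Q.PH)‖ ≤ G * ‖Q.Dp x‖) (hα : 0 < α) (hβ : 0 < β) :
    ∃ r : ℝ, β * Q.normDp k ≤ (1 + α * β) * Q.normComm α β t ∧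
      ‖t - (k + r • 1)‖ ≤ R * α * Q.normComm α β t ∧
      ‖t - r • 1‖ ≤ (R * α + G * (β⁻¹ + α)) * Q.normComm α β t := by
  set c := Q.normComm α β t with hc
  have hc0 : 0 ≤ c := normComm_nonneg _ _ _
  obtain ⟨r, hr⟩ := hR.2 ⟨a, h.mem, h.selfAdjoint⟩
  have hr' : ‖a - r • 1‖ ≤ R * opNorm (comm Q.D a) := hr
  have nA := h.opNorm_comm_le hα β
  have nk : Q.normDp k ≤ (β⁻¹ + α) * c := by
    have := h.normDp_le hβ α
    rw [add_mul, inv_mul_eq_div]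
    exact this.trans (add_le_add le_rfl nA)
  have e : t - (k + r • 1) = Q.T (a - r • 1) := by
    rw [T_sub, T_smul, T_one, h.eq]; abel
  have n₁ : ‖t - (k + r • 1)‖ ≤ R * α * c := by
    rw [e, mul_assoc]
    exact (Q.norm_T_le _).trans (hr'.trans (mul_le_mul_of_nonneg_left nA hR.1))
  refine ⟨r, ?_, n₁, ?_⟩
  · calc β * Q.normDp k ≤ β * ((β⁻¹ + α) * c) := mul_le_mul_of_nonneg_left nk hβ.le
      _ = (1 + α * β) * c := by field_simp
  · have e' : t - r • 1 = (t - (k + r • 1)) + k := by abel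
    have n₂ : ‖k‖ ≤ G * (β⁻¹ + α) * c := (Q.norm_le_normDp hG.1 hG.2 h.memAc).trans
      ((mul_le_mul_of_nonneg_left nk hG.1).trans_eq (mul_assoc _ _ _).symm)
    rw [e', add_mul]
    exact (norm_add_le _ _).trans (add_le_add n₁ n₂)

/-- `A_T` has radius at most `R α + G (1/β + α)`. -/
lemma exists_scalar_LT (Q : ToeplitzQuadruple H)
    (hR : 0 ≤ R ∧ ∀ a : Q.ouA, ∃ r : ℝ, ‖Q.inclA a - r • 1‖ ≤ R * Q.LA a)
    (hG : 0 ≤ G ∧ ∀ x : Q.Dp.domain, ‖(x : Q.PH)‖ ≤ G * ‖Q.Dp x‖) (hα : 0 < α) (hβ : 0 < β)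
    (x : Q.ouT) :
    ∃ r : ℝ, ‖Q.inclT x - r • 1‖ ≤ (R * α + G * (β⁻¹ + α)) * Q.LT α β x := by
  obtain ⟨a, k, h⟩ := Q.exists_isDecomp x
  obtain ⟨r, -, -, hr⟩ := h.exists_scalar hR hG hα hβ
  exact ⟨r, hr⟩

end Radius

/-- `L_{α,β}` is a Lip-norm with precompact ball. -/
theorem isPrecompactLip_LT [Nontrivial H] (Q : ToeplitzQuadruple H) (hLA : IsPrecompactLip Q.LA)
    {α β : ℝ} (hα : 0 < α) (hβ : 0 < β) : IsPrecompactLip (Q.LT α β) := by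
  refine Q.isUnitalEmbedding_inclT.isPrecompactLip ?_ ?_ ?_ ?_
  · intro x y
    obtain ⟨a, k, hx⟩ := Q.exists_isDecomp x
    obtain ⟨b, l, hy⟩ := Q.exists_isDecomp y
    have := hx.normComm_linear_comb_le hy α β 1 1
    rwa [one_smul, one_smul, abs_one, one_mul, one_mul, ← map_add] at this
  · refine smul_eq_of_smul_le (M := Q.ouT) (L := Q.LT α β) (fun x => normComm_nonneg _ _ _)
      fun r x => ?_
    obtain ⟨a, k, hx⟩ := Q.exists_isDecomp x
    have := hx.normComm_linear_comb_le hx α β r 0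
    rwa [zero_smul, add_zero, abs_zero, zero_mul, add_zero, ← map_smul] at this
  · intro x
    rw [LT_eq]
    constructor
    · intro h
      obtain ⟨a, k, hx⟩ := Q.exists_isDecomp x
      obtain ⟨R, hR⟩ := Q.isUnitalEmbedding_inclA.exists_radius hLA
      obtain ⟨r, -, -, hr⟩ := hx.exists_scalar hR Q.exists_Dp_bound.choose_spec hα hβ
      rw [h, mul_zero] at hr
      refine ⟨r, Q.isUnitalEmbedding_inclT.injective ?_⟩
      rw [map_smul, Q.isUnitalEmbedding_inclT.map_unit]
      exact sub_eq_zero.1 (norm_le_zero_iff.1 hr)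
    · rintro ⟨r, rfl⟩
      have hd := isDecomp_smul_one Q.memAc_zero (IsSelfAdjoint.zero _) r
      rw [zero_add] at hd
      rw [map_smul, Q.isUnitalEmbedding_inclT.map_unit]
      refine le_antisymm ?_ (normComm_nonneg _ _ _)
      have := hd.normComm_le_of_scalar hβ α
      rwa [normDp_zero, mul_zero] at this
  · intro ε hε
    obtain ⟨F, hF, hn⟩ := Q.isUnitalEmbedding_inclA.exists_net hLA
      (ε := ε / (2 * α)) (by positivity)
    obtain ⟨F', hF', hFm, hn'⟩ := Q.exists_net_Ac (β⁻¹ + α) (half_pos hε)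
    -- `T(a) + k` in the unit ball has `α⁻¹ a` in the unit ball of `L_A` and `‖D_p k‖ ≤ β⁻¹ + α`
    refine ⟨Q.inclT ⁻¹' (Set.image2 (fun f l => Q.T (α • Q.inclA f) + l) F F'),
      (hF.image2 _ hF').preimage Q.isUnitalEmbedding_inclT.injective.injOn, fun x hx => ?_⟩
    obtain ⟨a, k, h⟩ := Q.exists_isDecomp x
    have nA := (h.opNorm_comm_le hα β).trans (mul_le_of_le_one_right hα.le hx)
    have nk : Q.normDp k ≤ β⁻¹ + α := by
      refine (h.normDp_le hβ α).trans (add_le_add ?_ nA)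
      rw [← one_div]
      exact div_le_div_of_nonneg_right hx hβ.le
    let a' : Q.ouA := ⟨a, h.mem, h.selfAdjoint⟩
    obtain ⟨f, hf, r, hr⟩ := hn (α⁻¹ • a') (by
      rw [hLA.smul, abs_of_pos (inv_pos.2 hα), inv_mul_le_one₀ hα]
      exact nA)
    obtain ⟨l, hl, hkl⟩ := hn' k h.memAc h.selfAdjoint' nk
    have hf' : Q.IsDecomp (Q.T (α • Q.inclA f) + l) (α • Q.inclA f) l :=
      ⟨(α • f).2.1, (α • f).2.2, (hFm l hl).1, (hFm l hl).2, rfl⟩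
    obtain ⟨y, hy⟩ := hf'.exists_inclT_eq
    refine ⟨y, ?_, α * r, ?_⟩
    · rw [Set.mem_preimage, hy]
      exact ⟨f, hf, l, hl, rfl⟩
    · have e : Q.inclT x - Q.inclT y - (α * r) • 1
          = Q.T (α • (α⁻¹ • a - Q.inclA f - r • 1)) + (k - l) := by
        rw [hy, h.eq, smul_sub, smul_sub, smul_inv_smul₀ hα.ne', smul_smul, T_sub, T_sub,
          Q.T_smul (α * r), T_one]
        abel
      rw [e]
      refine (norm_add_le _ _).trans ((add_le_add ((Q.norm_T_le _).trans ?_) hkl.le).trans_eq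
        (add_halves ε))
      rw [norm_smul, Real.norm_eq_abs, abs_of_pos hα]
      calc α * ‖α⁻¹ • a - Q.inclA f - r • 1‖ ≤ α * (ε / (2 * α)) :=
            mul_le_mul_of_nonneg_left hr hα.le
        _ = ε / 2 := by field_simp

end ToeplitzQuadruple

open Filter Topology

/-- Continuity is tested with `edist`, so that no topology on the target has to be named; the
parameter space also carries the subspace topology of the product. -/
lemma isCompact_range_of_tendsto_edist {K P : Type*} [TopologicalSpace K] [CompactSpace K]
    [PseudoEMetricSpace P] {f : K → P}
    (hf : ∀ q, Tendsto (fun x => edist (f x) (f q)) (𝓝 q) (𝓝 0)) : IsCompact (Set.range f) :=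
  isCompact_range (continuous_iff_continuousAt.2 fun q => tendsto_iff_edist_tendsto_0.2 (hf q))

namespace ToeplitzQuadruple

variable (Q : ToeplitzQuadruple H)

/-! ### The members of the family -/

lemma fam_zero_top : Q.fam (0, ⊤) = ⟨OrderUnitSpace.real, fun _ => 0⟩ := rfl

lemma fam_zero (β : ℝ) : Q.fam (0, (β : WithTop ℝ)) = ⟨Q.ouC, fun x => β * Q.LC x⟩ :=
  if_pos rfl

lemma fam_of_pos {α : ℝ} (hα : 0 < α) (β : ℝ) :
    Q.fam (α, (β : WithTop ℝ)) = ⟨Q.ouT, Q.LT α β⟩ :=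
  if_neg hα.ne'

variable [Nontrivial H]

/-- All members of the family sit inside the bounded operators on `PH`. -/
lemma exists_isUnitalEmbedding_fam (hLA : IsPrecompactLip Q.LA) {p : ℝ × WithTop ℝ}
    (hp : p ∈ params) :
    ∃ ι : (Q.fam p).A →ₗ[ℝ] (Q.PH →L[ℂ] Q.PH), IsUnitalEmbedding 1 ι ∧
      IsPrecompactLip (Q.fam p).L := by
  have := Q.nontrivial_PH
  rcases hp with ⟨α, β, rfl, hα, hβ, -⟩ | rfl
  · rcases hα.eq_or_lt with rfl | hα
    · rw [fam_zero]
      exact ⟨Q.inclC, Q.isUnitalEmbedding_inclC, Q.isPrecompactLip_LC hβ⟩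
    · rw [Q.fam_of_pos hα]
      exact ⟨Q.inclT, Q.isUnitalEmbedding_inclT, Q.isPrecompactLip_LT hLA hα hβ⟩
  · exact ⟨realIncl Q.PH, isUnitalEmbedding_real, isPrecompactLip_real⟩

lemma isLipNorm_fam (hLA : IsPrecompactLip Q.LA) {p : ℝ × WithTop ℝ} (hp : p ∈ params) :
    IsLipNorm (Q.fam p).L := by
  obtain ⟨ι, -, h⟩ := Q.exists_isUnitalEmbedding_fam hLA hp
  exact h.isLipNorm

lemma distQ_fam_self (hLA : IsPrecompactLip Q.LA) {p : ℝ × WithTop ℝ} (hp : p ∈ params) :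
    distQ (Q.fam p) (Q.fam p) = 0 := by
  have := Q.nontrivial_PH
  obtain ⟨ι, hι, h⟩ := Q.exists_isUnitalEmbedding_fam hLA hp
  exact distQ_self norm_one hι h

lemma distQ_fam_comm (hLA : IsPrecompactLip Q.LA) {p q : ℝ × WithTop ℝ} (hp : p ∈ params)
    (hq : q ∈ params) : distQ (Q.fam p) (Q.fam q) = distQ (Q.fam q) (Q.fam p) := by
  have := Q.nontrivial_PH
  obtain ⟨ι, hι, h⟩ := Q.exists_isUnitalEmbedding_fam hLA hp
  obtain ⟨κ, hκ, h'⟩ := Q.exists_isUnitalEmbedding_fam hLA hq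
  exact distQ_comm norm_one hι hκ h h'

lemma distQ_fam_triangle (hLA : IsPrecompactLip Q.LA) {p q r : ℝ × WithTop ℝ} (hp : p ∈ params)
    (hq : q ∈ params) (hr : r ∈ params) :
    distQ (Q.fam p) (Q.fam r) ≤ distQ (Q.fam p) (Q.fam q) + distQ (Q.fam q) (Q.fam r) := by
  have := Q.nontrivial_PH
  obtain ⟨ι, hι, h⟩ := Q.exists_isUnitalEmbedding_fam hLA hp
  obtain ⟨κ, hκ, h'⟩ := Q.exists_isUnitalEmbedding_fam hLA hr
  have := hι.nonempty_state norm_one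
  rw [Q.distQ_fam_comm hLA hp hq]
  exact distQ_triangle h h'

lemma distQ_fam_ne_top (hLA : IsPrecompactLip Q.LA) {p q : ℝ × WithTop ℝ} (hp : p ∈ params)
    (hq : q ∈ params) : distQ (Q.fam p) (Q.fam q) ≠ ⊤ := by
  have := Q.nontrivial_PH
  obtain ⟨ι, hι, h⟩ := Q.exists_isUnitalEmbedding_fam hLA hp
  obtain ⟨κ, hκ, h'⟩ := Q.exists_isUnitalEmbedding_fam hLA hq
  exact distQ_ne_top norm_one hι hκ h h'

/-- The pseudometric on the parameter space; its `edist` is `distQ` by definition. -/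
@[reducible] def paramsPseudoMetric (hLA : IsPrecompactLip Q.LA) :
    PseudoMetricSpace (params : Set (ℝ × WithTop ℝ)) :=
  letI : PseudoEMetricSpace (params : Set (ℝ × WithTop ℝ)) :=
    { edist := fun p q => distQ (Q.fam p) (Q.fam q)
      edist_self := fun p => Q.distQ_fam_self hLA p.2
      edist_comm := fun p q => Q.distQ_fam_comm hLA p.2 q.2
      edist_triangle := fun p q r => Q.distQ_fam_triangle hLA p.2 q.2 r.2 }
  PseudoEMetricSpace.toPseudoMetricSpace fun p q => Q.distQ_fam_ne_top hLA p.2 q.2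

/-! ### Distance estimates -/

variable {R G : ℝ}

/-- `A_C` with the seminorm `β L_C` has radius at most `G / β`. -/
lemma exists_scalar_LC (hG : 0 ≤ G ∧ ∀ x : Q.Dp.domain, ‖(x : Q.PH)‖ ≤ G * ‖Q.Dp x‖) {β : ℝ}
    (hβ : 0 < β) (x : Q.ouC) :
    ∃ r : ℝ, ‖Q.inclC x - r • 1‖ ≤ G * β⁻¹ * (β * Q.LC x) := by
  obtain ⟨k, ⟨hk, -⟩, r, hx⟩ := Q.exists_decomp_C x
  refine ⟨r, ?_⟩
  rw [hx, add_sub_cancel_right, Q.LC_eq x hk hx, mul_assoc, inv_mul_cancel_left₀ hβ.ne']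
  exact Q.norm_le_normDp hG.1 hG.2 hk

/-- For `α, α' > 0` the seminorms are on the same space and differ by a factor near one. -/
lemma distQ_LT_LT_le (hLA : IsPrecompactLip Q.LA)
    (hR : 0 ≤ R ∧ ∀ a : Q.ouA, ∃ r : ℝ, ‖Q.inclA a - r • 1‖ ≤ R * Q.LA a)
    (hG : 0 ≤ G ∧ ∀ x : Q.Dp.domain, ‖(x : Q.PH)‖ ≤ G * ‖Q.Dp x‖) {α β α' β' : ℝ} (hα : 0 < α)
    (hβ : 0 < β) (hα' : 0 < α') (hβ' : 0 < β') :
    distQ ⟨Q.ouT, Q.LT α β⟩ ⟨Q.ouT, Q.LT α' β'⟩ ≤ ENNReal.ofReal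
      ((2 * |β / β' - 1| + |α' / α - 1| + (2 * |β' / β - 1| + |α / α' - 1|)) *
        (R * α + G * (β⁻¹ + α) + (R * α' + G * (β'⁻¹ + α')))) := by
  have := Q.nontrivial_PH
  have hR0 := hR.1
  have hG0 := hG.1
  have h₁ := Q.isPrecompactLip_LT hLA hα hβ
  have h₂ := Q.isPrecompactLip_LT hLA hα' hβ'
  set δ := 2 * |β / β' - 1| + |α' / α - 1|
  set δ' := 2 * |β' / β - 1| + |α / α' - 1|
  have hδ : 0 ≤ δ := by positivity
  have hδ' : 0 ≤ δ' := by positivity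
  refine distQ_le_of_approx_mul (X := ⟨Q.ouT, Q.LT α β⟩) (Y := ⟨Q.ouT, Q.LT α' β'⟩)
    (c := 1 + (δ + δ')) (η := 0) norm_one Q.isUnitalEmbedding_inclT
    Q.isUnitalEmbedding_inclT h₁ h₂ (by linarith) (by positivity)
    (by rw [zero_add, add_sub_cancel_left]) (fun x => ?_) fun x => ?_
  · obtain ⟨r, hr⟩ := Q.exists_scalar_LT hR hG hα hβ x
    obtain ⟨a, k, h⟩ := Q.exists_isDecomp x
    refine ⟨x, r, (h.normComm_le_mul hα' hα hβ β').trans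
      (mul_le_mul_of_nonneg_right ?_ (h₁.nonneg x)), by simp,
      hr.trans (mul_le_mul_of_nonneg_right ?_ (h₁.nonneg x))⟩
    · linarith
    · have : 0 ≤ R * α' + G * (β'⁻¹ + α') := by positivity
      linarith
  · obtain ⟨r, hr⟩ := Q.exists_scalar_LT hR hG hα' hβ' x
    obtain ⟨a, k, h⟩ := Q.exists_isDecomp x
    refine ⟨x, r, (h.normComm_le_mul hα hα' hβ' β).trans
      (mul_le_mul_of_nonneg_right ?_ (h₂.nonneg x)), by simp,
      hr.trans (mul_le_mul_of_nonneg_right ?_ (h₂.nonneg x))⟩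
    · linarith
    · have : 0 ≤ R * α + G * (β⁻¹ + α) := by positivity
      linarith

/-- As `α → 0`, the part `T(a)` of an element of the unit ball of `L_{α,β}` becomes scalar, and
`A_T` collapses to `A_C`. -/
lemma distQ_LT_LC_le (hLA : IsPrecompactLip Q.LA)
    (hR : 0 ≤ R ∧ ∀ a : Q.ouA, ∃ r : ℝ, ‖Q.inclA a - r • 1‖ ≤ R * Q.LA a)
    (hG : 0 ≤ G ∧ ∀ x : Q.Dp.domain, ‖(x : Q.PH)‖ ≤ G * ‖Q.Dp x‖) {α β : ℝ} (hα : 0 < α)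
    (hβ : 0 < β) :
    distQ ⟨Q.ouT, Q.LT α β⟩ ⟨Q.ouC, fun x => β * Q.LC x⟩ ≤ ENNReal.ofReal
      (R * α + α * β * (R * α + G * (β⁻¹ + α))) := by
  have := Q.nontrivial_PH
  have hR0 := hR.1
  have hG0 := hG.1
  have h₁ := Q.isPrecompactLip_LT hLA hα hβ
  have h₂ := Q.isPrecompactLip_LC hβ
  have hαβ : 0 ≤ α * β := by positivity
  refine distQ_le_of_approx_mul (X := ⟨Q.ouT, Q.LT α β⟩) (Y := ⟨Q.ouC, fun x => β * Q.LC x⟩)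
    (c := 1 + α * β) (η := R * α) (R := R * α + G * (β⁻¹ + α)) norm_one Q.isUnitalEmbedding_inclT
    Q.isUnitalEmbedding_inclC h₁ h₂ (by linarith) (by positivity)
    (by rw [add_sub_cancel_left]) (fun x => ?_) fun y => ?_
  · obtain ⟨a, k, h⟩ := Q.exists_isDecomp x
    obtain ⟨r, hr₁, hr₂, hr₃⟩ := h.exists_scalar hR hG hα hβ
    obtain ⟨y, hy⟩ := exists_inclC_eq h.memAc h.selfAdjoint' r
    refine ⟨y, r, ?_, ?_, hr₃⟩
    · change β * Q.LC y ≤ _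
      rw [Q.LC_eq y h.memAc hy]
      exact hr₁
    · rw [hy]
      exact hr₂
  · obtain ⟨k, ⟨hk, hk'⟩, r, hy⟩ := Q.exists_decomp_C y
    have h := isDecomp_smul_one hk hk' r
    obtain ⟨x, hx⟩ := h.exists_inclT_eq
    have hn := h₂.nonneg y
    refine ⟨x, r, ?_, ?_, ?_⟩
    · refine le_trans ?_ (le_mul_of_one_le_left hn (by linarith))
      change Q.LT α β x ≤ β * Q.LC y
      rw [LT_eq, hx, Q.LC_eq y hk hy]
      exact h.normComm_le_of_scalar hβ α
    · rw [hx, hy, sub_self, norm_zero]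
      positivity
    · have e : Q.inclC y - r • 1 = k := by rw [hy, add_sub_cancel_right]
      rw [e]
      have hk₁ := Q.norm_le_normDp hG.1 hG.2 hk
      rw [← Q.LC_eq y hk hy] at hk₁
      calc ‖k‖ ≤ G * Q.LC y := hk₁
        _ = G * β⁻¹ * (β * Q.LC y) := by field_simp
        _ ≤ _ := mul_le_mul_of_nonneg_right (by
            have : 0 ≤ R * α + G * α := by positivity
            linarith) hn

lemma distQ_LC_LC_le (hG : 0 ≤ G ∧ ∀ x : Q.Dp.domain, ‖(x : Q.PH)‖ ≤ G * ‖Q.Dp x‖)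
    {β β' : ℝ} (hβ : 0 < β) (hβ' : 0 < β') :
    distQ ⟨Q.ouC, fun x => β * Q.LC x⟩ ⟨Q.ouC, fun x => β' * Q.LC x⟩ ≤ ENNReal.ofReal
      ((|β' / β - 1| + |β / β' - 1|) * (G * β⁻¹ + G * β'⁻¹)) := by
  have := Q.nontrivial_PH
  have hG0 := hG.1
  have h₁ := Q.isPrecompactLip_LC hβ
  have h₂ := Q.isPrecompactLip_LC hβ'
  have key : ∀ {b b' e : ℝ}, 0 < b → |b' / b - 1| ≤ e → ∀ x,
      b' * Q.LC x ≤ (1 + e) * (b * Q.LC x) := fun {b b' e} hb he x => by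
    rw [← mul_assoc]
    refine mul_le_mul_of_nonneg_right ?_ (Q.LC_nonneg x)
    rw [← div_le_iff₀ hb]
    linarith [le_abs_self (b' / b - 1)]
  refine distQ_le_of_approx_mul (X := ⟨Q.ouC, fun x => β * Q.LC x⟩)
    (Y := ⟨Q.ouC, fun x => β' * Q.LC x⟩)
    (c := 1 + (|β' / β - 1| + |β / β' - 1|)) (η := 0) norm_one Q.isUnitalEmbedding_inclC
    Q.isUnitalEmbedding_inclC h₁ h₂ (by linarith [abs_nonneg (β' / β - 1), abs_nonneg (β / β' - 1)])
    (by positivity) (by rw [zero_add, add_sub_cancel_left]) (fun x => ?_) fun x => ?_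
  · obtain ⟨r, hr⟩ := Q.exists_scalar_LC hG hβ x
    refine ⟨x, r, key hβ (le_add_of_nonneg_right (abs_nonneg _)) x, by simp,
      hr.trans (mul_le_mul_of_nonneg_right (le_add_of_nonneg_right (by positivity)) (h₁.nonneg x))⟩
  · obtain ⟨r, hr⟩ := Q.exists_scalar_LC hG hβ' x
    refine ⟨x, r, key hβ' (le_add_of_nonneg_left (abs_nonneg _)) x, by simp,
      hr.trans (mul_le_mul_of_nonneg_right (le_add_of_nonneg_left (by positivity)) (h₂.nonneg x))⟩

/-- A space is within its radius of the one-point space. -/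
lemma distQ_real_le {E : Type u} [NormedAddCommGroup E] [InnerProductSpace ℂ E] [Nontrivial E]
    {X : OrderUnitPair.{u}} {ι : X.A →ₗ[ℝ] (E →L[ℂ] E)} (hι : IsUnitalEmbedding 1 ι)
    (hX : IsPrecompactLip X.L) {ρ : ℝ} (hρ : 0 ≤ ρ)
    (h : ∀ x, ∃ t : ℝ, ‖ι x - t • 1‖ ≤ ρ * X.L x) :
    distQ X ⟨OrderUnitSpace.real, fun _ => 0⟩ ≤ ENNReal.ofReal ρ := by
  refine distQ_le_of_approx_mul (Y := ⟨OrderUnitSpace.real, fun _ => 0⟩) (c := 1) (η := ρ)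
    (R := ρ) norm_one hι (isUnitalEmbedding_real (E := E)) hX isPrecompactLip_real le_rfl hρ
    (by simp) (fun x => ?_) fun y => ?_
  · obtain ⟨t, ht⟩ := h x
    refine ⟨⟨t⟩, t, ?_, ht, ht⟩
    rw [one_mul]
    exact hX.nonneg x
  · refine ⟨y.down • X.A.unit, y.down, ?_, ?_, ?_⟩
    · rw [hX.map_smul_unit, mul_zero]
    · rw [map_smul, hι.map_unit, mul_zero]
      exact (norm_le_zero_iff.2 (sub_self _))
    · rw [mul_zero]
      exact (norm_le_zero_iff.2 (sub_self _))

/-! ### Continuity and compactness -/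

/-- The coordinates `(α, s) = (α, 1/β)` on the parameter space, with `s = 0` for `β = ∞`. -/
def paramOf (q : ℝ × ℝ) : ℝ × WithTop ℝ :=
  if q.2 = 0 then (0, ⊤) else (q.1, ((q.2⁻¹ : ℝ) : WithTop ℝ))

lemma paramOf_zero {q : ℝ × ℝ} (h : q.2 = 0) : paramOf q = (0, ⊤) := if_pos h

lemma paramOf_of_pos {q : ℝ × ℝ} (h : 0 < q.2) :
    paramOf q = (q.1, ((q.2⁻¹ : ℝ) : WithTop ℝ)) := if_neg h.ne'

/-- In the coordinates `(α, s)`, the condition `α β ≤ 1` is `α ≤ s` and the condition `β ≥ β₀` is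
`s ≤ 1/β₀`: these parameters form a triangle. -/
def triangle (c : ℝ) : Set (ℝ × ℝ) := {q | 0 ≤ q.1 ∧ q.1 ≤ q.2 ∧ q.2 ≤ c}

lemma isCompact_triangle (c : ℝ) : IsCompact (triangle c) := by
  refine (isCompact_Icc (a := ((0, 0) : ℝ × ℝ)) (b := (c, c))).of_isClosed_subset ?_ ?_
  · exact (isClosed_le continuous_const continuous_fst).inter
      ((isClosed_le continuous_fst continuous_snd).inter
        (isClosed_le continuous_snd continuous_const))
  · rintro ⟨α, s⟩ ⟨h₁, h₂, h₃⟩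
    exact ⟨⟨h₁, h₁.trans h₂⟩, ⟨h₂.trans h₃, h₃⟩⟩

lemma paramOf_mem {c : ℝ} {q : ℝ × ℝ} (hq : q ∈ triangle c) : paramOf q ∈ params := by
  obtain ⟨h₁, h₂, -⟩ := hq
  rcases (h₁.trans h₂).eq_or_lt with h | h
  · exact Or.inr (paramOf_zero h.symm)
  · refine Or.inl ⟨q.1, q.2⁻¹, paramOf_of_pos h, h₁, inv_pos.2 h, ?_⟩
    rwa [← div_eq_mul_inv, div_le_one h]

lemma exists_paramOf_eq {β₀ : ℝ} (hβ₀ : 0 < β₀) {p : ℝ × WithTop ℝ} (hp : p ∈ params)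
    (h : (β₀ : WithTop ℝ) ≤ p.2) : ∃ q ∈ triangle β₀⁻¹, paramOf q = p := by
  rcases hp with ⟨α, β, rfl, hα, hβ, hαβ⟩ | rfl
  · refine ⟨(α, β⁻¹), ⟨hα, ?_, inv_anti₀ hβ₀ (WithTop.coe_le_coe.1 h)⟩, ?_⟩
    · rwa [← one_div, le_div_iff₀ hβ]
    · rw [paramOf_of_pos (inv_pos.2 hβ), inv_inv]
  · exact ⟨(0, 0), ⟨le_rfl, le_rfl, (inv_pos.2 hβ₀).le⟩, paramOf_zero rfl⟩

lemma le_paramOf {β₀ : ℝ} (hβ₀ : 0 < β₀) {q : ℝ × ℝ} (hq : q ∈ triangle β₀⁻¹) :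
    (β₀ : WithTop ℝ) ≤ (paramOf q).2 := by
  obtain ⟨h₁, h₂, h₃⟩ := hq
  rcases (h₁.trans h₂).eq_or_lt with h | h
  · rw [paramOf_zero h.symm]; exact le_top
  · rw [paramOf_of_pos h]
    exact WithTop.coe_le_coe.2 ((le_inv_comm₀ hβ₀ h).2 h₃)

/-- The family is `distQ`-continuous in the coordinates `(α, 1/β)`. -/
theorem tendsto_distQ_fam (hLA : IsPrecompactLip Q.LA) (c : ℝ) {q₀ : ℝ × ℝ}
    (hq₀ : q₀ ∈ triangle c) :
    Tendsto (fun q => distQ (Q.fam (paramOf q)) (Q.fam (paramOf q₀))) (𝓝[triangle c] q₀)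
      (𝓝 0) := by
  have := Q.nontrivial_PH
  obtain ⟨R, hR⟩ := Q.isUnitalEmbedding_inclA.exists_radius hLA
  obtain ⟨G, hG⟩ := Q.exists_Dp_bound
  have squeeze : ∀ g : ℝ × ℝ → ℝ, ContinuousAt g q₀ → g q₀ = 0 →
      (∀ᶠ q in 𝓝[triangle c] q₀,
        distQ (Q.fam (paramOf q)) (Q.fam (paramOf q₀)) ≤ ENNReal.ofReal (g q)) →
      Tendsto (fun q => distQ (Q.fam (paramOf q)) (Q.fam (paramOf q₀))) (𝓝[triangle c] q₀)
        (𝓝 0) := fun g hg h0 hle => by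
    have := (ENNReal.continuous_ofReal.tendsto _).comp (hg.tendsto.mono_left
      (nhdsWithin_le_nhds (s := triangle c)))
    rw [h0, ENNReal.ofReal_zero] at this
    exact tendsto_of_tendsto_of_tendsto_of_le_of_le' tendsto_const_nhds this
      (Eventually.of_forall fun _ => zero_le) hle
  obtain ⟨α₀, s₀⟩ := q₀
  have h₁ : 0 ≤ α₀ := hq₀.1
  have h₂ : α₀ ≤ s₀ := hq₀.2.1
  rcases (h₁.trans h₂).eq_or_lt with rfl | hs₀
  · -- at `β = ∞` the radius of the spaces tends to zero
    obtain rfl : α₀ = 0 := le_antisymm h₂ h₁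
    refine squeeze (fun q => R * q.1 + G * (q.2 + q.1)) (by fun_prop) (by simp) ?_
    filter_upwards [self_mem_nhdsWithin] with q hq
    rw [paramOf_zero (q := (0, 0)) rfl]
    rcases (hq.1.trans hq.2.1).eq_or_lt with h | hs
    · rw [paramOf_zero h.symm, Q.distQ_fam_self hLA (Or.inr rfl)]
      exact zero_le
    · rw [paramOf_of_pos hs, fam_zero_top]
      rcases hq.1.eq_or_lt with h | hα
      · rw [← h, fam_zero]
        refine distQ_real_le Q.isUnitalEmbedding_inclC (Q.isPrecompactLip_LC (inv_pos.2 hs))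
          (by have := mul_nonneg hG.1 hs.le; rwa [mul_zero, zero_add, add_zero]) fun x => ?_
        obtain ⟨r, hr⟩ := Q.exists_scalar_LC hG (inv_pos.2 hs) x
        refine ⟨r, hr.trans_eq ?_⟩
        rw [inv_inv, mul_zero, zero_add, add_zero]
      · rw [Q.fam_of_pos hα]
        refine distQ_real_le Q.isUnitalEmbedding_inclT
          (Q.isPrecompactLip_LT hLA hα (inv_pos.2 hs))
          (by have := hG.1; have := hR.1; positivity) fun x => ?_
        obtain ⟨r, hr⟩ := Q.exists_scalar_LT hR hG hα (inv_pos.2 hs) x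
        rw [inv_inv] at hr
        exact ⟨r, hr⟩
  have hpos : ∀ᶠ q in 𝓝[triangle c] (α₀, s₀), 0 < q.2 :=
    nhdsWithin_le_nhds (continuous_snd.continuousAt.eventually (lt_mem_nhds hs₀))
  rcases h₁.eq_or_lt with rfl | hα₀
  · -- at `α = 0` the space is first moved to `α = 0` and then along that edge
    refine squeeze (fun q => (R * q.1 + q.1 * q.2⁻¹ * (R * q.1 + G * (q.2 + q.1)))
        + (|s₀⁻¹ / q.2⁻¹ - 1| + |q.2⁻¹ / s₀⁻¹ - 1|) * (G * q.2 + G * s₀)) ?_ ?_ ?_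
    · have := hs₀.ne'
      have := inv_ne_zero this
      fun_prop (disch := assumption)
    · simp [hs₀.ne']
    filter_upwards [self_mem_nhdsWithin, hpos] with q hq hs
    have hs' := inv_pos.2 hs
    have hs₀' := inv_pos.2 hs₀
    have hG0 := hG.1
    have hR0 := hR.1
    have hq₁ := hq.1
    have edge := Q.distQ_LC_LC_le hG hs' hs₀'
    rw [inv_inv, inv_inv] at edge
    have coll : distQ (Q.fam (paramOf q)) (Q.fam (0, ((q.2⁻¹ : ℝ) : WithTop ℝ)))
        ≤ ENNReal.ofReal (R * q.1 + q.1 * q.2⁻¹ * (R * q.1 + G * (q.2 + q.1))) := by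
      rw [paramOf_of_pos hs]
      rcases hq₁.eq_or_lt with h | hα
      · rw [← h, Q.distQ_fam_self hLA (Or.inl ⟨0, _, rfl, le_rfl, hs', by simp⟩)]
        exact zero_le
      · rw [fam_zero, Q.fam_of_pos hα]
        have := Q.distQ_LT_LC_le hLA hR hG hα hs'
        rwa [inv_inv] at this
    rw [ENNReal.ofReal_add (by positivity) (by positivity)]
    refine (Q.distQ_fam_triangle hLA (paramOf_mem hq)
      (Or.inl ⟨0, _, rfl, le_rfl, hs', by simp⟩) (paramOf_mem hq₀)).trans (add_le_add coll ?_)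
    rw [paramOf_of_pos (q := (0, s₀)) hs₀, fam_zero, fam_zero]
    exact edge
  · -- for `α > 0` nearby spaces are all of the form `A_T`
    have hpos' : ∀ᶠ q in 𝓝[triangle c] (α₀, s₀), 0 < q.1 :=
      nhdsWithin_le_nhds (continuous_fst.continuousAt.eventually (lt_mem_nhds hα₀))
    refine squeeze (fun q =>
      (2 * |q.2⁻¹ / s₀⁻¹ - 1| + |α₀ / q.1 - 1| + (2 * |s₀⁻¹ / q.2⁻¹ - 1| + |q.1 / α₀ - 1|)) *
        (R * q.1 + G * (q.2 + q.1) + (R * α₀ + G * (s₀ + α₀)))) ?_ ?_ ?_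
    · have := hα₀.ne'
      have := hs₀.ne'
      have := inv_ne_zero this
      fun_prop (disch := assumption)
    · simp [hs₀.ne', hα₀.ne']
    filter_upwards [hpos, hpos'] with q hs hα
    have := Q.distQ_LT_LT_le hLA hR hG hα (inv_pos.2 hs) hα₀ (inv_pos.2 hs₀)
    rw [inv_inv, inv_inv] at this
    rwa [paramOf_of_pos hs, paramOf_of_pos (q := (α₀, s₀)) hs₀, Q.fam_of_pos hα,
      Q.fam_of_pos hα₀]

/-- The parameters with `β ≥ β₀` are the continuous image of a compact triangle. -/
theorem isCompact_params (hLA : IsPrecompactLip Q.LA) {β₀ : ℝ} (hβ₀ : 0 < β₀) :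
    @IsCompact _ (Q.paramsPseudoMetric hLA).toUniformSpace.toTopologicalSpace
      {p : (params : Set (ℝ × WithTop ℝ)) | (β₀ : WithTop ℝ) ≤ p.1.2} := by
  have := isCompact_iff_compactSpace.1 (isCompact_triangle β₀⁻¹)
  let f : triangle β₀⁻¹ → (params : Set (ℝ × WithTop ℝ)) := fun q => ⟨paramOf q, paramOf_mem q.2⟩
  have key := @isCompact_range_of_tendsto_edist _ _ _ _
    (Q.paramsPseudoMetric hLA).toPseudoEMetricSpace f fun q => by
      rw [nhds_subtype_eq_comap_nhdsWithin]
      exact (Q.tendsto_distQ_fam hLA _ q.2).comp tendsto_comap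
  convert key
  ext p
  constructor
  · intro hp
    obtain ⟨q, hq, h⟩ := exists_paramOf_eq hβ₀ p.2 hp
    exact ⟨⟨q, hq⟩, Subtype.ext h⟩
  · rintro ⟨q, rfl⟩
    exact le_paramOf hβ₀ q.2

end ToeplitzQuadruple
end QMS

theorem mainTheorem9 {H : Type u} [NormedAddCommGroup H] [InnerProductSpace ℂ H]
    [CompleteSpace H] [Nontrivial H] (Q : QMS.ToeplitzQuadruple H)
    (hLA : QMS.OrderUnitSpace.IsLipNorm Q.LA) :
    (∀ p ∈ QMS.ToeplitzQuadruple.params, (Q.fam p).IsCompactQuantumMetricSpace) ∧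
    ∃ m : PseudoMetricSpace QMS.ToeplitzQuadruple.params,
      (∀ p q : QMS.ToeplitzQuadruple.params,
        @edist _ m.toPseudoEMetricSpace.toEDist p q = QMS.distQ (Q.fam p) (Q.fam q)) ∧
      ∀ β₀ : ℝ, 0 < β₀ →
        @IsCompact _ m.toUniformSpace.toTopologicalSpace
          {p : QMS.ToeplitzQuadruple.params | (β₀ : WithTop ℝ) ≤ p.1.2} := by
  have hLA' := Q.isPrecompactLip_LA hLA
  exact ⟨fun p hp => Q.isLipNorm_fam hLA' hp, Q.paramsPseudoMetric hLA', fun p q => rfl,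
    fun β₀ hβ₀ => Q.isCompact_params hLA' hβ₀⟩
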